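/- Let $d\in\mathbb N$, $T>0$, $\mathbb T^d=\mathbb R^d/\mathbb Z^d$. Let $\rho\in C^\infty(\mathbb R^d)$ be a Friedrichs mollifier ($\rho\ge 0$, $\operatorname{spt}\rho\subset \overline{B_1(0)}$, $\int\rho=1$), and for a function $f$ on $\mathbb T^d\times(0,T)$ let $f_\ell(x,t)=\int_{\mathbb R^d}\ell^{-d}\rho(y/\ell)f(x-y,t)\,dy$ be its mollification in space. All identities "in $\mathcal D'_{x,t}$" are tested against smooth functions with compact support in $\mathbb T^d\times(0,T)$. Let $\nu\ge 0$ and let $u\in L^3(\mathbb T^d\times(0,T);\mathbb R^d)$ be a weak solution of $$\partial_t u+\operatorname{div}(u\otimes u)+\nabla q=\nu\Delta u,\qquad \operatorname{div}u=0\qquad\text{in }\mathbb T^d\times(0,T),$$ that is, $\operatorname{div} u=0$ in $\mathcal D'_{x,t}$ and $\int \big(u\cdot\partial_t\Phi+u\otimes u:\nabla\Phi+\nu\, u\cdot\Delta\Phi\big)\,dx\,dt=0$ for every smooth compactly supported divergence-free field $\Phi$. Let the pressure $q\in L^1(\mathbb T^d\times(0,T))$ be the solution of $-\Delta q=\operatorname{div}\operatorname{div}(u\otimes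 u)$ in $\mathcal D'_{x,t}$ with zero spatial mean for a.e. $t$. If $\nu>0$, assume in addition $u\in L^2_tH^1_x$. Let $D$ be the Duchon--Robert distribution, defined by $$(\partial_t-\nu\Delta)\frac{|u|^2}{2}+\operatorname{div}\Big(\Big(\frac{|u|^2}{2}+q\Big)u\Big)+\nu|\nabla u|^2=-D\qquad\text{in }\mathcal D'_{x,t}$$ (the terms with $\nu$ being absent when $\nu=0$, the Euler case). For $\ell>0$ set $$E^\ell=\frac{|u-u_\ell|^2}{2},\qquad Q^\ell=\Big(\frac{|u-u_\ell|^2}{2}+(q-q_\ell)\Big)(u-u_\ell),\qquad R^\ell=u_\ell\otimes u_\ell-(u\otimes u)_\ell,$$ $$C^\ell=(u-u_\ell)\cdot\operatorname{div}R^\ell+(u-u_\ell)\otimes(u-u_\ell):\nabla u_\ell .$$ Then for every $\ell>0$ all these quantities are meaningful: for a.e. $t$ the functions $u_\ell$ and $R^\ell$ are smooth in $x$, and $|u|^2$, $(\frac{|u|^2}{2}+q)u$, $E^\ell$, $E^\ell u_\ell$, $E^\ell\operatorname{div}u_\ell$, $Q^\ell$, $C^\ell$, $|\nabla u_\ell|^2$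 and, if $\nu>0$, $|\nabla u|^2$ and $\nabla u:\nabla u_\ell$ are integrable on $\mathbb T^d\times(0,T)$. Moreover: 1. (Euler) If $\nu=0$, then $$-D=(\partial_t+u_\ell\cdot\nabla)E^\ell+\operatorname{div}Q^\ell+C^\ell\qquad\text{in }\mathcal D'_{x,t}.$$ 2. (Navier--Stokes) For every $\nu\ge0$, $$-\big(D+\nu|\nabla u|^2\big)=(\partial_t+u_\ell\cdot\nabla-\nu\Delta)E^\ell+\operatorname{div}Q^\ell+C^\ell+\nu|\nabla u_\ell|^2-2\nu\,\nabla u:\nabla u_\ell\qquad\text{in }\mathcal D'_{x,t},$$ where for $\nu=0$ the terms with the factor $\nu$ are absent. Here $\langle u_\ell\cdot\nabla E^\ell,\varphi\rangle=-\int E^\ell\operatorname{div}(\varphi u_\ell)\,dx\,dt$. -/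

import Mathlib

open MeasureTheory Set
open scoped ContDiff

namespace TorusFluid

/-! ### The torus, space-time, and derivatives on the torus -/

/-- The flat torus `𝕋^d = ℝ^d / ℤ^d`. Its `volume` is the normalized Lebesgue (Haar) measure. -/
abbrev Torus (d : ℕ) : Type := UnitAddTorus (Fin d)

/-- The Euclidean space `ℝ^d`, in which velocities take their values. -/
abbrev Vec (d : ℕ) : Type := EuclideanSpace ℝ (Fin d)

/-- The quotient map `ℝ^d → 𝕋^d`. -/
def proj {d : ℕ} (y : Vec d) : Torus d := fun i => ((y i : ℝ) : UnitAddCircle)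

/-- Lebesgue measure on `(0,T) × 𝕋^d`. -/
noncomputable def spaceTime (d : ℕ) (T : ℝ) : Measure (ℝ × Torus d) :=
  (volume.restrict (Ioo 0 T)).prod volume

/-- Smoothness of a function on the torus, read on its periodic lift to `ℝ^d`. -/
def SmoothOnTorus {d : ℕ} {F : Type*} [NormedAddCommGroup F] [NormedSpace ℝ F]
    (f : Torus d → F) : Prop :=
  ContDiff ℝ ∞ (fun y : Vec d => f (proj y))

/-- The partial derivative `∂_i f (x)` of a function on the torus. -/
noncomputable def pd {d : ℕ} {F : Type*} [NormedAddCommGroup F] [NormedSpace ℝ F]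
    (i : Fin d) (f : Torus d → F) (x : Torus d) : F :=
  deriv (fun s : ℝ => f (x + Pi.single i (s : UnitAddCircle))) 0

/-- The gradient of a scalar function. -/
noncomputable def grad {d : ℕ} (f : Torus d → ℝ) (x : Torus d) : Vec d :=
  WithLp.toLp 2 (fun i => pd i f x)

/-- The divergence of a vector field. -/
noncomputable def divg {d : ℕ} (v : Torus d → Vec d) (x : Torus d) : ℝ :=
  ∑ i, pd i (fun y => v y i) x

/-- The Laplacian (componentwise, for vector-valued functions). -/
noncomputable def lapl {d : ℕ} {F : Type*} [NormedAddCommGroup F] [NormedSpace ℝ F]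
    (f : Torus d → F) (x : Torus d) : F :=
  ∑ i, pd i (pd i f) x

/-- The Jacobian matrix of a vector field, with entries `(i, j) ↦ ∂_j v_i`. -/
noncomputable def jac {d : ℕ} (v : Torus d → Vec d) (x : Torus d) (i j : Fin d) : ℝ :=
  pd j (fun y => v y i) x

/-- The time derivative of a function of `(t, x)`. -/
noncomputable def dt {d : ℕ} {F : Type*} [NormedAddCommGroup F] [NormedSpace ℝ F]
    (f : ℝ → Torus d → F) (t : ℝ) (x : Torus d) : F :=
  deriv (fun s => f s x) t

/-- The Frobenius product `A : B` of matrices. -/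
def frob {d : ℕ} (A B : Fin d → Fin d → ℝ) : ℝ := ∑ i, ∑ j, A i j * B i j

/-! ### Test functions and distributions on `(0,T) × 𝕋^d` -/

/-- Test functions: smooth on `(0,T) × 𝕋^d` with compact support there (the torus is compact, so
this only restricts the support in time). -/
structure IsTest {d : ℕ} {F : Type*} [NormedAddCommGroup F] [NormedSpace ℝ F]
    (T : ℝ) (φ : ℝ → Torus d → F) : Prop where
  smooth : ContDiff ℝ ∞ (fun p : ℝ × Vec d => φ p.1 (proj p.2))
  support : ∃ a b : ℝ, 0 < a ∧ b < T ∧ ∀ t x, t ∉ Icc a b → φ t x = 0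

/-- The distribution given by a function `f`: `⟨f, φ⟩ = ∫ f φ`. -/
noncomputable def pair {d : ℕ} (T : ℝ) (f : ℝ → Torus d → ℝ) (φ : ℝ → Torus d → ℝ) : ℝ :=
  ∫ p, f p.1 p.2 * φ p.1 p.2 ∂(spaceTime d T)

/-- The distribution `∂_t f`: `⟨∂_t f, φ⟩ = - ∫ f ∂_t φ`. -/
noncomputable def pairDt {d : ℕ} (T : ℝ) (f : ℝ → Torus d → ℝ) (φ : ℝ → Torus d → ℝ) : ℝ :=
  -∫ p, f p.1 p.2 * dt φ p.1 p.2 ∂(spaceTime d T)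

/-- The distribution `Δ f`: `⟨Δ f, φ⟩ = ∫ f Δ φ`. -/
noncomputable def pairLapl {d : ℕ} (T : ℝ) (f : ℝ → Torus d → ℝ) (φ : ℝ → Torus d → ℝ) : ℝ :=
  ∫ p, f p.1 p.2 * lapl (φ p.1) p.2 ∂(spaceTime d T)

/-- The distribution `div V`: `⟨div V, φ⟩ = - ∫ V · ∇φ`. -/
noncomputable def pairDiv {d : ℕ} (T : ℝ) (V : ℝ → Torus d → Vec d) (φ : ℝ → Torus d → ℝ) : ℝ :=
  -∫ p, inner ℝ (V p.1 p.2) (grad (φ p.1) p.2) ∂(spaceTime d T)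

/-- The distribution `w · ∇ f`, for a vector field `w` that is smooth in space:
`⟨w · ∇ f, φ⟩ = ⟨∇ f, φ w⟩ = - ∫ f div (φ w)`. -/
noncomputable def pairTransport {d : ℕ} (T : ℝ) (w : ℝ → Torus d → Vec d)
    (f : ℝ → Torus d → ℝ) (φ : ℝ → Torus d → ℝ) : ℝ :=
  -∫ p, f p.1 p.2 * divg (fun y => φ p.1 y • w p.1 y) p.2 ∂(spaceTime d T)

/-! ### Weak solutions and the pressure -/

/-- Weak solutions of the incompressible Navier--Stokes equations
`∂_t u + div (u ⊗ u) + ∇q = ν Δ u`, `div u = 0` on `(0,T) × 𝕋^d`, defined by testing with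
divergence-free fields, without reference to the pressure. For `ν = 0` these are the weak solutions
of the incompressible Euler equations. -/
structure IsWeakSolution {d : ℕ} (T ν : ℝ) (u : ℝ → Torus d → Vec d) : Prop where
  momentum : ∀ Φ : ℝ → Torus d → Vec d, IsTest T Φ → (∀ t x, divg (Φ t) x = 0) →
    ∫ p, (inner ℝ (u p.1 p.2) (dt Φ p.1 p.2)
        + (∑ i, ∑ j, u p.1 p.2 i * u p.1 p.2 j * jac (Φ p.1) p.2 i j)
        + ν * inner ℝ (u p.1 p.2) (lapl (Φ p.1) p.2)) ∂(spaceTime d T) = 0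
  incompressible : ∀ φ : ℝ → Torus d → ℝ, IsTest T φ →
    ∫ p, inner ℝ (u p.1 p.2) (grad (φ p.1) p.2) ∂(spaceTime d T) = 0

/-- `q` is the pressure of `u`: the zero-mean solution of `-Δ q = div div (u ⊗ u)`, in the sense of
distributions. Only integrability is asked of `q`. -/
structure IsPressure {d : ℕ} (T : ℝ) (u : ℝ → Torus d → Vec d) (q : ℝ → Torus d → ℝ) : Prop where
  integrable : Integrable (fun p : ℝ × Torus d => q p.1 p.2) (spaceTime d T)
  zero_mean : ∀ᵐ t ∂(volume.restrict (Ioo 0 T)), ∫ x, q t x = 0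
  poisson : ∀ φ : ℝ → Torus d → ℝ, IsTest T φ →
    -∫ p, q p.1 p.2 * lapl (φ p.1) p.2 ∂(spaceTime d T) =
      ∫ p, (∑ i, ∑ j, u p.1 p.2 i * u p.1 p.2 j * pd i (pd j (φ p.1)) p.2) ∂(spaceTime d T)

/-- `u ∈ L²_t H¹_x`, with weak spatial gradient `G`, `G i j = ∂_j u_i`. -/
structure IsL2H1 {d : ℕ} (T : ℝ) (u : ℝ → Torus d → Vec d)
    (G : ℝ → Torus d → Fin d → Fin d → ℝ) : Prop where
  memLp : MemLp (fun p : ℝ × Torus d => u p.1 p.2) 2 (spaceTime d T)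
  grad_memLp : ∀ i j, MemLp (fun p : ℝ × Torus d => G p.1 p.2 i j) 2 (spaceTime d T)
  weak_grad : ∀ i j, ∀ φ : ℝ → Torus d → ℝ, IsTest T φ →
    ∫ p, u p.1 p.2 i * pd j (φ p.1) p.2 ∂(spaceTime d T) =
      -∫ p, G p.1 p.2 i j * φ p.1 p.2 ∂(spaceTime d T)

/-! ### The local energy balance -/

/-- The kinetic energy density `|u|² / 2`. -/
noncomputable def kinetic {d : ℕ} (u : ℝ → Torus d → Vec d) (t : ℝ) (x : Torus d) : ℝ :=
  ‖u t x‖ ^ 2 / 2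

/-- The energy flux `(|u|² / 2 + q) u`. -/
noncomputable def energyFlux {d : ℕ} (u : ℝ → Torus d → Vec d) (q : ℝ → Torus d → ℝ)
    (t : ℝ) (x : Torus d) : Vec d :=
  (‖u t x‖ ^ 2 / 2 + q t x) • u t x

/-- The Duchon--Robert distribution of a weak solution of the Euler equations, defined by
`∂_t (|u|² / 2) + div ((|u|² / 2 + q) u) = -D`. -/
noncomputable def duchonRobert {d : ℕ} (T : ℝ) (u : ℝ → Torus d → Vec d) (q : ℝ → Torus d → ℝ)
    (φ : ℝ → Torus d → ℝ) : ℝ :=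
  -(pairDt T (kinetic u) φ + pairDiv T (energyFlux u q) φ)

/-- The Duchon--Robert distribution of a weak solution of the Navier--Stokes equations with spatial
gradient `G`, defined by
`(∂_t - ν Δ) (|u|² / 2) + div ((|u|² / 2 + q) u) + ν |∇u|² = -D`. -/
noncomputable def duchonRobertNS {d : ℕ} (T ν : ℝ) (u : ℝ → Torus d → Vec d) (q : ℝ → Torus d → ℝ)
    (G : ℝ → Torus d → Fin d → Fin d → ℝ) (φ : ℝ → Torus d → ℝ) : ℝ :=
  -(pairDt T (kinetic u) φ - ν * pairLapl T (kinetic u) φ + pairDiv T (energyFlux u q) φ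
    + ν * pair T (fun t x => frob (G t x) (G t x)) φ)

/-! ### Space mollification and the terms of the modified energy identity -/

/-- Friedrichs mollifiers on `ℝ^d`. -/
structure IsMollifier {d : ℕ} (ρ : Vec d → ℝ) : Prop where
  smooth : ContDiff ℝ ∞ ρ
  nonneg : ∀ y, 0 ≤ ρ y
  support : tsupport ρ ⊆ Metric.closedBall 0 1
  integral_eq_one : ∫ y, ρ y = 1

/-- The mollification `f_ℓ = f * ρ_ℓ` of a function on the torus, `ρ_ℓ (y) = ℓ^{-d} ρ (y / ℓ)`. -/
noncomputable def moll {d : ℕ} {F : Type*} [NormedAddCommGroup F] [NormedSpace ℝ F]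
    (ρ : Vec d → ℝ) (ℓ : ℝ) (f : Torus d → F) (x : Torus d) : F :=
  ∫ y : Vec d, ((ℓ ^ d)⁻¹ * ρ (ℓ⁻¹ • y)) • f (x - proj y)

/-- The fluctuation `u - u_ℓ`. -/
noncomputable def fluct {d : ℕ} (ρ : Vec d → ℝ) (ℓ : ℝ) (u : ℝ → Torus d → Vec d)
    (t : ℝ) (x : Torus d) : Vec d :=
  u t x - moll ρ ℓ (u t) x

/-- `E^ℓ = |u - u_ℓ|² / 2`. -/
noncomputable def Eterm {d : ℕ} (ρ : Vec d → ℝ) (ℓ : ℝ) (u : ℝ → Torus d → Vec d)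
    (t : ℝ) (x : Torus d) : ℝ :=
  ‖fluct ρ ℓ u t x‖ ^ 2 / 2

/-- `Q^ℓ = (|u - u_ℓ|² / 2 + (q - q_ℓ)) (u - u_ℓ)`. -/
noncomputable def Qterm {d : ℕ} (ρ : Vec d → ℝ) (ℓ : ℝ) (u : ℝ → Torus d → Vec d)
    (q : ℝ → Torus d → ℝ) (t : ℝ) (x : Torus d) : Vec d :=
  (‖fluct ρ ℓ u t x‖ ^ 2 / 2 + (q t x - moll ρ ℓ (q t) x)) • fluct ρ ℓ u t x

/-- `R^ℓ = u_ℓ ⊗ u_ℓ - (u ⊗ u)_ℓ`. -/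
noncomputable def Rterm {d : ℕ} (ρ : Vec d → ℝ) (ℓ : ℝ) (u : ℝ → Torus d → Vec d)
    (t : ℝ) (x : Torus d) (i j : Fin d) : ℝ :=
  moll ρ ℓ (u t) x i * moll ρ ℓ (u t) x j - moll ρ ℓ (fun y => u t y i * u t y j) x

/-- `C^ℓ = (u - u_ℓ) · div R^ℓ + (u - u_ℓ) ⊗ (u - u_ℓ) : ∇u_ℓ`. -/
noncomputable def Cterm {d : ℕ} (ρ : Vec d → ℝ) (ℓ : ℝ) (u : ℝ → Torus d → Vec d)
    (t : ℝ) (x : Torus d) : ℝ :=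
  (∑ i, fluct ρ ℓ u t x i * ∑ j, pd j (fun y => Rterm ρ ℓ u t y i j) x)
    + frob (fun i j => fluct ρ ℓ u t x i * fluct ρ ℓ u t x j) (jac (moll ρ ℓ (u t)) x)

/-- Every term of the energy balance and of the modified energy identity is meaningful: the
functions that are differentiated in the classical sense are smooth in space, and the functions that
define distributions are integrable on `(0,T) × 𝕋^d`. -/
structure TermsMeaningful {d : ℕ} (T : ℝ) (ρ : Vec d → ℝ) (ℓ : ℝ) (u : ℝ → Torus d → Vec d)
    (q : ℝ → Torus d → ℝ) : Prop where
  smooth_moll : ∀ᵐ t ∂(volume.restrict (Ioo 0 T)), SmoothOnTorus (moll ρ ℓ (u t))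
  smooth_R : ∀ᵐ t ∂(volume.restrict (Ioo 0 T)), ∀ i j, SmoothOnTorus (fun x => Rterm ρ ℓ u t x i j)
  integrable_kinetic : Integrable (fun p : ℝ × Torus d => kinetic u p.1 p.2) (spaceTime d T)
  integrable_flux : Integrable (fun p : ℝ × Torus d => energyFlux u q p.1 p.2) (spaceTime d T)
  integrable_E : Integrable (fun p : ℝ × Torus d => Eterm ρ ℓ u p.1 p.2) (spaceTime d T)
  integrable_E_moll : Integrable
    (fun p : ℝ × Torus d => Eterm ρ ℓ u p.1 p.2 • moll ρ ℓ (u p.1) p.2) (spaceTime d T)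
  integrable_E_div : Integrable
    (fun p : ℝ × Torus d => Eterm ρ ℓ u p.1 p.2 * divg (moll ρ ℓ (u p.1)) p.2) (spaceTime d T)
  integrable_Q : Integrable (fun p : ℝ × Torus d => Qterm ρ ℓ u q p.1 p.2) (spaceTime d T)
  integrable_C : Integrable (fun p : ℝ × Torus d => Cterm ρ ℓ u p.1 p.2) (spaceTime d T)

end TorusFluid

open TorusFluid

/-!
The balance laws are obtained by subtracting, from the energy balance that defines the
Duchon–Robert distribution, the evolution of `u · u_ℓ` and of `|u_ℓ|² / 2`; since
`|u - u_ℓ|² / 2 = |u|² / 2 - u · u_ℓ + |u_ℓ|² / 2`, the rest is algebra. The work lies in making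
sense of these evolutions for a solution that is only in `L³` and only tested with divergence-free
fields.

*Mollification.* The mollification over `ℝ^d` is the convolution on the torus with a smooth kernel,
the periodization of the scaled mollifier (`moll_eq_conv`). Everything is proved for convolutions
`K * u` with an arbitrary smooth kernel `K` on the torus.

*Pressure in the equation.* Testing with one Fourier mode at a time, the divergence-free test fields
see the part of each Fourier coefficient orthogonal to its frequency, and the Poisson equation
provides the part along the frequency. Together they give the momentum equation with pressure on all
modes (`sepPair_momentum_pressure`). A distribution that vanishes on all modes vanishes after
convolution with a smooth kernel (`conv_eq_zero_of_tmode`), so at every point `x` the function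
`t ↦ (K * u_i)(t, x)` has an integrable weak derivative (`hasWeakDeriv_conv`), and products of two
such functions obey the product rule (`HasWeakDeriv.integral_mul`).

*Integrability of the pressure.* The flux `q u` is integrable because `q ∈ L^{3/2}`
(`IsPressure.memLp`), which is the Calderón–Zygmund estimate for `q = -∑ R_i R_j (u_i u_j)`. It is
proved with a Bellman function, an explicit function `bell` of two variables comparable to
`|x|^{3/2} + |y|³`, whose Hessian dominates the product of the increments (`bell_hessian_ge`).
Monotonicity of a Bellman functional along the heat flow gives the bilinear bound of `R_i R_j`
between `L^{3/2}` and `L³` on trigonometric polynomials (`riesz_bilinear_bell`), and density and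
duality give the bound on `L^{3/2}` (`exists_riesz`, `eLpNorm_pressure_le`).

*Evolution of the correlation.* The product rule applies to `(k * u) · (K * u)`. Since `φ (K * u)`
and its derivatives in space are continuous in space, the kernel `k` can be concentrated at zero
with `K` fixed (`tendsto_integral_conv_mul`), which yields the evolution of `u · (K * u)`
(`integral_u_mul_conv_mul_dt`).

*Conclusion.* The integrands of the two sides differ by the two evolutions above, by total
derivatives with vanishing integral (`integralZero_u_grad`, `integralZero_fluct_grad`,
`integralZero_green`), and by the viscous term `∇u : ∇u_ℓ` integrated by parts
(`integral_u_mul_pd_eq`). This is the pointwise identity `energy_algebra`, and its integral is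
`fluct_energy_identity`.
-/

namespace TorusFluid

/-! ### The covering map and invariance of the measure -/

section Covering

variable {d : ℕ}

instance : IsProbabilityMeasure (volume : Measure UnitAddCircle) :=
  ⟨by rw [AddCircle.measure_univ]; simp⟩

instance : (volume : Measure (Torus d)).IsNegInvariant :=
  Measure.IsAddHaarMeasure.isNegInvariant_of_regular _

theorem continuous_proj : Continuous (proj : Vec d → Torus d) := by
  unfold proj
  refine continuous_pi fun i => ?_
  exact (AddCircle.continuous_mk' (1:ℝ)).comp (by fun_prop)

theorem proj_surjective : Function.Surjective (proj : Vec d → Torus d) := by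
  intro x
  choose y hy using fun i => QuotientAddGroup.mk_surjective (x i)
  exact ⟨WithLp.toLp 2 y, funext hy⟩

theorem isOpenQuotientMap_proj : IsOpenQuotientMap (proj : Vec d → Torus d) := by
  refine ⟨proj_surjective, continuous_proj, ?_⟩
  have h : IsOpenMap (Pi.map fun (_ : Fin d) (s : ℝ) => (s : UnitAddCircle)) :=
    IsOpenMap.piMap (fun i => QuotientAddGroup.isOpenMap_coe)
      (by simp [QuotientAddGroup.mk_surjective])
  exact h.comp (EuclideanSpace.equiv (Fin d) ℝ).toHomeomorph.isOpenMap

theorem proj_add (y z : Vec d) : proj (y + z) = proj y + proj z := by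
  ext i; simp [proj]

theorem proj_sub (y z : Vec d) : proj (y - z) = proj y - proj z := by
  ext i; simp [proj]

theorem proj_neg (y : Vec d) : proj (-y) = -proj y := by
  ext i; simp [proj]

theorem proj_single (i : Fin d) (s : ℝ) :
    proj (EuclideanSpace.single i s) = Pi.single i (s : UnitAddCircle) := by
  ext j
  by_cases h : j = i
  · subst h; simp [proj]
  · simp [proj, h]

theorem proj_add_smul_single (y : Vec d) (i : Fin d) (s : ℝ) :
    proj (y + s • EuclideanSpace.single i (1:ℝ)) = proj y + Pi.single i (s : UnitAddCircle) := by
  rw [proj_add, ← proj_single]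
  congr 2
  ext j; simp

end Covering

/-! ### Partial derivatives on the torus -/

section Calculus

variable {d : ℕ} {F : Type*} [NormedAddCommGroup F] [NormedSpace ℝ F]

/-- `f'` is the partial derivative of `f` in the direction `i`, at every point of the torus. -/
def HasPd (i : Fin d) (f f' : Torus d → F) : Prop :=
  ∀ x, HasDerivAt (fun s : ℝ => f (x + Pi.single i (s : UnitAddCircle))) (f' x) 0

theorem HasPd.pd_eq {i : Fin d} {f f' : Torus d → F} (h : HasPd i f f') : pd i f = f' :=
  funext fun x => (h x).deriv

theorem HasPd.hasDerivAt {i : Fin d} {f f' : Torus d → F} (h : HasPd i f f') (x : Torus d)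
    (s : ℝ) : HasDerivAt (fun s : ℝ => f (x + Pi.single i (s : UnitAddCircle)))
      (f' (x + Pi.single i (s : UnitAddCircle))) s := by
  have h1 := h (x + Pi.single i (s : UnitAddCircle))
  have h2 : HasDerivAt (fun r : ℝ => r - s) 1 s := (hasDerivAt_id s).sub_const s
  have h3 := HasDerivAt.scomp_of_eq s h1 h2 (by simp)
  rw [one_smul] at h3
  refine h3.congr_of_eventuallyEq (Filter.Eventually.of_forall fun r => ?_)
  simp [add_assoc, ← Pi.single_add]

theorem HasPd.add {i : Fin d} {f f' g g' : Torus d → F} (hf : HasPd i f f') (hg : HasPd i g g') :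
    HasPd i (fun x => f x + g x) (fun x => f' x + g' x) := fun x => (hf x).add (hg x)

theorem HasPd.sub {i : Fin d} {f f' g g' : Torus d → F} (hf : HasPd i f f') (hg : HasPd i g g') :
    HasPd i (fun x => f x - g x) (fun x => f' x - g' x) := fun x => (hf x).sub (hg x)

theorem HasPd.sum {ι : Type*} (s : Finset ι) {i : Fin d} {f f' : ι → Torus d → F}
    (h : ∀ k ∈ s, HasPd i (f k) (f' k)) :
    HasPd i (fun x => ∑ k ∈ s, f k x) (fun x => ∑ k ∈ s, f' k x) :=
  fun x => HasDerivAt.fun_sum fun k hk => h k hk x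

theorem HasPd.mul {i : Fin d} {f f' g g' : Torus d → ℝ} (hf : HasPd i f f') (hg : HasPd i g g') :
    HasPd i (fun x => f x * g x) (fun x => f' x * g x + f x * g' x) := fun x => by
  simpa using! (hf x).mul (hg x)

theorem HasPd.const_mul {i : Fin d} {f f' : Torus d → ℝ} (c : ℝ) (hf : HasPd i f f') :
    HasPd i (fun x => c * f x) (fun x => c * f' x) := fun x => (hf x).const_mul c

theorem HasPd.smul_const {i : Fin d} {f f' : Torus d → ℝ} (hf : HasPd i f f') (c : F) :
    HasPd i (fun x => f x • c) (fun x => f' x • c) := fun x => (hf x).smul_const c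

theorem HasPd.comp_add {i : Fin d} {f f' : Torus d → F} (hf : HasPd i f f') (a : Torus d) :
    HasPd i (fun x => f (a + x)) (fun x => f' (a + x)) := fun x => by
  simpa [add_assoc] using hf (a + x)

theorem HasPd.comp_neg {i : Fin d} {f f' : Torus d → F} (hf : HasPd i f f') :
    HasPd i (fun x => f (-x)) (fun x => -f' (-x)) := fun x => by
  have h3 := HasDerivAt.scomp_of_eq (0:ℝ) (hf (-x)) (hasDerivAt_neg (0:ℝ)) (by simp)
  rw [neg_one_smul] at h3
  refine h3.congr_of_eventuallyEq (Filter.Eventually.of_forall fun r => ?_)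
  simp [add_comm, Pi.single_neg]

theorem HasPd.congr {i : Fin d} {f f' g' : Torus d → F} (hf : HasPd i f f')
    (h : ∀ x, f' x = g' x) : HasPd i f g' := fun x => h x ▸ hf x

/-- A continuous function on the torus is bounded. -/
theorem exists_norm_le {X G : Type*} [TopologicalSpace X] [CompactSpace X]
    [SeminormedAddCommGroup G] {f : X → G} (hf : Continuous f) : ∃ C, 0 ≤ C ∧ ∀ x, ‖f x‖ ≤ C := by
  obtain ⟨C, hC⟩ := isCompact_univ.exists_bound_of_continuousOn hf.continuousOn
  exact ⟨max C 0, le_max_right _ _, fun x => (hC x (mem_univ x)).trans (le_max_left _ _)⟩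

theorem integrable_of_continuous {G : Type*} [NormedAddCommGroup G] {f : Torus d → G}
    (hf : Continuous f) : Integrable f := by
  obtain ⟨C, -, hC⟩ := exists_norm_le hf
  exact Integrable.of_bound hf.aestronglyMeasurable_of_compactSpace C
    (Filter.Eventually.of_forall hC)

/-- Partial derivatives integrate to zero, because the measure is translation invariant. -/
theorem HasPd.integral_eq_zero {i : Fin d} {f f' : Torus d → ℝ} (h : HasPd i f f')
    (hf : Continuous f) (hf' : Continuous f') : ∫ x, f' x = 0 := by
  obtain ⟨C, -, hC⟩ := exists_norm_le hf'
  have key := hasDerivAt_integral_of_dominated_loc_of_deriv_le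
    (F := fun (s : ℝ) x => f (x + Pi.single i (s : UnitAddCircle)))
    (F' := fun (s : ℝ) x => f' (x + Pi.single i (s : UnitAddCircle)))
    (x₀ := (0:ℝ)) (s := univ) (μ := (volume : Measure (Torus d))) (bound := fun _ => C)
    Filter.univ_mem
    (Filter.Eventually.of_forall fun s =>
      (by fun_prop : Continuous _).aestronglyMeasurable)
    (by simpa using integrable_of_continuous hf)
    (by fun_prop : Continuous _).aestronglyMeasurable
    (Filter.Eventually.of_forall fun x s _ => hC _) (integrable_const C)
    (Filter.Eventually.of_forall fun x s _ => h.hasDerivAt x s)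
  have h2 : (fun s : ℝ => ∫ x : Torus d, f (x + Pi.single i (s : UnitAddCircle))) =
      fun _ => ∫ x : Torus d, f x := funext fun s => integral_add_right_eq_self f _
  have h3 := key.2
  rw [h2] at h3
  simpa using h3.unique (hasDerivAt_const _ _)

/-- Integration by parts on the torus. -/
theorem HasPd.integral_mul_eq {i : Fin d} {f f' g g' : Torus d → ℝ} (hf : HasPd i f f')
    (hg : HasPd i g g') (cf : Continuous f) (cf' : Continuous f') (cg : Continuous g)
    (cg' : Continuous g') : ∫ x, f' x * g x = -∫ x, f x * g' x := by
  have h := (hf.mul hg).integral_eq_zero (by fun_prop) (by fun_prop)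
  rw [integral_add (integrable_of_continuous (by fun_prop))
    (integrable_of_continuous (by fun_prop))] at h
  linarith

theorem SmoothOnTorus.continuous {f : Torus d → F} (hf : SmoothOnTorus f) : Continuous f :=
  isOpenQuotientMap_proj.isQuotientMap.continuous_iff.2 (ContDiff.continuous hf)

theorem SmoothOnTorus.hasPd {f : Torus d → F} (hf : SmoothOnTorus f) (i : Fin d) :
    HasPd i f (pd i f) := by
  intro x
  obtain ⟨y, rfl⟩ := proj_surjective x
  refine DifferentiableAt.hasDerivAt ?_
  simp_rw [← proj_add_smul_single]
  exact (((ContDiff.differentiable hf (by simp)).comp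
    (by fun_prop : Differentiable ℝ fun s : ℝ => y + s • EuclideanSpace.single i (1:ℝ)))) 0

theorem pd_proj {f : Torus d → F} (hf : SmoothOnTorus f) (i : Fin d) (y : Vec d) :
    pd i f (proj y) = fderiv ℝ (fun y : Vec d => f (proj y)) y (EuclideanSpace.single i 1) := by
  unfold pd
  simp_rw [← proj_add_smul_single]
  have h1 : HasDerivAt (fun s : ℝ => y + s • EuclideanSpace.single i (1:ℝ))
      (EuclideanSpace.single i (1:ℝ)) 0 := by
    simpa using ((hasDerivAt_id (0:ℝ)).smul_const (EuclideanSpace.single i (1:ℝ))).const_add y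
  have h2 := (ContDiff.differentiable hf (by simp) y).hasFDerivAt
  have h3 := HasFDerivAt.comp_hasDerivAt_of_eq (0:ℝ) h2 h1 (by simp)
  exact h3.deriv

theorem SmoothOnTorus.pd {f : Torus d → F} (hf : SmoothOnTorus f) (i : Fin d) :
    SmoothOnTorus (pd i f) := by
  unfold SmoothOnTorus
  simp_rw [pd_proj hf]
  exact (ContDiff.fderiv_right hf (by simp)).clm_apply contDiff_const

theorem SmoothOnTorus.const (c : F) : SmoothOnTorus (fun _ : Torus d => c) := contDiff_const

theorem SmoothOnTorus.sub {f g : Torus d → F} (hf : SmoothOnTorus f) (hg : SmoothOnTorus g) :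
    SmoothOnTorus (fun x => f x - g x) := ContDiff.sub hf hg

theorem SmoothOnTorus.mul {f g : Torus d → ℝ} (hf : SmoothOnTorus f) (hg : SmoothOnTorus g) :
    SmoothOnTorus (fun x => f x * g x) := ContDiff.mul hf hg

theorem SmoothOnTorus.sum {ι : Type*} (s : Finset ι) {f : ι → Torus d → F}
    (h : ∀ k ∈ s, SmoothOnTorus (f k)) : SmoothOnTorus (fun x => ∑ k ∈ s, f k x) :=
  ContDiff.sum h

theorem SmoothOnTorus.comp_add {f : Torus d → F} (hf : SmoothOnTorus f) (a : Torus d) :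
    SmoothOnTorus (fun x => f (a + x)) := by
  obtain ⟨b, rfl⟩ := proj_surjective a
  unfold SmoothOnTorus
  simp_rw [← proj_add]
  have h : ContDiff ℝ ∞ fun y : Vec d => f (proj y) := hf
  exact h.comp (by fun_prop : ContDiff ℝ ∞ fun y : Vec d => b + y)

theorem SmoothOnTorus.comp_neg {f : Torus d → F} (hf : SmoothOnTorus f) :
    SmoothOnTorus (fun x => f (-x)) := by
  unfold SmoothOnTorus
  simp_rw [← proj_neg]
  have h : ContDiff ℝ ∞ fun y : Vec d => f (proj y) := hf
  exact h.comp (by fun_prop : ContDiff ℝ ∞ fun y : Vec d => -y)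

end Calculus

/-! ### Test functions -/

section Tests

variable {d : ℕ} {F : Type*} [NormedAddCommGroup F] [NormedSpace ℝ F] {T : ℝ}
  {φ : ℝ → Torus d → F}

theorem IsTest.smoothOnTorus (h : IsTest T φ) (t : ℝ) : SmoothOnTorus (φ t) := by
  have h' := h.smooth.comp (by fun_prop : ContDiff ℝ ∞ fun y : Vec d => (t, y))
  exact h'

theorem IsTest.continuous (h : IsTest T φ) : Continuous fun p : ℝ × Torus d => φ p.1 p.2 := by
  have hq : IsOpenQuotientMap (Prod.map id proj : ℝ × Vec d → ℝ × Torus d) :=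
    IsOpenQuotientMap.id.prodMap isOpenQuotientMap_proj
  exact hq.isQuotientMap.continuous_iff.2 h.smooth.continuous

theorem IsTest.exists_norm_le (h : IsTest T φ) : ∃ C, 0 ≤ C ∧ ∀ t x, ‖φ t x‖ ≤ C := by
  obtain ⟨a, b, -, -, hs⟩ := h.support
  obtain ⟨C, hC⟩ := (isCompact_Icc (a := a) (b := b)).prod (isCompact_univ (X := Torus d))
    |>.exists_bound_of_continuousOn h.continuous.continuousOn
  refine ⟨max C 0, le_max_right _ _, fun t x => ?_⟩
  by_cases ht : t ∈ Icc a b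
  · exact (hC (t, x) ⟨ht, mem_univ _⟩).trans (le_max_left _ _)
  · rw [hs t x ht, norm_zero]; exact le_max_right _ _

theorem IsTest.pd (h : IsTest T φ) (i : Fin d) : IsTest T (fun t => pd i (φ t)) := by
  refine ⟨?_, ?_⟩
  · have : (fun p : ℝ × Vec d => TorusFluid.pd i (φ p.1) (proj p.2)) = fun p : ℝ × Vec d =>
        fderiv ℝ (fun p : ℝ × Vec d => φ p.1 (proj p.2)) p (0, EuclideanSpace.single i 1) := by
      ext p
      obtain ⟨t, y⟩ := p
      rw [pd_proj (h.smoothOnTorus t)]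
      have h2 := (h.smooth.differentiable (by simp) (t, y)).hasFDerivAt
      have h1 : HasFDerivAt (fun y : Vec d => (t, y)) (ContinuousLinearMap.inr ℝ ℝ (Vec d)) y :=
        hasFDerivAt_prodMk_right t y
      rw [show (fun y : Vec d => φ t (proj y)) =
        (fun p : ℝ × Vec d => φ p.1 (proj p.2)) ∘ fun y : Vec d => (t, y) from rfl,
        (HasFDerivAt.comp y h2 h1).fderiv]
      simp
    change ContDiff ℝ ∞ (fun p : ℝ × Vec d => TorusFluid.pd i (φ p.1) (proj p.2))
    rw [this]
    exact (h.smooth.fderiv_right (by simp)).clm_apply contDiff_const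
  · obtain ⟨a, b, ha, hb, hs⟩ := h.support
    refine ⟨a, b, ha, hb, fun t x ht => ?_⟩
    simp [TorusFluid.pd, hs t _ ht]

theorem IsTest.dt (h : IsTest T φ) : IsTest T (dt φ) := by
  refine ⟨?_, ?_⟩
  · have : (fun p : ℝ × Vec d => TorusFluid.dt φ p.1 (proj p.2)) = fun p : ℝ × Vec d =>
        fderiv ℝ (fun p : ℝ × Vec d => φ p.1 (proj p.2)) p (1, 0) := by
      ext p
      obtain ⟨t, y⟩ := p
      have h2 := (h.smooth.differentiable (by simp) (t, y)).hasFDerivAt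
      have h1 : HasDerivAt (fun s : ℝ => (s, y)) ((1:ℝ), (0 : Vec d)) t :=
        (hasDerivAt_id t).prodMk (hasDerivAt_const t y)
      exact (HasFDerivAt.comp_hasDerivAt t h2 h1).deriv
    rw [this]
    exact (h.smooth.fderiv_right (by simp)).clm_apply contDiff_const
  · obtain ⟨a, b, ha, hb, hs⟩ := h.support
    refine ⟨a, b, ha, hb, fun t x ht => ?_⟩
    have hev : (fun s => φ s x) =ᶠ[nhds t] fun _ => 0 := by
      filter_upwards [isClosed_Icc.isOpen_compl.mem_nhds ht] with s hs' using hs s x hs'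
    change deriv (fun s => φ s x) t = 0
    rw [hev.deriv_eq, deriv_const]

theorem IsTest.sum {ι : Type*} (s : Finset ι) {f : ι → ℝ → Torus d → F}
    (hf : ∀ k ∈ s, IsTest T (f k)) (hT : 0 < T) : IsTest T (fun t x => ∑ k ∈ s, f k t x) := by
  classical
  induction s using Finset.induction_on with
  | empty => exact ⟨by simpa using contDiff_const, T / 3, T / 2, by linarith, by linarith, by simp⟩
  | insert k s hk ih =>
    have h1 := hf k (Finset.mem_insert_self _ _)
    have h2 := ih fun j hj => hf j (Finset.mem_insert_of_mem hj)
    simp_rw [Finset.sum_insert hk]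
    refine ⟨h1.smooth.add h2.smooth, ?_⟩
    obtain ⟨a, b, ha, hb, hs⟩ := h1.support
    obtain ⟨a', b', ha', hb', hs'⟩ := h2.support
    refine ⟨min a a', max b b', lt_min ha ha', max_lt hb hb', fun t x ht => ?_⟩
    rw [hs t x (fun h => ht ⟨(min_le_left _ _).trans h.1, h.2.trans (le_max_left _ _)⟩),
      hs' t x (fun h => ht ⟨(min_le_right _ _).trans h.1, h.2.trans (le_max_right _ _)⟩),
      add_zero]

end Tests

/-! ### Convolution on the torus -/

section Convolution

variable {d : ℕ}

/-- The convolution `x ↦ ∫ K (x - z) f (z) dz` on the torus. -/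
noncomputable def conv (K f : Torus d → ℝ) (x : Torus d) : ℝ := ∫ z, K (x - z) * f z

/-- Product of a bounded continuous kernel with an integrable function. -/
theorem integrable_continuous_mul {X : Type*} [TopologicalSpace X] [CompactSpace X]
    [MeasurableSpace X] [OpensMeasurableSpace X] {μ : Measure X} {K f : X → ℝ}
    (hK : Continuous K) (hf : Integrable f μ) : Integrable (fun z => K z * f z) μ := by
  obtain ⟨C, -, hC⟩ := exists_norm_le hK
  exact hf.bdd_mul hK.aestronglyMeasurable_of_compactSpace (c := C)
    (Filter.Eventually.of_forall hC)

theorem integrable_conv_integrand {K f : Torus d → ℝ} (hK : Continuous K) (hf : Integrable f)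
    (x : Torus d) : Integrable fun z => K (x - z) * f z :=
  integrable_continuous_mul (by fun_prop) hf

theorem abs_conv_le {K f : Torus d → ℝ} {C : ℝ} (hK : Continuous K) (hC : ∀ x, ‖K x‖ ≤ C)
    (hf : Integrable f) (x : Torus d) : |conv K f x| ≤ C * ∫ z, |f z| := by
  rw [← integral_const_mul]
  refine (norm_integral_le_integral_norm _).trans
    (integral_mono (integrable_conv_integrand hK hf x).norm (hf.abs.const_mul C) fun z => ?_)
  change ‖K (x - z) * f z‖ ≤ C * |f z|
  rw [norm_mul, Real.norm_eq_abs (f z)]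
  exact mul_le_mul_of_nonneg_right (hC _) (abs_nonneg _)

theorem continuous_conv {K f : Torus d → ℝ} (hK : Continuous K) (hf : Integrable f) :
    Continuous (conv K f) := by
  obtain ⟨C, -, hC⟩ := exists_norm_le hK
  refine continuous_of_dominated (bound := fun z => C * |f z|)
    (fun x => (integrable_conv_integrand hK hf x).aestronglyMeasurable)
    (fun x => Filter.Eventually.of_forall fun z => ?_) (hf.abs.const_mul C)
    (Filter.Eventually.of_forall fun z => by fun_prop)
  rw [norm_mul, Real.norm_eq_abs (f z)]
  exact mul_le_mul_of_nonneg_right (hC _) (abs_nonneg _)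

theorem HasPd.conv {K K' f : Torus d → ℝ} {i : Fin d} (h : HasPd i K K') (hK : Continuous K)
    (hK' : Continuous K') (hf : Integrable f) : HasPd i (conv K f) (conv K' f) := by
  intro x
  obtain ⟨C, -, hC⟩ := exists_norm_le hK'
  have key := hasDerivAt_integral_of_dominated_loc_of_deriv_le
    (F := fun (s : ℝ) z => K (x + Pi.single i (s : UnitAddCircle) - z) * f z)
    (F' := fun (s : ℝ) z => K' (x + Pi.single i (s : UnitAddCircle) - z) * f z)
    (x₀ := (0:ℝ)) (s := univ) (μ := (volume : Measure (Torus d))) (bound := fun z => C * |f z|)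
    Filter.univ_mem
    (Filter.Eventually.of_forall fun s =>
      (integrable_conv_integrand hK hf _).aestronglyMeasurable)
    (integrable_conv_integrand hK hf _)
    (integrable_conv_integrand hK' hf _).aestronglyMeasurable
    (Filter.Eventually.of_forall fun z s _ => by
      rw [norm_mul, Real.norm_eq_abs (f z)]
      exact mul_le_mul_of_nonneg_right (hC _) (abs_nonneg _))
    (hf.abs.const_mul C)
    (Filter.Eventually.of_forall fun z s _ => by
      have := (h.hasDerivAt (x - z) s).mul_const (f z)
      simpa [sub_add_eq_add_sub] using this)
  simpa [TorusFluid.conv] using key.2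

/-- The total derivative, as a linear form, assembled from the partial derivatives. -/
noncomputable def totalPd (K : Torus d → ℝ) (x : Torus d) : Vec d →L[ℝ] ℝ :=
  ∑ i, pd i K x • EuclideanSpace.proj (𝕜 := ℝ) i

theorem SmoothOnTorus.hasFDerivAt {K : Torus d → ℝ} (hK : SmoothOnTorus K) (y : Vec d) :
    HasFDerivAt (fun y : Vec d => K (proj y)) (totalPd K (proj y)) y := by
  have h := (ContDiff.differentiable hK (by simp) y).hasFDerivAt
  refine h.congr_fderiv ?_
  ext v
  have hv : v = ∑ i, v i • EuclideanSpace.single i (1:ℝ) := by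
    ext j; simp [Finset.sum_apply, Pi.single_apply]
  conv_lhs => rw [hv]
  rw [map_sum]
  simp [totalPd, pd_proj hK, mul_comm]

theorem SmoothOnTorus.continuous_totalPd {K : Torus d → ℝ} (hK : SmoothOnTorus K) :
    Continuous (totalPd K) :=
  continuous_finsetSum _ fun i _ => (hK.pd i).continuous.smul continuous_const

theorem hasFDerivAt_conv {K f : Torus d → ℝ} (hK : SmoothOnTorus K) (hf : Integrable f)
    (y : Vec d) : HasFDerivAt (fun y : Vec d => conv K f (proj y))
      (∑ i, conv (pd i K) f (proj y) • EuclideanSpace.proj (𝕜 := ℝ) i) y := by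
  obtain ⟨C, -, hC⟩ := exists_norm_le hK.continuous_totalPd
  have hbd : ∀ z (y : Vec d), ‖f z • totalPd K (proj y - z)‖ ≤ C * |f z| := fun z y => by
    rw [norm_smul, Real.norm_eq_abs, mul_comm]
    exact mul_le_mul_of_nonneg_right (hC _) (abs_nonneg _)
  have hm : AEStronglyMeasurable (fun z => f z • totalPd K (proj y - z)) volume :=
    hf.aestronglyMeasurable.smul
      (hK.continuous_totalPd.comp (by fun_prop)).aestronglyMeasurable_of_compactSpace
  have hd : ∀ z (y : Vec d), HasFDerivAt (fun y : Vec d => f z * K (proj y - z))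
      (f z • totalPd K (proj y - z)) y := fun z y => by
    obtain ⟨w, rfl⟩ := proj_surjective z
    simp_rw [← proj_sub]
    have h1 : HasFDerivAt (fun y : Vec d => K (proj (y - w))) (totalPd K (proj (y - w))) y := by
      simpa using! (hK.hasFDerivAt (y - w)).comp y ((hasFDerivAt_id y).sub_const w)
    exact h1.const_mul _
  have hF : ∀ y : Vec d, Integrable fun z => f z * K (proj y - z) := fun y => by
    simpa only [mul_comm] using integrable_conv_integrand hK.continuous hf (proj y)
  have key := hasFDerivAt_integral_of_dominated_of_fderiv_le (𝕜 := ℝ)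
    (F := fun (y : Vec d) z => f z * K (proj y - z))
    (F' := fun (y : Vec d) z => f z • totalPd K (proj y - z))
    (x₀ := y) (s := univ) (μ := (volume : Measure (Torus d))) (bound := fun z => C * |f z|)
    Filter.univ_mem (.of_forall fun y => (hF y).aestronglyMeasurable) (hF y) hm
    (.of_forall fun z y _ => hbd z y) (hf.abs.const_mul _) (.of_forall fun z y _ => hd z y)
  have e : ∫ z, f z • totalPd K (proj y - z) =
      ∑ i, conv (pd i K) f (proj y) • EuclideanSpace.proj (𝕜 := ℝ) i := by
    simp_rw [totalPd, Finset.smul_sum, smul_smul]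
    rw [integral_finsetSum]
    · refine Finset.sum_congr rfl fun i _ => ?_
      rw [integral_smul_const]
      simp only [conv, mul_comm]
    · intro i _
      refine Integrable.smul_const ?_ _
      simpa only [mul_comm] using integrable_conv_integrand (hK.pd i).continuous hf (proj y)
  rw [e] at key
  simpa only [conv, mul_comm] using key

/-- Convolution with a smooth kernel is smooth. -/
theorem SmoothOnTorus.conv {K f : Torus d → ℝ} (hK : SmoothOnTorus K) (hf : Integrable f) :
    SmoothOnTorus (conv K f) := by
  refine contDiff_infty.2 fun n => ?_
  induction n generalizing K with
  | zero =>
    exact contDiff_zero.2 ((continuous_conv hK.continuous hf).comp continuous_proj)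
  | succ n ih =>
    exact contDiff_succ_iff_hasFDerivAt.2 ⟨_, ContDiff.sum fun i _ =>
      (ih (hK.pd i)).smul contDiff_const, hasFDerivAt_conv hK hf⟩

theorem pd_conv {K f : Torus d → ℝ} (hK : SmoothOnTorus K) (hf : Integrable f) (i : Fin d) :
    pd i (conv K f) = conv (pd i K) f :=
  ((hK.hasPd i).conv hK.continuous (hK.pd i).continuous hf).pd_eq

theorem integrable_prod_kernel {K f g : Torus d → ℝ} (hK : Continuous K) (hf : Integrable f)
    (hg : Integrable g) :
    Integrable (fun p : Torus d × Torus d => K (p.1 - p.2) * (g p.1 * f p.2))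
      (volume.prod volume) :=
  integrable_continuous_mul (by fun_prop) (hg.mul_prod hf)

/-- The adjoint of convolution with `K` is convolution with the reflected kernel. -/
theorem integral_conv_mul {K f g : Torus d → ℝ} (hK : Continuous K) (hf : Integrable f)
    (hg : Integrable g) :
    ∫ x, conv K f x * g x = ∫ z, f z * conv (fun w => K (-w)) g z := by
  have h := integral_integral_swap (f := fun x z => K (x - z) * (g x * f z))
    (integrable_prod_kernel hK hf hg)
  have e1 : ∀ x, conv K f x * g x = ∫ z, K (x - z) * (g x * f z) := fun x => by
    rw [conv, ← integral_mul_const]; exact integral_congr_ae (.of_forall fun z => by ring)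
  have e2 : ∀ z, f z * conv (fun w => K (-w)) g z = ∫ x, K (x - z) * (g x * f z) := fun z => by
    rw [conv, ← integral_const_mul]
    exact integral_congr_ae (.of_forall fun x => by simp only [neg_sub]; ring)
  simp_rw [e1, e2, h]

end Convolution

/-! ### Periodization of compactly supported kernels -/

section Periodization

variable {d : ℕ}

/-- The integer vector `n`, as a point of `ℝ^d`. -/
noncomputable def latticePt (n : Fin d → ℤ) : Vec d := WithLp.toLp 2 fun i => (n i : ℝ)

/-- The representative in `(0, 1]^d` of a point of the torus. -/
noncomputable def cellRep (x : Torus d) : Vec d :=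
  WithLp.toLp 2 fun i => (AddCircle.equivIoc 1 0 (x i) : ℝ)

/-- The half-open unit cell with lower corner `n`. -/
def cell (n : Fin d → ℤ) : Set (Vec d) := {y | ∀ i, y i ∈ Ioc (n i : ℝ) (n i + 1)}

/-- The sum of the integer translates of `k`, as a function on the torus. -/
noncomputable def periodize (k : Vec d → ℝ) (x : Torus d) : ℝ :=
  ∑ᶠ n : Fin d → ℤ, k (cellRep x + latticePt n)

theorem proj_cellRep (x : Torus d) : proj (cellRep x) = x := by
  ext i; simp [proj, cellRep, AddCircle.coe_equivIoc]

theorem cellRep_mem (x : Torus d) (i : Fin d) : cellRep x i ∈ Ioc (0:ℝ) 1 := by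
  simpa using! (AddCircle.equivIoc (1:ℝ) 0 (x i)).2

theorem exists_eq_cellRep_add (y : Vec d) : ∃ n, y = cellRep (proj y) + latticePt n := by
  have h : ∀ i, ∃ n : ℤ, (n : ℝ) = y i - cellRep (proj y) i := fun i => by
    have h1 : ((y i - cellRep (proj y) i : ℝ) : UnitAddCircle) = 0 := by
      have := congrFun (proj_cellRep (proj y)) i
      simp only [proj] at this
      rw [AddCircle.coe_sub, this, sub_self]
    obtain ⟨n, hn⟩ := (AddCircle.coe_eq_zero_iff 1).1 h1
    exact ⟨n, by simpa using hn⟩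
  choose n hn using h
  exact ⟨n, by ext i; simp [latticePt, hn]⟩

theorem cellRep_proj_add {n : Fin d → ℤ} {y : Vec d} (hy : y ∈ cell n) :
    cellRep (proj y) + latticePt n = y := by
  obtain ⟨m, hm⟩ := exists_eq_cellRep_add y
  suffices m = n by rw [← this]; exact hm.symm
  ext i
  have h1 := hy i
  have h2 := cellRep_mem (proj y) i
  have h3 : y i = cellRep (proj y) i + m i := by
    conv_lhs => rw [hm]
    simp [latticePt]
  have h4 : (m i : ℝ) < n i + 1 := by linarith [h1.2, h2.1]
  have h5 : (n i : ℝ) < m i + 1 := by linarith [h1.1, h2.2]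
  norm_cast at h4 h5
  omega

theorem periodize_proj (k : Vec d → ℝ) (y : Vec d) :
    periodize k (proj y) = ∑ᶠ n : Fin d → ℤ, k (y + latticePt n) := by
  obtain ⟨m, hm⟩ := exists_eq_cellRep_add y
  rw [periodize, ← finsum_comp_equiv (Equiv.addRight m)]
  refine finsum_congr fun n => congrArg k ?_
  conv_rhs => rw [hm]
  ext i
  simp [latticePt]
  ring

/-- The integer vectors with entries at most `N` in absolute value. -/
noncomputable def latticeBox (d : ℕ) (N : ℤ) : Finset (Fin d → ℤ) :=
  Fintype.piFinset fun _ => Finset.Icc (-N) N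

theorem abs_coord_le (y : Vec d) (i : Fin d) : |y i| ≤ ‖y‖ := by
  simpa using PiLp.norm_apply_le y i

theorem support_subset_latticeBox {k : Vec d → ℝ} {R A : ℤ} (hk : ∀ y, (R : ℝ) < ‖y‖ → k y = 0)
    {y : Vec d} (hy : ∀ i, |y i| ≤ A) :
    (Function.support fun n => k (y + latticePt n)) ⊆ latticeBox d (A + R) := by
  intro n hn
  by_contra hc
  refine hn (hk _ ?_)
  simp only [latticeBox, Finset.mem_coe, Fintype.mem_piFinset, Finset.mem_Icc, not_forall] at hc
  obtain ⟨i, hi⟩ := hc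
  have h1 : A + R < |n i| := by
    by_contra h; exact hi (abs_le.1 (not_lt.1 h))
  have h1' : (A + R : ℝ) < |(n i : ℝ)| := by exact_mod_cast h1
  have h2 : |(y + latticePt n) i| ≤ ‖y + latticePt n‖ := abs_coord_le _ i
  have h3 : (y + latticePt n) i = y i + n i := by simp [latticePt]
  have h4 : |(n i : ℝ)| ≤ |y i + n i| + |y i| := by
    have := abs_sub (y i + n i) (y i)
    simpa using this
  rw [h3] at h2
  linarith [hy i]

theorem periodize_smooth {k : Vec d → ℝ} (hk : ContDiff ℝ ∞ k) {R : ℤ}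
    (hR : ∀ y, (R : ℝ) < ‖y‖ → k y = 0) : SmoothOnTorus (periodize k) := by
  refine contDiff_iff_contDiffAt.2 fun y₀ => ?_
  have hev : (fun y => periodize k (proj y)) =ᶠ[nhds y₀]
      fun y => ∑ n ∈ latticeBox d (⌈‖y₀‖ + 1⌉ + R), k (y + latticePt n) := by
    filter_upwards [Metric.ball_mem_nhds y₀ one_pos] with y hy
    rw [periodize_proj, finsum_eq_sum_of_support_subset _ (support_subset_latticeBox hR _)]
    intro i
    have h1 : |y i| ≤ ‖y‖ := abs_coord_le _ i
    have h2 : ‖y‖ ≤ ‖y₀‖ + ‖y - y₀‖ := by simpa using norm_add_le y₀ (y - y₀)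
    rw [Metric.mem_ball, dist_eq_norm] at hy
    exact (by linarith : |y i| ≤ ‖y₀‖ + 1).trans (Int.le_ceil _)
  refine ContDiffAt.congr_of_eventuallyEq (ContDiff.contDiffAt ?_) hev
  exact ContDiff.sum fun n _ => hk.comp (by fun_prop)

theorem measurableSet_cell (n : Fin d → ℤ) : MeasurableSet (cell n) := by
  have : cell n = ⋂ i, (fun y : Vec d => y i) ⁻¹' Ioc (n i : ℝ) (n i + 1) := by
    ext y; simp [cell]
  rw [this]
  exact MeasurableSet.iInter fun i =>
    (by fun_prop : Measurable fun y : Vec d => y i) measurableSet_Ioc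

theorem measurePreserving_proj (n : Fin d → ℤ) :
    MeasurePreserving (proj : Vec d → Torus d) (volume.restrict (cell n)) volume := by
  have h1 : MeasurePreserving (fun (y : Fin d → ℝ) (i : Fin d) => (y i : UnitAddCircle))
      (volume.restrict (univ.pi fun i => Ioc (n i : ℝ) (n i + 1))) volume := by
    have h := measurePreserving_pi (fun i : Fin d => volume.restrict (Ioc (n i : ℝ) (n i + 1)))
      (fun _ => (volume : Measure UnitAddCircle))
      (fun i => AddCircle.measurePreserving_mk 1 (n i : ℝ))
    rwa [← Measure.restrict_pi_pi] at h
  have h2 := (PiLp.volume_preserving_ofLp (Fin d)).restrict_preimage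
    (s := univ.pi fun i => Ioc (n i : ℝ) (n i + 1))
    (MeasurableSet.univ_pi fun i => measurableSet_Ioc)
  have h3 := h1.comp h2
  have e : (WithLp.ofLp ⁻¹' (univ.pi fun i => Ioc (n i : ℝ) (n i + 1)) : Set (Vec d)) = cell n := by
    ext y; simp [cell]
  rw [e] at h3
  exact h3

theorem measurable_cellRep : Measurable (cellRep : Torus d → Vec d) := by
  unfold cellRep
  refine (MeasurableEquiv.toLp 2 (Fin d → ℝ)).measurable.comp (measurable_pi_lambda _ fun i => ?_)
  exact measurable_subtype_coe.comp
    ((AddCircle.measurableEquivIoc (1:ℝ) 0).measurable.comp (measurable_pi_apply i))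

theorem eq_zero_of_notMem_cells {k : Vec d → ℝ} {R : ℤ} (hR : ∀ y, (R : ℝ) < ‖y‖ → k y = 0)
    {y : Vec d} (hy : y ∉ ⋃ n ∈ latticeBox d (1 + R), cell n) : k y = 0 := by
  by_contra h
  obtain ⟨n, hn⟩ := exists_eq_cellRep_add y
  refine hy (mem_iUnion₂.2 ⟨n, ?_, fun i => ?_⟩)
  · refine support_subset_latticeBox hR (A := 1) (y := cellRep (proj y)) (fun i => ?_) ?_
    · have := cellRep_mem (proj y) i
      rw [abs_of_pos this.1]; simpa using this.2
    · rw [Function.mem_support, ← hn]; exact h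
  · have := cellRep_mem (proj y) i
    have h3 : y i = cellRep (proj y) i + n i := by
      conv_lhs => rw [hn]
      simp [latticePt]
    rw [h3]
    exact ⟨by linarith [this.1], by linarith [this.2]⟩

theorem pairwise_disjoint_cell (s : Set (Fin d → ℤ)) :
    s.Pairwise (Function.onFun Disjoint cell) := by
  intro n _ m _ hnm
  refine Set.disjoint_left.2 fun y hn hm => hnm ?_
  have h := (cellRep_proj_add hn).trans (cellRep_proj_add hm).symm
  ext i
  have h2 := congrArg (fun v : Vec d => v i) h
  simpa [latticePt] using h2

/-- A compactly supported kernel times an integrable periodic function is integrable on `ℝ^d`. -/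
theorem integrable_mul_proj {F : Type*} [NormedAddCommGroup F] [NormedSpace ℝ F] {k : Vec d → ℝ}
    (hk : Continuous k) {R : ℤ} (hR : ∀ y, (R : ℝ) < ‖y‖ → k y = 0) {f : Torus d → F}
    (hf : Integrable f) : Integrable fun y => k y • f (proj y) := by
  have hkc : HasCompactSupport k := HasCompactSupport.intro (isCompact_closedBall 0 (R : ℝ))
    fun y hy => hR y (by simpa using hy)
  obtain ⟨C, hC⟩ := hkc.exists_bound_of_continuous hk
  refine IntegrableOn.integrable_of_forall_notMem_eq_zero
    (s := ⋃ n ∈ latticeBox d (1 + R), cell n) (integrableOn_finset_iUnion.2 fun n _ => ?_)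
    fun y hy => by rw [eq_zero_of_notMem_cells hR hy, zero_smul]
  have h := ((measurePreserving_proj n).integrable_comp hf.aestronglyMeasurable).2 hf
  exact h.bdd_smul (C := C) hk.aestronglyMeasurable (.of_forall hC)

/-- Unfolding: an integral over `ℝ^d` against a periodic function is an integral over the torus
against the periodization. -/
theorem integral_mul_proj {k : Vec d → ℝ} (hk : Continuous k) {R : ℤ}
    (hR : ∀ y, (R : ℝ) < ‖y‖ → k y = 0) {f : Torus d → ℝ} (hf : Integrable f) :
    ∫ y, k y * f (proj y) = ∫ x, periodize k x * f x := by
  have hkc : HasCompactSupport k := HasCompactSupport.intro (isCompact_closedBall 0 (R : ℝ))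
    fun y hy => hR y (by simpa using hy)
  obtain ⟨C, hC⟩ := hkc.exists_bound_of_continuous hk
  have hint : ∀ n : Fin d → ℤ, Integrable fun x => k (cellRep x + latticePt n) * f x := fun n =>
    hf.bdd_mul (c := C) (hk.measurable.comp
      (measurable_cellRep.add_const _)).aestronglyMeasurable (.of_forall fun x => hC _)
  have h1 : ∀ n : Fin d → ℤ, ∫ y in cell n, k y * f (proj y) =
      ∫ x, k (cellRep x + latticePt n) * f x := fun n => by
    rw [← (measurePreserving_proj n).map_eq,
      integral_map (measurePreserving_proj n).measurable.aemeasurable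
        (by rw [(measurePreserving_proj n).map_eq]; exact (hint n).aestronglyMeasurable)]
    exact setIntegral_congr_fun (measurableSet_cell n) fun y hy => by
      simp only [cellRep_proj_add hy]
  rw [← setIntegral_eq_integral_of_forall_compl_eq_zero
    (s := ⋃ n ∈ latticeBox d (1 + R), cell n)
    fun y hy => by rw [eq_zero_of_notMem_cells hR hy, zero_mul],
    integral_biUnion_finset _ (fun n _ => measurableSet_cell n) (pairwise_disjoint_cell _)
      fun n _ => by
        simpa only [smul_eq_mul] using (integrable_mul_proj hk hR hf).integrableOn]
  simp_rw [h1]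
  rw [← integral_finsetSum _ fun n _ => hint n]
  refine integral_congr_ae (.of_forall fun x => ?_)
  simp only [periodize]
  rw [finsum_eq_sum_of_support_subset _ (support_subset_latticeBox hR (A := 1) fun i => ?_),
    Finset.sum_mul]
  have := cellRep_mem x i
  rw [abs_of_pos this.1]; simpa using this.2

end Periodization

/-! ### Mollification as a convolution on the torus -/

section Mollification

variable {d : ℕ} {ρ : Vec d → ℝ} {ℓ : ℝ}

/-- The rescaled mollifier `ρ_ℓ`. -/
noncomputable def scaled (ρ : Vec d → ℝ) (ℓ : ℝ) (y : Vec d) : ℝ := (ℓ ^ d)⁻¹ * ρ (ℓ⁻¹ • y)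

/-- The periodized rescaled mollifier: mollification is convolution with this kernel. -/
noncomputable def mollKernel (ρ : Vec d → ℝ) (ℓ : ℝ) : Torus d → ℝ := periodize (scaled ρ ℓ)

theorem IsMollifier.eq_zero (hρ : IsMollifier ρ) {y : Vec d} (hy : 1 < ‖y‖) : ρ y = 0 := by
  by_contra h
  have := hρ.support (subset_tsupport _ h)
  rw [mem_closedBall_zero_iff] at this
  linarith

theorem IsMollifier.contDiff_scaled (hρ : IsMollifier ρ) : ContDiff ℝ ∞ (scaled ρ ℓ) :=
  contDiff_const.mul (hρ.smooth.comp (contDiff_const_smul _))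

theorem IsMollifier.scaled_eq_zero (hρ : IsMollifier ρ) (hℓ : 0 < ℓ) (y : Vec d)
    (hy : ((⌈ℓ⌉ : ℤ) : ℝ) < ‖y‖) : scaled ρ ℓ y = 0 := by
  have h : ℓ < ‖y‖ := (Int.le_ceil ℓ).trans_lt hy
  rw [scaled, hρ.eq_zero, mul_zero]
  rw [norm_smul, norm_inv, Real.norm_of_nonneg hℓ.le, inv_mul_eq_div, one_lt_div hℓ]
  exact h

theorem IsMollifier.smooth_mollKernel (hρ : IsMollifier ρ) (hℓ : 0 < ℓ) :
    SmoothOnTorus (mollKernel ρ ℓ) :=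
  periodize_smooth hρ.contDiff_scaled (hρ.scaled_eq_zero hℓ)

theorem moll_eq_conv (hρ : IsMollifier ρ) (hℓ : 0 < ℓ) {f : Torus d → ℝ} (hf : Integrable f) :
    moll ρ ℓ f = conv (mollKernel ρ ℓ) f := by
  ext x
  have h := integral_mul_proj (hρ.contDiff_scaled (ℓ := ℓ)).continuous (hρ.scaled_eq_zero hℓ)
    (hf.comp_sub_left x)
  simp only [moll, smul_eq_mul]
  refine h.trans ?_
  rw [conv, ← integral_sub_left_eq_self _ volume x]
  simp [mollKernel]

theorem moll_apply (hρ : IsMollifier ρ) (hℓ : 0 < ℓ) {f : Torus d → Vec d} (hf : Integrable f)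
    (x : Torus d) (i : Fin d) : moll ρ ℓ f x i = moll ρ ℓ (fun z => f z i) x := by
  have h := integrable_mul_proj (hρ.contDiff_scaled (ℓ := ℓ)).continuous (hρ.scaled_eq_zero hℓ)
    (hf.comp_sub_left x)
  have := (EuclideanSpace.proj (𝕜 := ℝ) i : Vec d →L[ℝ] ℝ).integral_comp_comm h
  simp only [moll]
  simpa [scaled] using! this.symm

/-- Unfolding of a reflected mollification, as an average over `ℝ^d`. -/
theorem conv_neg_mollKernel (hρ : IsMollifier ρ) (hℓ : 0 < ℓ) {θ : Torus d → ℝ}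
    (hθ : Continuous θ) (x : Torus d) :
    conv (fun w => mollKernel ρ ℓ (-w)) θ x = ∫ y, ρ y * θ (x + proj (ℓ • y)) := by
  have h := integral_mul_proj (hρ.contDiff_scaled (ℓ := ℓ)).continuous (hρ.scaled_eq_zero hℓ)
    (integrable_of_continuous (f := fun z => θ (x + z)) (by fun_prop))
  have h2 : ∫ y, ρ y * θ (x + proj (ℓ • y)) = ∫ y, scaled ρ ℓ y * θ (x + proj y) := by
    have h3 := Measure.integral_comp_inv_smul (volume : Measure (Vec d))
      (fun y => ρ y * θ (x + proj (ℓ • y))) ℓ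
    simp only [smul_smul, mul_inv_cancel₀ hℓ.ne', one_smul, finrank_euclideanSpace,
      Fintype.card_fin] at h3
    have h4 : ∫ y, scaled ρ ℓ y * θ (x + proj y) =
        (ℓ ^ d)⁻¹ * ∫ y, ρ (ℓ⁻¹ • y) * θ (x + proj y) := by
      rw [← integral_const_mul]; simp only [scaled, mul_assoc]
    rw [h4, h3, abs_of_pos (by positivity), smul_eq_mul, inv_mul_cancel_left₀ (by positivity)]
  rw [h2, h, conv, ← integral_add_left_eq_self _ x]
  refine integral_congr_ae (.of_forall fun z => ?_)
  simp [mollKernel]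

theorem IsMollifier.integrable (hρ : IsMollifier ρ) : Integrable ρ :=
  hρ.smooth.continuous.integrable_of_hasCompactSupport
    (HasCompactSupport.intro (isCompact_closedBall 0 1) fun y hy => hρ.eq_zero (by simpa using hy))

theorem abs_conv_neg_mollKernel_le (hρ : IsMollifier ρ) (hℓ : 0 < ℓ) {θ : Torus d → ℝ}
    (hθ : Continuous θ) {C : ℝ} (hC : ∀ x, |θ x| ≤ C) (x : Torus d) :
    |conv (fun w => mollKernel ρ ℓ (-w)) θ x| ≤ C := by
  rw [conv_neg_mollKernel hρ hℓ hθ]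
  have : ∫ y, ρ y * C = C := by rw [integral_mul_const, hρ.integral_eq_one, one_mul]
  refine (norm_integral_le_of_norm_le (f := fun y => ρ y * θ (x + proj (ℓ • y)))
    (hρ.integrable.mul_const C) (.of_forall fun y => ?_)).trans_eq this
  rw [norm_mul, Real.norm_of_nonneg (hρ.nonneg y)]
  exact mul_le_mul_of_nonneg_left (hC _) (hρ.nonneg y)

/-- Mollification of a continuous function converges pointwise as the scale tends to zero. -/
theorem tendsto_conv_neg_mollKernel (hρ : IsMollifier ρ) {θ : Torus d → ℝ} (hθ : Continuous θ)
    (x : Torus d) :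
    Filter.Tendsto (fun n : ℕ => conv (fun w => mollKernel ρ (1 / (n + 1)) (-w)) θ x)
      Filter.atTop (nhds (θ x)) := by
  simp_rw [fun n : ℕ => conv_neg_mollKernel hρ (Nat.one_div_pos_of_nat (α := ℝ) (n := n)) hθ x]
  obtain ⟨C, -, hC⟩ := exists_norm_le hθ
  have h0 : ∫ y, ρ y * θ x = θ x := by rw [integral_mul_const, hρ.integral_eq_one, one_mul]
  rw [← h0]
  refine tendsto_integral_of_dominated_convergence (fun y => ρ y * C) (fun n => ?_)
    (hρ.integrable.mul_const C) (fun n => .of_forall fun y => ?_) (.of_forall fun y => ?_)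
  · refine (hρ.smooth.continuous.mul (hθ.comp ?_)).aestronglyMeasurable
    exact continuous_const.add (continuous_proj.comp (continuous_const_smul _))
  · rw [norm_mul, Real.norm_of_nonneg (hρ.nonneg y)]
    exact mul_le_mul_of_nonneg_left (hC _) (hρ.nonneg y)
  · refine Filter.Tendsto.const_mul _ ?_
    have hc : Continuous fun s : ℝ => θ (x + proj (s • y)) :=
      hθ.comp (continuous_const.add (continuous_proj.comp (by fun_prop)))
    have := (hc.tendsto 0).comp (tendsto_one_div_add_atTop_nhds_zero_nat (𝕜 := ℝ))
    have e : proj (0 : Vec d) = 0 := by ext i; simp [proj]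
    simpa [Function.comp_def, e] using this

end Mollification

/-! ### Real trigonometric modes -/

section Modes

variable {d : ℕ}

/-- The real trigonometric mode `Re (c e^{2πi m·x})`. -/
noncomputable def tmode (m : Fin d → ℤ) (c : ℂ) (x : Torus d) : ℝ :=
  (c * UnitAddTorus.mFourier m x).re

/-- The factor `2πi m_j` by which `∂_j` acts on the frequency `m`. -/
noncomputable def freq (m : Fin d → ℤ) (j : Fin d) : ℂ :=
  2 * Real.pi * Complex.I * m j

theorem mFourier_point_add (m : Fin d → ℤ) (x y : Torus d) :
    UnitAddTorus.mFourier m (x + y) = UnitAddTorus.mFourier m x * UnitAddTorus.mFourier m y := by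
  simp [UnitAddTorus.mFourier, fourier_apply, AddCircle.toCircle_add, Finset.prod_mul_distrib]

theorem mFourier_point_single (m : Fin d → ℤ) (j : Fin d) (s : ℝ) :
    UnitAddTorus.mFourier m (Pi.single j (s : UnitAddCircle)) = Complex.exp (s * freq m j) := by
  have : ∀ i, fourier (m i) ((Pi.single j (s : UnitAddCircle) : Torus d) i) =
      if i = j then Complex.exp (s * freq m j) else 1 := fun i => by
    by_cases h : i = j
    · subst h
      rw [Pi.single_eq_same, fourier_coe_apply, if_pos rfl, freq]
      congr 1; push_cast; ring
    · rw [Pi.single_eq_of_ne h, if_neg h, fourier_eval_zero]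
  simp only [UnitAddTorus.mFourier, ContinuousMap.coe_mk, this]
  simp

theorem mFourier_proj (m : Fin d → ℤ) (y : Vec d) :
    UnitAddTorus.mFourier m (proj y) = ∏ i, Complex.exp (2 * Real.pi * Complex.I * m i * y i) := by
  simp [UnitAddTorus.mFourier, proj]

theorem tmode_hasPd (m : Fin d → ℤ) (c : ℂ) (j : Fin d) :
    HasPd j (tmode m c) (tmode m (freq m j * c)) := by
  intro x
  simp_rw [tmode, mFourier_point_add, mFourier_point_single]
  have h1 : HasDerivAt (fun s : ℝ => Complex.exp ((s : ℂ) * freq m j)) (freq m j) 0 := by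
    have h := ((hasDerivAt_id (0:ℝ)).ofReal_comp.mul_const (freq m j)).cexp
    simpa using h
  have h2 := (h1.const_mul (UnitAddTorus.mFourier m x)).const_mul c
  have h3 := Complex.reCLM.hasFDerivAt.comp_hasDerivAt (0:ℝ) h2
  refine h3.congr_deriv ?_
  simp only [Complex.reCLM_apply]
  congr 1; ring

theorem tmode_smooth (m : Fin d → ℤ) (c : ℂ) : SmoothOnTorus (tmode m c) := by
  unfold SmoothOnTorus tmode
  simp_rw [mFourier_proj]
  refine Complex.reCLM.contDiff.comp (contDiff_const.mul (contDiff_prod fun i _ => ?_))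
  refine ContDiff.cexp (contDiff_const.mul (Complex.ofRealCLM.contDiff.comp ?_))
  fun_prop

theorem continuous_tmode (m : Fin d → ℤ) (c : ℂ) : Continuous (tmode m c) :=
  (tmode_smooth m c).continuous

theorem pd_tmode (m : Fin d → ℤ) (c : ℂ) (j : Fin d) :
    pd j (tmode m c) = tmode m (freq m j * c) := (tmode_hasPd m c j).pd_eq

theorem tmode_real_mul (m : Fin d → ℤ) (r : ℝ) (c : ℂ) (x : Torus d) :
    tmode m (r * c) x = r * tmode m c x := by
  simp [tmode, mul_assoc]

theorem tmode_neg (m : Fin d → ℤ) (c : ℂ) (x : Torus d) : tmode m (-c) x = -tmode m c x := by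
  simp [tmode]

theorem tmode_add (m : Fin d → ℤ) (c c' : ℂ) (x : Torus d) :
    tmode m (c + c') x = tmode m c x + tmode m c' x := by
  simp [tmode, add_mul]

theorem freq_mul_freq (m : Fin d → ℤ) (i j : Fin d) :
    freq m i * freq m j = ((-(4 * Real.pi ^ 2 * m i * m j) : ℝ) : ℂ) := by
  have : freq m i * freq m j = 4 * Real.pi ^ 2 * m i * m j * (Complex.I * Complex.I) := by
    simp only [freq]; ring
  rw [this, Complex.I_mul_I]; push_cast; ring

theorem pd_pd_tmode (m : Fin d → ℤ) (c : ℂ) (i j : Fin d) (x : Torus d) :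
    pd i (pd j (tmode m c)) x = -(4 * Real.pi ^ 2 * m i * m j) * tmode m c x := by
  rw [pd_tmode, pd_tmode, ← mul_assoc, freq_mul_freq, tmode_real_mul]

/-- The squared length of the frequency `m`. -/
def freqSq (m : Fin d → ℤ) : ℝ := ∑ i, (m i : ℝ) ^ 2

theorem lapl_tmode (m : Fin d → ℤ) (c : ℂ) (x : Torus d) :
    lapl (tmode m c) x = -(4 * Real.pi ^ 2 * freqSq m) * tmode m c x := by
  simp_rw [lapl, pd_pd_tmode, ← Finset.sum_mul, freqSq, Finset.mul_sum, ← Finset.sum_neg_distrib]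
  congr 1
  exact Finset.sum_congr rfl fun i _ => by ring

theorem abs_tmode_le (m : Fin d → ℤ) (c : ℂ) (x : Torus d) : |tmode m c x| ≤ ‖c‖ := by
  refine (Complex.abs_re_le_norm _).trans ?_
  rw [norm_mul]
  have := (UnitAddTorus.mFourier m).norm_coe_le_norm x
  rw [UnitAddTorus.mFourier_norm] at this
  exact mul_le_of_le_one_right (norm_nonneg _) this

/-- The real trigonometric polynomial with coefficients `a`. -/
noncomputable def trigPoly (a : (Fin d → ℤ) →₀ ℂ) (x : Torus d) : ℝ :=
  ∑ m ∈ a.support, tmode m (a m) x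

theorem continuous_trigPoly (a : (Fin d → ℤ) →₀ ℂ) : Continuous (trigPoly a) :=
  continuous_finsetSum _ fun m _ => continuous_tmode m _

/-- Real trigonometric polynomials are uniformly dense in the continuous functions. -/
theorem exists_trigPoly_close {g : Torus d → ℝ} (hg : Continuous g) {ε : ℝ} (hε : 0 < ε) :
    ∃ a : (Fin d → ℤ) →₀ ℂ, ∀ x, |g x - trigPoly a x| < ε := by
  let G : C(Torus d, ℂ) := ⟨fun x => (g x : ℂ), by fun_prop⟩
  have hG : G ∈
      (Submodule.span ℂ (range (UnitAddTorus.mFourier (d := Fin d)))).topologicalClosure := by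
    rw [UnitAddTorus.span_mFourier_closure_eq_top]; trivial
  obtain ⟨H, hH, hd⟩ := Metric.mem_closure_iff.1 hG ε hε
  obtain ⟨a, rfl⟩ := Finsupp.mem_span_range_iff_exists_finsupp.1 hH
  refine ⟨a, fun x => ?_⟩
  have h1 := (ContinuousMap.dist_apply_le_dist x).trans_lt hd
  rw [dist_eq_norm] at h1
  refine lt_of_le_of_lt ?_ h1
  have e : g x - trigPoly a x =
      (G x - (a.sum fun m c => c • UnitAddTorus.mFourier m) x).re := by
    simp [G, trigPoly, tmode, Finsupp.sum, ContinuousMap.sum_apply, Complex.re_sum]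
  rw [e]
  exact Complex.abs_re_le_norm _

theorem integral_mul_trigPoly {f : Torus d → ℝ} (hf : Integrable f) (a : (Fin d → ℤ) →₀ ℂ) :
    ∫ x, f x * trigPoly a x = ∑ m ∈ a.support, ∫ x, f x * tmode m (a m) x := by
  simp_rw [trigPoly, Finset.mul_sum]
  refine integral_finsetSum _ fun m _ => ?_
  simpa only [mul_comm] using integrable_continuous_mul (continuous_tmode m (a m)) hf

theorem integrable_mul_continuous {f g : Torus d → ℝ} (hf : Integrable f) (hg : Continuous g) :
    Integrable fun x => f x * g x := by
  simpa only [mul_comm] using integrable_continuous_mul hg hf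

/-- An integrable function that annihilates the trigonometric modes annihilates the continuous
functions. -/
theorem integral_mul_eq_zero_of_tmode {f : Torus d → ℝ} (hf : Integrable f)
    (h : ∀ m c, ∫ x, f x * tmode m c x = 0) {g : Torus d → ℝ} (hg : Continuous g) :
    ∫ x, f x * g x = 0 := by
  by_contra hne
  have hpos : 0 < |∫ x, f x * g x| := abs_pos.2 hne
  set I := ∫ x, |f x| with hI
  have hI0 : 0 ≤ I := integral_nonneg fun x => abs_nonneg _
  obtain ⟨a, ha⟩ := exists_trigPoly_close hg (div_pos hpos (by linarith : 0 < I + 1))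
  have h0 : ∫ x, f x * trigPoly a x = 0 := by
    rw [integral_mul_trigPoly hf]; exact Finset.sum_eq_zero fun m _ => h m _
  have h1 : ∫ x, f x * g x = ∫ x, f x * (g x - trigPoly a x) := by
    simp_rw [mul_sub]
    rw [integral_sub (integrable_mul_continuous hf hg)
      (integrable_mul_continuous hf (continuous_trigPoly a)), h0, sub_zero]
  have h2 : |∫ x, f x * (g x - trigPoly a x)| ≤ |∫ x, f x * g x| / (I + 1) * I := by
    rw [hI, ← integral_const_mul]
    refine norm_integral_le_of_norm_le (f := fun x => f x * (g x - trigPoly a x))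
      (hf.abs.const_mul _) (.of_forall fun x => ?_)
    rw [norm_mul, mul_comm]
    exact mul_le_mul_of_nonneg_right (ha x).le (abs_nonneg _)
  rw [← h1, div_mul_eq_mul_div, le_div_iff₀ (by linarith)] at h2
  nlinarith

/-- Uniqueness of Fourier coefficients for integrable functions. -/
theorem ae_eq_zero_of_tmode {f : Torus d → ℝ} (hf : Integrable f)
    (h : ∀ m c, ∫ x, f x * tmode m c x = 0) : f =ᵐ[volume] 0 := by
  refine ae_eq_zero_of_forall_setIntegral_isClosed_eq_zero hf fun s hs => ?_
  have h1 : ∀ n : ℕ, ∫ x, f x * (hs.apprSeq n x : ℝ) = 0 := fun n =>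
    integral_mul_eq_zero_of_tmode hf h (by fun_prop)
  have h2 : Filter.Tendsto (fun n : ℕ => ∫ x, f x * (hs.apprSeq n x : ℝ)) Filter.atTop
      (nhds (∫ x, s.indicator f x)) := by
    refine tendsto_integral_of_dominated_convergence (fun x => |f x|)
      (fun n => (integrable_mul_continuous hf (by fun_prop)).aestronglyMeasurable) hf.abs
      (fun n => .of_forall fun x => ?_) (.of_forall fun x => ?_)
    · rw [norm_mul, Real.norm_eq_abs (f x)]
      refine mul_le_of_le_one_right (abs_nonneg _) ?_
      simpa using HasOuterApproxClosed.apprSeq_apply_le_one hs n x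
    · have h3 := tendsto_pi_nhds.1 (HasOuterApproxClosed.tendsto_apprSeq hs) x
      have h4 := ((NNReal.continuous_coe.tendsto _).comp h3).const_mul (f x)
      have e : s.indicator f x = f x * ((s.indicator (fun _ => 1) x : NNReal) : ℝ) := by
        by_cases hx : x ∈ s <;> simp [hx]
      rw [e]
      exact h4
  rw [← integral_indicator hs.measurableSet]
  exact tendsto_nhds_unique h2 (by simp [h1])

theorem conv_tmode {K : Torus d → ℝ} (hK : Continuous K) (m : Fin d → ℤ) (c : ℂ) :
    ∃ c' : ℂ, conv K (tmode m c) = tmode m c' := by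
  refine ⟨c * ∫ w, (K w : ℂ) * UnitAddTorus.mFourier m (-w), ?_⟩
  ext x
  rw [conv, ← integral_sub_left_eq_self _ volume x]
  have hi : Integrable fun w => (K w : ℂ) * UnitAddTorus.mFourier m (-w) :=
    integrable_of_continuous (by fun_prop)
  have h1 : ∀ w, K (x - (x - w)) * tmode m c (x - w) =
      Complex.reCLM (c * UnitAddTorus.mFourier m x *
        ((K w : ℂ) * UnitAddTorus.mFourier m (-w))) := fun w => by
    rw [sub_sub_cancel, tmode, sub_eq_add_neg, mFourier_point_add, Complex.reCLM_apply,
      ← Complex.re_ofReal_mul]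
    congr 1; ring
  simp_rw [h1]
  rw [Complex.reCLM.integral_comp_comm (hi.const_mul _), integral_const_mul, tmode,
    Complex.reCLM_apply]
  congr 1; ring

theorem SmoothOnTorus.lapl {K : Torus d → ℝ} (hK : SmoothOnTorus K) : SmoothOnTorus (lapl K) :=
  SmoothOnTorus.sum _ fun i _ => (hK.pd i).pd i

theorem conv_pd_neg {K f : Torus d → ℝ} (hK : SmoothOnTorus K) (hf : Integrable f) (j : Fin d) :
    conv (fun w => TorusFluid.pd j K (-w)) f =
      fun x => -TorusFluid.pd j (conv (fun w => K (-w)) f) x := by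
  rw [pd_conv hK.comp_neg hf, (hK.hasPd j).comp_neg.pd_eq]
  ext x
  rw [conv, conv, ← integral_neg]
  exact integral_congr_ae (.of_forall fun z => by ring)

theorem pd_neg (f : Torus d → ℝ) (j : Fin d) (x : Torus d) :
    TorusFluid.pd j (fun y => -f y) x = -TorusFluid.pd j f x := by
  simp only [TorusFluid.pd]
  exact deriv.fun_neg

theorem conv_sum_left {ι : Type*} (s : Finset ι) {K : ι → Torus d → ℝ} {f : Torus d → ℝ}
    (hK : ∀ k ∈ s, Continuous (K k)) (hf : Integrable f) (x : Torus d) :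
    conv (fun w => ∑ k ∈ s, K k w) f x = ∑ k ∈ s, conv (K k) f x := by
  simp_rw [conv, Finset.sum_mul]
  exact integral_finsetSum _ fun k hk => integrable_conv_integrand (hK k hk) hf x

theorem conv_lapl_neg {K f : Torus d → ℝ} (hK : SmoothOnTorus K) (hf : Integrable f) :
    conv (fun w => TorusFluid.lapl K (-w)) f =
      TorusFluid.lapl (conv (fun w => K (-w)) f) := by
  ext x
  simp only [TorusFluid.lapl]
  rw [conv_sum_left _ (fun i _ => ((hK.pd i).pd i).comp_neg.continuous) hf]
  refine Finset.sum_congr rfl fun i _ => ?_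
  rw [conv_pd_neg (hK.pd i) hf, conv_pd_neg hK hf]
  simp only [pd_neg, neg_neg]

/-- A distribution `A + div B + ΔC` with integrable `A`, `B`, `C` that annihilates every
trigonometric mode vanishes after convolution with any smooth kernel: the convolution is
continuous, and its Fourier coefficients are multiples of the pairings with modes. -/
theorem conv_eq_zero_of_tmode {A C : Torus d → ℝ} {B : Fin d → Torus d → ℝ} (hA : Integrable A)
    (hB : ∀ j, Integrable (B j)) (hC : Integrable C)
    (h : ∀ m c, (∫ x, A x * tmode m c x) - (∑ j, ∫ x, B j x * TorusFluid.pd j (tmode m c) x)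
      + ∫ x, C x * TorusFluid.lapl (tmode m c) x = 0)
    {K : Torus d → ℝ} (hK : SmoothOnTorus K) (x : Torus d) :
    conv K A x + ∑ j, conv (TorusFluid.pd j K) (B j) x + conv (TorusFluid.lapl K) C x = 0 := by
  have cA := continuous_conv hK.continuous hA
  have cB := fun j => continuous_conv (hK.pd j).continuous (hB j)
  have cC := continuous_conv hK.lapl.continuous hC
  set Λ : Torus d → ℝ := fun x =>
    conv K A x + ∑ j, conv (TorusFluid.pd j K) (B j) x + conv (TorusFluid.lapl K) C x with hΛ
  have cΛ : Continuous Λ := (cA.add (continuous_finsetSum _ fun j _ => cB j)).add cC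
  suffices hz : Λ =ᵐ[volume] 0 from
    congrFun (Continuous.ae_eq_iff_eq volume cΛ continuous_zero |>.1 hz) x
  refine ae_eq_zero_of_tmode (integrable_of_continuous cΛ) fun m c => ?_
  have hτ := continuous_tmode m c
  have iτ := integrable_of_continuous hτ
  -- the reflected convolution maps a mode to a mode of the same frequency
  obtain ⟨c', hc'⟩ := conv_tmode (K := fun w => K (-w)) hK.comp_neg.continuous m c
  have e1 : ∫ x, conv K A x * tmode m c x = ∫ x, A x * tmode m c' x := by
    rw [integral_conv_mul hK.continuous hA iτ, hc']
  have e2 : ∀ j, ∫ x, conv (TorusFluid.pd j K) (B j) x * tmode m c x =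
      -∫ x, B j x * TorusFluid.pd j (tmode m c') x := fun j => by
    rw [integral_conv_mul (hK.pd j).continuous (hB j) iτ, conv_pd_neg hK iτ, hc', ← integral_neg]
    exact integral_congr_ae (.of_forall fun z => by ring)
  have e3 : ∫ x, conv (TorusFluid.lapl K) C x * tmode m c x =
      ∫ x, C x * TorusFluid.lapl (tmode m c') x := by
    rw [integral_conv_mul hK.lapl.continuous hC iτ, conv_lapl_neg hK iτ, hc']
  have e4 : ∫ x, Λ x * tmode m c x = (∫ x, conv K A x * tmode m c x)
      + (∑ j, ∫ x, conv (TorusFluid.pd j K) (B j) x * tmode m c x)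
      + ∫ x, conv (TorusFluid.lapl K) C x * tmode m c x := by
    simp_rw [hΛ, add_mul, Finset.sum_mul]
    rw [integral_add, integral_add, integral_finsetSum]
    · exact fun j _ => integrable_of_continuous ((cB j).mul hτ)
    · exact integrable_of_continuous (cA.mul hτ)
    · exact integrable_of_continuous (continuous_finsetSum _ fun j _ => (cB j).mul hτ)
    · exact integrable_of_continuous
        ((cA.mul hτ).add (continuous_finsetSum _ fun j _ => (cB j).mul hτ))
    · exact integrable_of_continuous (cC.mul hτ)
  rw [e4, e1, e3]
  simp_rw [e2]
  rw [Finset.sum_neg_distrib, ← sub_eq_add_neg]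
  exact h m c'

/-- A distribution `A + div B` with integrable `A`, `B` that annihilates every trigonometric mode
annihilates every smooth function. -/
theorem integral_eq_zero_of_tmode {A : Torus d → ℝ} {B : Fin d → Torus d → ℝ}
    (hA : Integrable A) (hB : ∀ j, Integrable (B j))
    (h : ∀ m c, (∫ x, A x * tmode m c x) - ∑ j, ∫ x, B j x * TorusFluid.pd j (tmode m c) x = 0)
    {ψ : Torus d → ℝ} (hψ : SmoothOnTorus ψ) :
    (∫ x, A x * ψ x) - ∑ j, ∫ x, B j x * TorusFluid.pd j ψ x = 0 := by
  have h0 := conv_eq_zero_of_tmode (C := fun _ => 0) hA hB (integrable_zero _ _ _)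
    (by simpa using h) hψ.comp_neg 0
  simp only [(fun j => (hψ.hasPd j).comp_neg.pd_eq), conv, zero_sub, neg_neg, mul_zero,
    integral_zero, add_zero, neg_mul, integral_neg, Finset.sum_neg_distrib] at h0
  simpa only [mul_comm, sub_eq_add_neg] using h0

end Modes

/-! ### A Bellman function for the exponents `3/2` and `3` -/

section Bellman

/-- The fourth root of `ε + x² + y⁴`. -/
noncomputable def bellRoot (ε x y : ℝ) : ℝ := (ε + x ^ 2 + y ^ 4) ^ (1 / 4 : ℝ)

/-- The Bellman function `4 P^{3/4} + y² P^{1/4}`, where `P = ε + x² + y⁴`. -/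
noncomputable def bell (ε x y : ℝ) : ℝ := 4 * bellRoot ε x y ^ 3 + y ^ 2 * bellRoot ε x y

/-- The derivative of `bell` in `x`. -/
noncomputable def bellX (ε x y : ℝ) : ℝ :=
  6 * x / bellRoot ε x y + x * y ^ 2 / (2 * bellRoot ε x y ^ 3)

/-- The derivative of `bell` in `y`. -/
noncomputable def bellY (ε x y : ℝ) : ℝ :=
  12 * y ^ 3 / bellRoot ε x y + 2 * y * bellRoot ε x y + y ^ 5 / bellRoot ε x y ^ 3

/-- The derivative of `bellX` in the direction `(ξ, η)`. -/
noncomputable def bellDX (ε x y ξ η : ℝ) : ℝ :=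
  6 * ξ / bellRoot ε x y - 6 * x * (x * ξ / 2 + y ^ 3 * η) / bellRoot ε x y ^ 5
    + (ξ * y ^ 2 + 2 * x * y * η) / (2 * bellRoot ε x y ^ 3)
    - 3 * x * y ^ 2 * (x * ξ / 2 + y ^ 3 * η) / (2 * bellRoot ε x y ^ 7)

/-- The derivative of `bellY` in the direction `(ξ, η)`. -/
noncomputable def bellDY (ε x y ξ η : ℝ) : ℝ :=
  36 * y ^ 2 * η / bellRoot ε x y - 12 * y ^ 3 * (x * ξ / 2 + y ^ 3 * η) / bellRoot ε x y ^ 5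
    + 2 * η * bellRoot ε x y + 2 * y * (x * ξ / 2 + y ^ 3 * η) / bellRoot ε x y ^ 3
    + 5 * y ^ 4 * η / bellRoot ε x y ^ 3
    - 3 * y ^ 5 * (x * ξ / 2 + y ^ 3 * η) / bellRoot ε x y ^ 7

variable {ε : ℝ}

theorem bellRoot_base_pos (hε : 0 < ε) (x y : ℝ) : 0 < ε + x ^ 2 + y ^ 4 := by positivity

theorem bellRoot_pos (hε : 0 < ε) (x y : ℝ) : 0 < bellRoot ε x y :=
  Real.rpow_pos_of_pos (bellRoot_base_pos hε x y) _

theorem bellRoot_pow_four (hε : 0 < ε) (x y : ℝ) : bellRoot ε x y ^ 4 = ε + x ^ 2 + y ^ 4 := by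
  rw [bellRoot, ← Real.rpow_natCast, ← Real.rpow_mul (bellRoot_base_pos hε x y).le]
  norm_num

theorem bellRoot_pow_three (hε : 0 < ε) (x y : ℝ) :
    bellRoot ε x y ^ 3 = (ε + x ^ 2 + y ^ 4) ^ (3 / 4 : ℝ) := by
  rw [bellRoot, ← Real.rpow_natCast, ← Real.rpow_mul (bellRoot_base_pos hε x y).le]
  norm_num

theorem sq_le_bellRoot_sq (hε : 0 < ε) (x y : ℝ) : y ^ 2 ≤ bellRoot ε x y ^ 2 := by
  have h := bellRoot_pow_four hε x y
  refine abs_le_of_sq_le_sq' ?_ (by positivity) |>.2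
  nlinarith [sq_nonneg x]

theorem abs_le_bellRoot_sq (hε : 0 < ε) (x y : ℝ) : |x| ≤ bellRoot ε x y ^ 2 := by
  have h := bellRoot_pow_four hε x y
  refine abs_le_of_sq_le_sq ?_ (by positivity)
  nlinarith [sq_nonneg (y ^ 2)]

theorem bell_nonneg (hε : 0 < ε) (x y : ℝ) : 0 ≤ bell ε x y := by
  have := bellRoot_pos hε x y
  unfold bell; positivity

theorem bell_le (hε : 0 < ε) (x y : ℝ) :
    bell ε x y ≤ 5 * (ε ^ (3 / 4 : ℝ) + |x| ^ (3 / 2 : ℝ) + |y| ^ (3 : ℝ)) := by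
  have h0 := bellRoot_pos hε x y
  have h1 : bell ε x y ≤ 5 * bellRoot ε x y ^ 3 := by
    unfold bell
    nlinarith [mul_le_mul_of_nonneg_right (sq_le_bellRoot_sq hε x y) h0.le]
  refine h1.trans (mul_le_mul_of_nonneg_left ?_ (by norm_num))
  rw [bellRoot_pow_three hε]
  refine (Real.rpow_add_le_add_rpow (by positivity) (by positivity) (by norm_num)
    (by norm_num)).trans (add_le_add ((Real.rpow_add_le_add_rpow (by positivity) (by positivity)
    (by norm_num) (by norm_num)).trans (add_le_add le_rfl (le_of_eq ?_))) (le_of_eq ?_))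
  · rw [← sq_abs, ← Real.rpow_natCast, ← Real.rpow_mul (abs_nonneg x)]; norm_num
  · rw [← (show Even 4 by decide).pow_abs, ← Real.rpow_natCast, ← Real.rpow_mul (abs_nonneg y)]
    norm_num

theorem HasDerivAt.bellRoot (hε : 0 < ε) {F G : ℝ → ℝ} {ξ η s : ℝ} (hF : HasDerivAt F ξ s)
    (hG : HasDerivAt G η s) : HasDerivAt (fun s => bellRoot ε (F s) (G s))
      ((F s * ξ / 2 + G s ^ 3 * η) / TorusFluid.bellRoot ε (F s) (G s) ^ 3) s := by
  have hP := bellRoot_base_pos hε (F s) (G s)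
  have h := (((hF.pow 2).const_add ε).add (hG.pow 4)).rpow_const (p := 1 / 4) (Or.inl hP.ne')
  refine h.congr_deriv ?_
  have e : (ε + F s ^ 2 + G s ^ 4) ^ (1 / 4 - 1 : ℝ)
      = (TorusFluid.bellRoot ε (F s) (G s) ^ 3)⁻¹ := by
    rw [bellRoot_pow_three hε, ← Real.rpow_neg hP.le]; norm_num
  simp only [Pi.add_apply, Pi.pow_apply]
  rw [e]
  have := bellRoot_pos hε (F s) (G s)
  field_simp
  ring

theorem HasDerivAt.bell (hε : 0 < ε) {F G : ℝ → ℝ} {ξ η s : ℝ} (hF : HasDerivAt F ξ s)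
    (hG : HasDerivAt G η s) : HasDerivAt (fun s => bell ε (F s) (G s))
      (bellX ε (F s) (G s) * ξ + bellY ε (F s) (G s) * η) s := by
  have hS := HasDerivAt.bellRoot hε hF hG
  have h := ((hS.pow 3).const_mul 4).add ((hG.pow 2).mul hS)
  refine h.congr_deriv ?_
  have := bellRoot_pos hε (F s) (G s)
  simp only [Pi.pow_apply, bellX, bellY]
  field_simp
  ring

theorem HasDerivAt.bellX (hε : 0 < ε) {F G : ℝ → ℝ} {ξ η s : ℝ} (hF : HasDerivAt F ξ s)
    (hG : HasDerivAt G η s) : HasDerivAt (fun s => bellX ε (F s) (G s))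
      (bellDX ε (F s) (G s) ξ η) s := by
  have hS := HasDerivAt.bellRoot hε hF hG
  have h0 := bellRoot_pos hε (F s) (G s)
  have h := ((hF.const_mul 6).div hS h0.ne').add
    ((hF.mul (hG.pow 2)).div ((hS.pow 3).const_mul 2) (by simp [h0.ne']))
  refine h.congr_deriv ?_
  simp only [Pi.pow_apply, Pi.mul_apply, bellDX]
  field_simp
  ring

theorem HasDerivAt.bellY (hε : 0 < ε) {F G : ℝ → ℝ} {ξ η s : ℝ} (hF : HasDerivAt F ξ s)
    (hG : HasDerivAt G η s) : HasDerivAt (fun s => bellY ε (F s) (G s))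
      (bellDY ε (F s) (G s) ξ η) s := by
  have hS := HasDerivAt.bellRoot hε hF hG
  have h0 := bellRoot_pos hε (F s) (G s)
  have h := ((((hG.pow 3).const_mul 12).div hS h0.ne').add ((hG.const_mul 2).mul hS)).add
    ((hG.pow 5).div (hS.pow 3) (by simp [h0.ne']))
  refine h.congr_deriv ?_
  simp only [Pi.pow_apply, bellDY]
  field_simp
  ring

/-- The Hessian of `bell` dominates a diagonal form whose two entries have product at least `1`. -/
theorem bell_hessian_ge (hε : 0 < ε) (x y ξ η : ℝ) :
    ξ ^ 2 / bellRoot ε x y + bellRoot ε x y * η ^ 2 ≤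
      ξ * bellDX ε x y ξ η + η * bellDY ε x y ξ η := by
  have hS := bellRoot_pos hε x y
  have h4 := bellRoot_pow_four hε x y
  have hy := sq_le_bellRoot_sq hε x y
  have hx := abs_le_bellRoot_sq hε x y
  unfold bellDX bellDY
  set S := bellRoot ε x y
  set τ := (x * ξ / 2 + y ^ 3 * η) ^ 2 / S ^ 4 with hτ
  -- Cauchy–Schwarz for the gradient of `P`
  have hτ1 : τ ≤ ξ ^ 2 / 4 + y ^ 2 * η ^ 2 := by
    rw [hτ, div_le_iff₀ (by positivity), h4]
    nlinarith [sq_nonneg (x * (y * η) - y ^ 2 * (ξ / 2)), mul_nonneg hε.le (sq_nonneg ξ),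
      mul_nonneg hε.le (sq_nonneg (y * η))]
  have hsplit : ξ * (6 * ξ / S - 6 * x * (x * ξ / 2 + y ^ 3 * η) / S ^ 5
        + (ξ * y ^ 2 + 2 * x * y * η) / (2 * S ^ 3)
        - 3 * x * y ^ 2 * (x * ξ / 2 + y ^ 3 * η) / (2 * S ^ 7))
      + η * (36 * y ^ 2 * η / S - 12 * y ^ 3 * (x * ξ / 2 + y ^ 3 * η) / S ^ 5 + 2 * η * S
        + 2 * y * (x * ξ / 2 + y ^ 3 * η) / S ^ 3 + 5 * y ^ 4 * η / S ^ 3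
        - 3 * y ^ 5 * (x * ξ / 2 + y ^ 3 * η) / S ^ 7) =
      (6 * ξ ^ 2 + 36 * (y * η) ^ 2 - 12 * τ) / S + 2 * S * η ^ 2
        + (ξ ^ 2 * y ^ 2 / 2 + 2 * x * y * ξ * η + 7 * y ^ 4 * η ^ 2 - 3 * y ^ 2 * τ) / S ^ 3 := by
    rw [hτ]; field_simp; ring
  rw [hsplit]
  have hcross : -(S ^ 2 * (ξ ^ 2 + (y * η) ^ 2)) ≤ 2 * x * y * ξ * η := by
    have h1 : |2 * x * y * ξ * η| ≤ S ^ 2 * (ξ ^ 2 + (y * η) ^ 2) := by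
      have e : |2 * x * y * ξ * η| = |x| * (2 * |ξ * (y * η)|) := by
        rw [show 2 * x * y * ξ * η = x * (2 * (ξ * (y * η))) by ring, abs_mul, abs_mul,
          abs_of_pos (two_pos (α := ℝ))]
      rw [e]
      refine mul_le_mul hx ?_ (by positivity) (by positivity)
      rw [abs_mul]
      nlinarith [sq_nonneg (|ξ| - |y * η|), sq_abs ξ, sq_abs (y * η)]
    exact (abs_le.1 h1).1
  have hsecond : -((5 / 4 * ξ ^ 2 + (y * η) ^ 2) / S) ≤
      (ξ ^ 2 * y ^ 2 / 2 + 2 * x * y * ξ * η + 7 * y ^ 4 * η ^ 2 - 3 * y ^ 2 * τ) / S ^ 3 := by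
    rw [← neg_div, div_le_div_iff₀ hS (by positivity)]
    have : -(5 / 4 * ξ ^ 2 + (y * η) ^ 2) * S ^ 2 ≤
        ξ ^ 2 * y ^ 2 / 2 + 2 * x * y * ξ * η + 7 * y ^ 4 * η ^ 2 - 3 * y ^ 2 * τ := by
      nlinarith [mul_le_mul_of_nonneg_left hτ1 (sq_nonneg y),
        mul_le_mul_of_nonneg_left hy (sq_nonneg ξ), sq_nonneg (y ^ 2 * η)]
    nlinarith [mul_le_mul_of_nonneg_right this hS.le]
  have hfirst : (3 * ξ ^ 2 + 24 * (y * η) ^ 2) / S ≤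
      (6 * ξ ^ 2 + 36 * (y * η) ^ 2 - 12 * τ) / S := by
    refine div_le_div_of_nonneg_right ?_ hS.le
    nlinarith
  have hfinal : ξ ^ 2 / S ≤ (3 * ξ ^ 2 + 24 * (y * η) ^ 2) / S
      - (5 / 4 * ξ ^ 2 + (y * η) ^ 2) / S := by
    rw [← sub_div]
    refine div_le_div_of_nonneg_right ?_ hS.le
    nlinarith [sq_nonneg ξ, sq_nonneg (y * η)]
  have : 0 ≤ S * η ^ 2 := by positivity
  linarith

end Bellman

/-! ### Second order Riesz transforms of trigonometric polynomials -/

section Riesz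

variable {d : ℕ} {ε : ℝ}

theorem Continuous.bellRoot {X : Type*} [TopologicalSpace X] (hε : 0 < ε) {F G : X → ℝ}
    (hF : Continuous F) (hG : Continuous G) :
    Continuous fun p => TorusFluid.bellRoot ε (F p) (G p) :=
  Continuous.rpow_const (by fun_prop) fun p => Or.inl (bellRoot_base_pos hε _ _).ne'

theorem Continuous.bell {X : Type*} [TopologicalSpace X] (hε : 0 < ε) {F G : X → ℝ}
    (hF : Continuous F) (hG : Continuous G) : Continuous fun p => bell ε (F p) (G p) := by
  have h := Continuous.bellRoot hε hF hG
  unfold TorusFluid.bell; fun_prop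

theorem Continuous.bellX {X : Type*} [TopologicalSpace X] (hε : 0 < ε) {F G : X → ℝ}
    (hF : Continuous F) (hG : Continuous G) : Continuous fun p => bellX ε (F p) (G p) := by
  have h := Continuous.bellRoot hε hF hG
  have h0 := fun p => (bellRoot_pos hε (F p) (G p)).ne'
  unfold TorusFluid.bellX
  refine (Continuous.div (by fun_prop) h h0).add (Continuous.div (by fun_prop) (by fun_prop) ?_)
  intro p; simp [h0 p]

theorem Continuous.bellY {X : Type*} [TopologicalSpace X] (hε : 0 < ε) {F G : X → ℝ}
    (hF : Continuous F) (hG : Continuous G) : Continuous fun p => bellY ε (F p) (G p) := by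
  have h := Continuous.bellRoot hε hF hG
  have h0 := fun p => (bellRoot_pos hε (F p) (G p)).ne'
  unfold TorusFluid.bellY
  refine ((Continuous.div (by fun_prop) h h0).add (by fun_prop)).add
    (Continuous.div (by fun_prop) (by fun_prop) ?_)
  intro p; simp [h0 p]

theorem Continuous.bellDX {X : Type*} [TopologicalSpace X] (hε : 0 < ε) {F G ξ η : X → ℝ}
    (hF : Continuous F) (hG : Continuous G) (hξ : Continuous ξ) (hη : Continuous η) :
    Continuous fun p => bellDX ε (F p) (G p) (ξ p) (η p) := by
  have h := Continuous.bellRoot hε hF hG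
  have h0 := fun p => (bellRoot_pos hε (F p) (G p)).ne'
  unfold TorusFluid.bellDX
  refine (((Continuous.div (by fun_prop) h h0).sub
    (Continuous.div (by fun_prop) (by fun_prop) fun p => ?_)).add
    (Continuous.div (by fun_prop) (by fun_prop) fun p => ?_)).sub
    (Continuous.div (by fun_prop) (by fun_prop) fun p => ?_) <;> simp [h0 p]

theorem Continuous.bellDY {X : Type*} [TopologicalSpace X] (hε : 0 < ε) {F G ξ η : X → ℝ}
    (hF : Continuous F) (hG : Continuous G) (hξ : Continuous ξ) (hη : Continuous η) :
    Continuous fun p => bellDY ε (F p) (G p) (ξ p) (η p) := by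
  have h := Continuous.bellRoot hε hF hG
  have h0 := fun p => (bellRoot_pos hε (F p) (G p)).ne'
  unfold TorusFluid.bellDY
  refine (((((Continuous.div (by fun_prop) h h0).sub
    (Continuous.div (by fun_prop) (by fun_prop) fun p => ?_)).add (by fun_prop)).add
    (Continuous.div (by fun_prop) (by fun_prop) fun p => ?_)).add
    (Continuous.div (by fun_prop) (by fun_prop) fun p => ?_)).sub
    (Continuous.div (by fun_prop) (by fun_prop) fun p => ?_) <;> simp [h0 p]

/-- The heat extension of the trigonometric polynomial with frequencies in `s` and coefficients
`a`. -/
noncomputable def heat (s : Finset (Fin d → ℤ)) (a : (Fin d → ℤ) → ℂ) (t : ℝ) (x : Torus d) : ℝ :=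
  ∑ m ∈ s, Real.exp (-(4 * Real.pi ^ 2 * freqSq m) * t) * tmode m (a m) x

theorem continuous_heat (s : Finset (Fin d → ℤ)) (a : (Fin d → ℤ) → ℂ) :
    Continuous fun p : ℝ × Torus d => heat s a p.1 p.2 := by
  unfold heat
  refine continuous_finsetSum _ fun m _ => ?_
  have := continuous_tmode m (a m)
  fun_prop

theorem continuous_heat_right (s : Finset (Fin d → ℤ)) (a : (Fin d → ℤ) → ℂ) (t : ℝ) :
    Continuous (heat s a t) := (continuous_heat s a).comp (by fun_prop : Continuous fun x => (t, x))

theorem heat_hasPd (s : Finset (Fin d → ℤ)) (a : (Fin d → ℤ) → ℂ) (t : ℝ) (j : Fin d) :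
    HasPd j (heat s a t) (heat s (fun m => freq m j * a m) t) :=
  HasPd.sum s fun m _ => (tmode_hasPd m (a m) j).const_mul _

theorem heat_hasDerivAt (s : Finset (Fin d → ℤ)) (a : (Fin d → ℤ) → ℂ) (t : ℝ) (x : Torus d) :
    HasDerivAt (fun t => heat s a t x)
      (∑ k, heat s (fun m => freq m k * (freq m k * a m)) t x) t := by
  have h : HasDerivAt (fun t => heat s a t x) (∑ m ∈ s,
      (Real.exp (-(4 * Real.pi ^ 2 * freqSq m) * t) * -(4 * Real.pi ^ 2 * freqSq m))
        * tmode m (a m) x) t := by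
    refine HasDerivAt.fun_sum fun m _ => HasDerivAt.mul_const ?_ _
    simpa using ((hasDerivAt_id t).const_mul (-(4 * Real.pi ^ 2 * freqSq m))).exp
  refine h.congr_deriv ?_
  simp only [heat]
  rw [Finset.sum_comm]
  refine Finset.sum_congr rfl fun m _ => ?_
  rw [mul_assoc, ← Finset.mul_sum, ← lapl_tmode]
  simp only [lapl, pd_tmode]

/-- The multiplier `m_i m_j / |m|²` of the double Riesz transform. -/
noncomputable def rieszMult (i j : Fin d) (m : Fin d → ℤ) : ℝ := m i * m j / freqSq m

theorem freqSq_pos {m : Fin d → ℤ} (hm : m ≠ 0) : 0 < freqSq m := by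
  obtain ⟨i, hi⟩ := Function.ne_iff.1 hm
  refine Finset.sum_pos' (fun _ _ => sq_nonneg _) ⟨i, Finset.mem_univ _, ?_⟩
  have : (m i : ℝ) ≠ 0 := by exact_mod_cast hi
  positivity

theorem freqSq_mul_rieszMult (i j : Fin d) (m : Fin d → ℤ) :
    freqSq m * rieszMult i j m = m i * m j := by
  by_cases hm : m = 0
  · subst hm; simp [rieszMult]
  · rw [rieszMult, mul_div_cancel₀ _ (freqSq_pos hm).ne']

theorem sum_heat_riesz (s : Finset (Fin d → ℤ)) (a : (Fin d → ℤ) → ℂ) (t : ℝ) (x : Torus d)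
    (i j : Fin d) : ∑ k, heat s (fun m => freq m k * (freq m k * (rieszMult i j m * a m))) t x =
      heat s (fun m => freq m i * (freq m j * a m)) t x := by
  simp only [heat]
  rw [Finset.sum_comm]
  refine Finset.sum_congr rfl fun m _ => ?_
  rw [← Finset.mul_sum]
  congr 1
  have h := lapl_tmode m (rieszMult i j m * a m) x
  simp only [lapl, pd_tmode] at h
  rw [h, tmode_real_mul, ← mul_assoc, ← mul_assoc, freq_mul_freq, tmode_real_mul]
  have := freqSq_mul_rieszMult i j m
  linear_combination (-(4 * Real.pi ^ 2) * tmode m (a m) x) * this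

/-- Differentiation of an integral over the torus with respect to a parameter. -/
theorem hasDerivAt_integral_torus {Ψ Ψ' : ℝ → Torus d → ℝ}
    (hΨ : Continuous fun p : ℝ × Torus d => Ψ p.1 p.2)
    (hΨ' : Continuous fun p : ℝ × Torus d => Ψ' p.1 p.2)
    (h : ∀ t x, HasDerivAt (fun t => Ψ t x) (Ψ' t x) t) (t : ℝ) :
    HasDerivAt (fun t => ∫ x, Ψ t x) (∫ x, Ψ' t x) t := by
  obtain ⟨C, hC⟩ := (isCompact_Icc (a := t - 1) (b := t + 1)).prod (isCompact_univ (X := Torus d))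
    |>.exists_bound_of_continuousOn hΨ'.continuousOn
  have c1 : ∀ t, Continuous (Ψ t) := fun t => hΨ.comp (by fun_prop : Continuous fun x => (t, x))
  have c2 : ∀ t, Continuous (Ψ' t) := fun t => hΨ'.comp (by fun_prop : Continuous fun x => (t, x))
  exact (hasDerivAt_integral_of_dominated_loc_of_deriv_le (F := Ψ) (F' := Ψ') (x₀ := t)
    (s := Icc (t - 1) (t + 1)) (bound := fun _ => C)
    (Icc_mem_nhds (by linarith) (by linarith))
    (.of_forall fun t => (c1 t).aestronglyMeasurable) (integrable_of_continuous (c1 t))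
    (c2 t).aestronglyMeasurable (.of_forall fun x s hs => hC (s, x) ⟨hs, mem_univ _⟩)
    (integrable_const C) (.of_forall fun x s _ => h s x)).2

theorem heat_zero (s : Finset (Fin d → ℤ)) (a : (Fin d → ℤ) → ℂ) (x : Torus d) :
    heat s a 0 x = ∑ m ∈ s, tmode m (a m) x := by
  simp [heat]

theorem freqSq_nonneg (m : Fin d → ℤ) : 0 ≤ freqSq m := Finset.sum_nonneg fun _ _ => sq_nonneg _

theorem abs_heat_le (s : Finset (Fin d → ℤ)) (a : (Fin d → ℤ) → ℂ) (t : ℝ) (x : Torus d) :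
    |heat s a t x| ≤ ∑ m ∈ s, Real.exp (-(4 * Real.pi ^ 2 * freqSq m) * t) * ‖a m‖ := by
  refine (Finset.abs_sum_le_sum_abs _ _).trans (Finset.sum_le_sum fun m _ => ?_)
  rw [abs_mul, abs_of_pos (Real.exp_pos _)]
  exact mul_le_mul_of_nonneg_left (abs_tmode_le _ _ _) (Real.exp_pos _).le

theorem tendsto_integral_heat_riesz (s s' : Finset (Fin d → ℤ)) (a b : (Fin d → ℤ) → ℂ)
    (i j : Fin d) : Filter.Tendsto
      (fun t => ∫ x, heat s (fun m => rieszMult i j m * a m) t x * heat s' b t x)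
      Filter.atTop (nhds 0) := by
  have h1 : Filter.Tendsto (fun t : ℝ => (∑ m ∈ s, Real.exp (-(4 * Real.pi ^ 2 * freqSq m) * t)
      * ‖(rieszMult i j m : ℂ) * a m‖) * ∑ m ∈ s', ‖b m‖) Filter.atTop (nhds 0) := by
    rw [show (0:ℝ) = (∑ m ∈ s, 0) * ∑ m ∈ s', ‖b m‖ by simp]
    refine Filter.Tendsto.mul_const _ (tendsto_finsetSum _ fun m _ => ?_)
    by_cases hm : m = 0
    · subst hm; simp [rieszMult]
    · have h3 : 0 < 4 * Real.pi ^ 2 * freqSq m := by have := freqSq_pos hm; positivity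
      rw [show (0:ℝ) = 0 * ‖(rieszMult i j m : ℂ) * a m‖ by simp]
      refine Filter.Tendsto.mul_const _ (Real.tendsto_exp_atBot.comp ?_)
      exact Filter.tendsto_id.const_mul_atTop_of_neg (by linarith)
  refine squeeze_zero_norm' ?_ h1
  filter_upwards [Filter.eventually_ge_atTop 0] with t ht
  refine (norm_integral_le_of_norm_le_const (μ := volume)
    (C := (∑ m ∈ s, Real.exp (-(4 * Real.pi ^ 2 * freqSq m) * t)
      * ‖(rieszMult i j m : ℂ) * a m‖) * ∑ m ∈ s', ‖b m‖) (.of_forall fun x => ?_)).trans_eq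
      (by simp)
  rw [norm_mul]
  refine mul_le_mul (abs_heat_le _ _ _ _) ?_ (norm_nonneg _)
    (Finset.sum_nonneg fun m _ => by positivity)
  refine (abs_heat_le _ _ _ _).trans (Finset.sum_le_sum fun m _ => ?_)
  refine mul_le_of_le_one_left (norm_nonneg _) (Real.exp_le_one_iff.2 ?_)
  have : 0 ≤ 4 * Real.pi ^ 2 * freqSq m * t := by have := freqSq_nonneg m; positivity
  linarith

/-- The bilinear estimate for the double Riesz transform, with a Bellman function on the right. The
quantity `∫ bell (F, G) - σ ∫ W G` decreases along the heat flow, where `F`, `G` and `W` are the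
heat extensions of the two polynomials and of the Riesz transform of the first. -/
theorem riesz_bilinear_bell (hε : 0 < ε) (s s' : Finset (Fin d → ℤ)) (a b : (Fin d → ℤ) → ℂ)
    (i j : Fin d) {σ : ℝ} (hσ : |σ| ≤ 1) :
    σ * ∫ x, heat s (fun m => rieszMult i j m * a m) 0 x * heat s' b 0 x ≤
      ∫ x, bell ε (heat s a 0 x) (heat s' b 0 x) := by
  set F := heat s a with hFdef
  set G := heat s' b with hGdef
  set W := heat s (fun m => rieszMult i j m * a m) with hWdef
  set F1 : Fin d → ℝ → Torus d → ℝ := fun k => heat s (fun m => freq m k * a m)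
  set F2 : Fin d → Fin d → ℝ → Torus d → ℝ := fun k l =>
    heat s (fun m => freq m k * (freq m l * a m))
  set G1 : Fin d → ℝ → Torus d → ℝ := fun k => heat s' (fun m => freq m k * b m)
  set G2 : Fin d → ℝ → Torus d → ℝ := fun k => heat s' (fun m => freq m k * (freq m k * b m))
  set W1 : Fin d → ℝ → Torus d → ℝ := fun k => heat s (fun m => freq m k * (rieszMult i j m * a m))
  set W2 : Fin d → ℝ → Torus d → ℝ := fun k =>
    heat s (fun m => freq m k * (freq m k * (rieszMult i j m * a m)))
  have cF : Continuous fun p : ℝ × Torus d => F p.1 p.2 := continuous_heat _ _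
  have cG : Continuous fun p : ℝ × Torus d => G p.1 p.2 := continuous_heat _ _
  have cW : Continuous fun p : ℝ × Torus d => W p.1 p.2 := continuous_heat _ _
  have cF2 : ∀ k l, Continuous fun p : ℝ × Torus d => F2 k l p.1 p.2 := fun k l =>
    continuous_heat _ _
  have cG2 : ∀ k, Continuous fun p : ℝ × Torus d => G2 k p.1 p.2 := fun k => continuous_heat _ _
  have cW2 : ∀ k, Continuous fun p : ℝ × Torus d => W2 k p.1 p.2 := fun k => continuous_heat _ _
  set M : ℝ → ℝ := fun t => ∫ x, (bell ε (F t x) (G t x) - σ * (W t x * G t x)) with hM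
  have hderiv : ∀ t, HasDerivAt M (∫ x, ((bellX ε (F t x) (G t x) * (∑ k, F2 k k t x)
      + bellY ε (F t x) (G t x) * (∑ k, G2 k t x))
      - σ * ((∑ k, W2 k t x) * G t x + W t x * ∑ k, G2 k t x))) t := by
    refine hasDerivAt_integral_torus ?_ ?_ fun t x => ?_
    · exact (Continuous.bell hε cF cG).sub (by fun_prop)
    · have h1 := Continuous.bellX hε cF cG
      have h2 := Continuous.bellY hε cF cG
      fun_prop
    · exact (HasDerivAt.bell hε (heat_hasDerivAt s a t x) (heat_hasDerivAt s' b t x)).sub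
        (((heat_hasDerivAt s _ t x).mul (heat_hasDerivAt s' b t x)).const_mul σ)
  have hnonpos : ∀ t, (∫ x, ((bellX ε (F t x) (G t x) * (∑ k, F2 k k t x)
      + bellY ε (F t x) (G t x) * (∑ k, G2 k t x))
      - σ * ((∑ k, W2 k t x) * G t x + W t x * ∑ k, G2 k t x))) ≤ 0 := by
    intro t
    have dF : Continuous (F t) := continuous_heat_right _ _ _
    have dG : Continuous (G t) := continuous_heat_right _ _ _
    have dW : Continuous (W t) := continuous_heat_right _ _ _
    have dF1 : ∀ k, Continuous (F1 k t) := fun k => continuous_heat_right _ _ _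
    have dG1 : ∀ k, Continuous (G1 k t) := fun k => continuous_heat_right _ _ _
    have dW1 : ∀ k, Continuous (W1 k t) := fun k => continuous_heat_right _ _ _
    have dF2 : ∀ k l, Continuous (F2 k l t) := fun k l => continuous_heat_right _ _ _
    have dG2 : ∀ k, Continuous (G2 k t) := fun k => continuous_heat_right _ _ _
    have dW2 : ∀ k, Continuous (W2 k t) := fun k => continuous_heat_right _ _ _
    have dX := Continuous.bellX hε dF dG
    have dY := Continuous.bellY hε dF dG
    set Q : Fin d → Torus d → ℝ := fun k x =>
      F1 k t x * bellDX ε (F t x) (G t x) (F1 k t x) (G1 k t x)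
        + G1 k t x * bellDY ε (F t x) (G t x) (F1 k t x) (G1 k t x)
    have dQ : ∀ k, Continuous (Q k) := fun k =>
      ((dF1 k).mul (Continuous.bellDX hε dF dG (dF1 k) (dG1 k))).add
        ((dG1 k).mul (Continuous.bellDY hε dF dG (dF1 k) (dG1 k)))
    -- a total derivative; `Q k` is the Hessian of `bell` on the vector `(∂_k F, ∂_k G)`
    have hA : ∀ k, ∫ x, (Q k x + (bellX ε (F t x) (G t x) * F2 k k t x
        + bellY ε (F t x) (G t x) * G2 k t x)) = 0 := fun k => by
      have h1 : HasPd k (fun x => bellX ε (F t x) (G t x) * F1 k t x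
          + bellY ε (F t x) (G t x) * G1 k t x)
          (fun x => Q k x + (bellX ε (F t x) (G t x) * F2 k k t x
            + bellY ε (F t x) (G t x) * G2 k t x)) := by
        intro x
        have f0 := heat_hasPd s a t k x
        have g0 := heat_hasPd s' b t k x
        have f1 := heat_hasPd s (fun m => freq m k * a m) t k x
        have g1 := heat_hasPd s' (fun m => freq m k * b m) t k x
        have h := ((HasDerivAt.bellX hε f0 g0).mul f1).add ((HasDerivAt.bellY hε f0 g0).mul g1)
        refine h.congr_deriv ?_
        simp only [QuotientAddGroup.mk_zero, Pi.single_zero, add_zero, Q, F1, F2, G1, G2, F, G]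
        ring
      exact h1.integral_eq_zero (by fun_prop) (by fun_prop)
    -- the two Laplacians in the derivative of `∫ W G` contribute equally, and `Δ W = ∂_i ∂_j F`
    have hB : ∀ k, ∫ x, W t x * G2 k t x = ∫ x, W2 k t x * G t x := fun k => by
      have e1 := (heat_hasPd s (fun m => freq m k * (rieszMult i j m * a m)) t k).integral_mul_eq
        (heat_hasPd s' b t k) (dW1 k) (dW2 k) dG (dG1 k)
      have e2 := (heat_hasPd s (fun m => rieszMult i j m * a m) t k).integral_mul_eq
        (heat_hasPd s' (fun m => freq m k * b m) t k) dW (dW1 k) (dG1 k) (dG2 k)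
      change (∫ x, W2 k t x * G t x) = -∫ x, W1 k t x * G1 k t x at e1
      change (∫ x, W1 k t x * G1 k t x) = -∫ x, W t x * G2 k t x at e2
      linarith
    have hC : ∫ x, F2 i j t x * G t x = -∫ x, F1 j t x * G1 i t x :=
      (heat_hasPd s (fun m => freq m j * a m) t i).integral_mul_eq (heat_hasPd s' b t i) (dF1 j)
        (dF2 i j) dG (dG1 i)
    have hW2 : ∀ x, ∑ k, W2 k t x = F2 i j t x := fun x => sum_heat_riesz s a t x i j
    have key : (∫ x, ((bellX ε (F t x) (G t x) * (∑ k, F2 k k t x)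
        + bellY ε (F t x) (G t x) * (∑ k, G2 k t x))
        - σ * ((∑ k, W2 k t x) * G t x + W t x * ∑ k, G2 k t x))) =
        -∫ x, (∑ k, Q k x - 2 * σ * (F1 j t x * G1 i t x)) := by
      have e1 : (∑ k, ∫ x, (Q k x + (bellX ε (F t x) (G t x) * F2 k k t x
          + bellY ε (F t x) (G t x) * G2 k t x))) = 0 := Finset.sum_eq_zero fun k _ => hA k
      rw [← integral_finsetSum _ fun k _ => integrable_of_continuous (by fun_prop)] at e1
      have e2 : ∫ x, W t x * ∑ k, G2 k t x = ∫ x, F2 i j t x * G t x := by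
        simp_rw [← hW2, Finset.mul_sum, Finset.sum_mul]
        rw [integral_finsetSum _ fun k _ => integrable_of_continuous (by fun_prop),
          integral_finsetSum _ fun k _ => integrable_of_continuous (by fun_prop)]
        exact Finset.sum_congr rfl fun k _ => hB k
      have e3 : (∫ x, ((bellX ε (F t x) (G t x) * (∑ k, F2 k k t x)
          + bellY ε (F t x) (G t x) * (∑ k, G2 k t x))
          - σ * ((∑ k, W2 k t x) * G t x + W t x * ∑ k, G2 k t x)))
          = (∫ x, ∑ k, (Q k x + (bellX ε (F t x) (G t x) * F2 k k t x
            + bellY ε (F t x) (G t x) * G2 k t x))) - (∫ x, ∑ k, Q k x)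
            - σ * ((∫ x, F2 i j t x * G t x) + ∫ x, W t x * ∑ k, G2 k t x) := by
        rw [← integral_add (integrable_of_continuous (by fun_prop))
          (integrable_of_continuous (by fun_prop)), ← integral_const_mul,
          ← integral_sub (integrable_of_continuous (by fun_prop))
          (integrable_of_continuous (by fun_prop)), ← integral_sub
          (integrable_of_continuous (by fun_prop)) (integrable_of_continuous (by fun_prop))]
        refine integral_congr_ae (.of_forall fun x => ?_)
        simp only [Finset.sum_add_distrib, ← Finset.mul_sum, hW2]
        ring
      rw [e3, e1, e2, hC, integral_sub (integrable_of_continuous (by fun_prop))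
        (integrable_of_continuous (by fun_prop)), integral_const_mul]
      ring
    rw [key, neg_nonpos]
    refine integral_nonneg fun x => ?_
    have hS := bellRoot_pos hε (F t x) (G t x)
    set S := bellRoot ε (F t x) (G t x)
    have h1 : ∀ k, F1 k t x ^ 2 / S + S * G1 k t x ^ 2 ≤ Q k x := fun k =>
      bell_hessian_ge hε _ _ _ _
    -- of the lower bound for the Hessian only `∂_j F` and `∂_i G` are needed
    have h2 : F1 j t x ^ 2 / S + S * G1 i t x ^ 2 ≤ ∑ k, Q k x := by
      refine le_trans ?_ (Finset.sum_le_sum fun k _ => h1 k)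
      rw [Finset.sum_add_distrib]
      exact add_le_add
        (Finset.single_le_sum (f := fun k => F1 k t x ^ 2 / S) (fun k _ => by positivity)
          (Finset.mem_univ j))
        (Finset.single_le_sum (f := fun k => S * G1 k t x ^ 2) (fun k _ => by positivity)
          (Finset.mem_univ i))
    have h3 : 2 * σ * (F1 j t x * G1 i t x) ≤ F1 j t x ^ 2 / S + S * G1 i t x ^ 2 := by
      have e : F1 j t x ^ 2 / S + S * G1 i t x ^ 2 - 2 * σ * (F1 j t x * G1 i t x) =
          (F1 j t x - σ * S * G1 i t x) ^ 2 / S + (1 - σ ^ 2) * (S * G1 i t x ^ 2) := by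
        field_simp; ring
      have hσ2 : σ ^ 2 ≤ 1 := by rwa [sq_le_one_iff_abs_le_one]
      have : 0 ≤ (F1 j t x - σ * S * G1 i t x) ^ 2 / S + (1 - σ ^ 2) * (S * G1 i t x ^ 2) := by
        have := sub_nonneg.2 hσ2
        positivity
      linarith
    change 0 ≤ ∑ k, Q k x - 2 * σ * (F1 j t x * G1 i t x)
    linarith
  -- `M` decreases, and its limit is nonnegative because `∫ W G` tends to zero
  have hanti : Antitone M := antitone_of_hasDerivAt_nonpos hderiv hnonpos
  have hM_eq : ∀ t, M t = (∫ x, bell ε (F t x) (G t x)) - σ * ∫ x, W t x * G t x := fun t => by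
    have dF : Continuous (F t) := continuous_heat_right _ _ _
    have dG : Continuous (G t) := continuous_heat_right _ _ _
    have dW : Continuous (W t) := continuous_heat_right _ _ _
    have dB := Continuous.bell hε dF dG
    rw [hM, ← integral_const_mul]
    exact integral_sub (integrable_of_continuous dB) (integrable_of_continuous (by fun_prop))
  have hlim := (tendsto_integral_heat_riesz s s' a b i j).const_mul σ |>.neg
  simp only [mul_zero, neg_zero] at hlim
  have h0 : 0 ≤ M 0 := by
    refine le_of_tendsto hlim ?_
    filter_upwards [Filter.eventually_ge_atTop 0] with t ht
    have h1 := hanti ht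
    have h2 : 0 ≤ ∫ x, bell ε (F t x) (G t x) := integral_nonneg fun x => bell_nonneg hε _ _
    rw [hM_eq t] at h1
    linarith
  rw [hM_eq 0] at h0
  linarith

end Riesz

end TorusFluid

namespace TorusFluid

open scoped ENNReal

/-! ### Boundedness of the double Riesz transform on `L^{3/2}` -/

section CalderonZygmund

variable {d : ℕ}

/-- The double Riesz transform of the trigonometric polynomial with coefficients `a`. -/
noncomputable def rieszPoly (i j : Fin d) (a : (Fin d → ℤ) →₀ ℂ) (x : Torus d) : ℝ :=
  ∑ m ∈ a.support, tmode m (rieszMult i j m * a m) x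

theorem continuous_rieszPoly (i j : Fin d) (a : (Fin d → ℤ) →₀ ℂ) : Continuous (rieszPoly i j a) :=
  continuous_finsetSum _ fun m _ => continuous_tmode m _

theorem tmode_zero (m : Fin d → ℤ) (x : Torus d) : tmode m 0 x = 0 := by simp [tmode]

theorem tmode_sub (m : Fin d → ℤ) (c c' : ℂ) (x : Torus d) :
    tmode m (c - c') x = tmode m c x - tmode m c' x := by
  rw [sub_eq_add_neg, tmode_add, tmode_neg, ← sub_eq_add_neg]

theorem trigPoly_sub (a b : (Fin d → ℤ) →₀ ℂ) (x : Torus d) :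
    trigPoly (a - b) x = trigPoly a x - trigPoly b x :=
  Finsupp.sum_sub_index (h := fun m c => tmode m c x) fun m c c' => tmode_sub m c c' x

theorem rieszPoly_sub (i j : Fin d) (a b : (Fin d → ℤ) →₀ ℂ) (x : Torus d) :
    rieszPoly i j (a - b) x = rieszPoly i j a x - rieszPoly i j b x :=
  Finsupp.sum_sub_index (h := fun m c => tmode m (rieszMult i j m * c) x) fun m c c' => by
    rw [mul_sub, tmode_sub]

/-- The bilinear estimate for the double Riesz transform: the limit `ε → 0` of
`riesz_bilinear_bell`. -/
theorem riesz_bilinear (i j : Fin d) (a b : (Fin d → ℤ) →₀ ℂ) :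
    ∫ x, rieszPoly i j a x * trigPoly b x ≤
      5 * ((∫ x, |trigPoly a x| ^ (3 / 2 : ℝ)) + ∫ x, |trigPoly b x| ^ (3 : ℝ)) := by
  have ca := continuous_trigPoly a
  have cb := continuous_trigPoly b
  refine le_of_forall_pos_le_add fun δ hδ => ?_
  -- the choice of `ε` makes the constant term of `bell_le` equal to `δ`
  set ε : ℝ := (δ / 5) ^ (4 / 3 : ℝ) with hε
  have hε0 : 0 < ε := Real.rpow_pos_of_pos (by positivity) _
  have h := riesz_bilinear_bell hε0 a.support b.support a b i j (σ := 1) (by simp)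
  simp only [heat_zero, one_mul] at h
  have i1 : Integrable fun x => |trigPoly a x| ^ (3 / 2 : ℝ) :=
    integrable_of_continuous (ca.abs.rpow_const fun _ => Or.inr (by norm_num))
  have i2 : Integrable fun x => |trigPoly b x| ^ (3 : ℝ) :=
    integrable_of_continuous (cb.abs.rpow_const fun _ => Or.inr (by norm_num))
  have h2 : ∫ x, bell ε (trigPoly a x) (trigPoly b x) ≤
      ∫ x, 5 * (ε ^ (3 / 4 : ℝ) + |trigPoly a x| ^ (3 / 2 : ℝ) + |trigPoly b x| ^ (3 : ℝ)) :=
    integral_mono (integrable_of_continuous (Continuous.bell hε0 ca cb))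
      ((((integrable_const _).add i1).add i2).const_mul 5) fun x => bell_le hε0 _ _
  have e : ε ^ (3 / 4 : ℝ) = δ / 5 := by
    rw [hε, ← Real.rpow_mul (by positivity)]; norm_num
  have i3 : Integrable fun x => ε ^ (3 / 4 : ℝ) + |trigPoly a x| ^ (3 / 2 : ℝ) :=
    (integrable_const _).add i1
  rw [integral_const_mul, integral_add i3 i2, integral_add (integrable_const _) i1, integral_const,
    e] at h2
  simp only [probReal_univ, one_smul] at h2
  refine h.trans (h2.trans (le_of_eq ?_))
  ring

/-- The bilinear estimate against arbitrary continuous functions. -/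
theorem riesz_bilinear_continuous (i j : Fin d) (a : (Fin d → ℤ) →₀ ℂ) {g : Torus d → ℝ}
    (hg : Continuous g) : ∫ x, rieszPoly i j a x * g x ≤
      5 * ((∫ x, |trigPoly a x| ^ (3 / 2 : ℝ)) + ∫ x, |g x| ^ (3 : ℝ)) := by
  -- uniform approximation of `g` by trigonometric polynomials
  choose b hb using fun n : ℕ => exists_trigPoly_close hg (Nat.one_div_pos_of_nat (α := ℝ) (n := n))
  obtain ⟨C, hC0, hC⟩ := exists_norm_le hg
  obtain ⟨D, hD0, hD⟩ := exists_norm_le (continuous_rieszPoly i j a)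
  have hlim : ∀ x, Filter.Tendsto (fun n => trigPoly (b n) x) Filter.atTop (nhds (g x)) := by
    intro x
    rw [tendsto_iff_dist_tendsto_zero]
    refine squeeze_zero (fun _ => dist_nonneg) (fun n => ?_)
      (tendsto_one_div_add_atTop_nhds_zero_nat (𝕜 := ℝ))
    rw [dist_comm]; exact (hb n x).le
  have hbd : ∀ n x, |trigPoly (b n) x| ≤ C + 1 := fun n x => by
    have h1 := hb n x
    have h2 : (1 : ℝ) / (n + 1) ≤ 1 := by
      rw [div_le_one (by positivity)]; linarith [(Nat.cast_nonneg n : (0:ℝ) ≤ n)]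
    have h3 : |trigPoly (b n) x| ≤ |g x| + |g x - trigPoly (b n) x| := by
      have := abs_sub (g x) (g x - trigPoly (b n) x)
      rwa [sub_sub_cancel] at this
    have := hC x
    rw [Real.norm_eq_abs] at this
    linarith
  have l1 : Filter.Tendsto (fun n => ∫ x, rieszPoly i j a x * trigPoly (b n) x) Filter.atTop
      (nhds (∫ x, rieszPoly i j a x * g x)) := by
    refine tendsto_integral_of_dominated_convergence (fun _ => D * (C + 1)) (fun n => ?_)
      (integrable_const _) (fun n => .of_forall fun x => ?_)
      (.of_forall fun x => (hlim x).const_mul _)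
    · exact ((continuous_rieszPoly i j a).mul (continuous_trigPoly (b n))).aestronglyMeasurable
    · rw [norm_mul]
      exact mul_le_mul (hD x) (hbd n x) (norm_nonneg _) hD0
  have l2 : Filter.Tendsto (fun n => ∫ x, |trigPoly (b n) x| ^ (3 : ℝ)) Filter.atTop
      (nhds (∫ x, |g x| ^ (3 : ℝ))) := by
    refine tendsto_integral_of_dominated_convergence (fun _ => (C + 1) ^ (3 : ℝ)) (fun n => ?_)
      (integrable_const _) (fun n => .of_forall fun x => ?_) (.of_forall fun x => ?_)
    · exact ((continuous_trigPoly (b n)).abs.rpow_const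
        fun _ => Or.inr (by norm_num)).aestronglyMeasurable
    · rw [Real.norm_of_nonneg (by positivity)]
      exact Real.rpow_le_rpow (abs_nonneg _) (hbd n x) (by norm_num)
    · exact (hlim x).abs.rpow_const (Or.inr (by norm_num))
  exact le_of_tendsto_of_tendsto' l1 ((l2.const_add _).const_mul 5) fun n =>
    riesz_bilinear i j a (b n)

/-- The dual exponent function `z ↦ sign(z) |z|^{1/2}`. -/
noncomputable def signedSqrt (z : ℝ) : ℝ := √z - √(-z)

theorem mul_signedSqrt (z : ℝ) : z * signedSqrt z = |z| ^ (3 / 2 : ℝ) := by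
  have h : |z| ^ (3 / 2 : ℝ) = |z| * √|z| := by
    rw [Real.sqrt_eq_rpow, show (3 / 2 : ℝ) = 1 + 1 / 2 by norm_num,
      Real.rpow_add' (abs_nonneg z) (by norm_num), Real.rpow_one]
  rw [h, signedSqrt]
  rcases le_total 0 z with hz | hz
  · rw [abs_of_nonneg hz, Real.sqrt_eq_zero_of_nonpos (by linarith : -z ≤ 0), sub_zero]
  · rw [abs_of_nonpos hz, Real.sqrt_eq_zero_of_nonpos hz]; ring

theorem abs_signedSqrt (z : ℝ) : |signedSqrt z| = |z| ^ (1 / 2 : ℝ) := by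
  rw [← Real.sqrt_eq_rpow, signedSqrt]
  rcases le_total 0 z with hz | hz
  · rw [abs_of_nonneg hz, Real.sqrt_eq_zero_of_nonpos (by linarith : -z ≤ 0), sub_zero,
      abs_of_nonneg (Real.sqrt_nonneg _)]
  · rw [abs_of_nonpos hz, Real.sqrt_eq_zero_of_nonpos hz, zero_sub, abs_neg,
      abs_of_nonneg (Real.sqrt_nonneg _)]

theorem integral_rieszPoly_le (i j : Fin d) (a : (Fin d → ℤ) →₀ ℂ) :
    ∫ x, |rieszPoly i j a x| ^ (3 / 2 : ℝ) ≤ 30 * ∫ x, |trigPoly a x| ^ (3 / 2 : ℝ) := by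
  have cr := continuous_rieszPoly i j a
  have cs : Continuous signedSqrt := by unfold signedSqrt; fun_prop
  -- testing with a quarter of the dual function makes the cubic term absorbable
  have h := riesz_bilinear_continuous i j a (g := fun x => 1 / 4 * signedSqrt (rieszPoly i j a x))
    (by fun_prop)
  have e1 : ∀ x, rieszPoly i j a x * (1 / 4 * signedSqrt (rieszPoly i j a x)) =
      1 / 4 * |rieszPoly i j a x| ^ (3 / 2 : ℝ) := fun x => by
    rw [← mul_signedSqrt]; ring
  have e2 : ∀ x, |1 / 4 * signedSqrt (rieszPoly i j a x)| ^ (3 : ℝ) =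
      1 / 64 * |rieszPoly i j a x| ^ (3 / 2 : ℝ) := fun x => by
    rw [abs_mul, abs_signedSqrt, Real.mul_rpow (abs_nonneg _) (by positivity),
      ← Real.rpow_mul (abs_nonneg _), abs_of_pos (by norm_num)]
    norm_num
  simp_rw [e1, e2, integral_const_mul] at h
  have h0 : 0 ≤ ∫ x, |trigPoly a x| ^ (3 / 2 : ℝ) := integral_nonneg fun x => by positivity
  linarith

theorem eLpNorm_rieszPoly_le (i j : Fin d) (a : (Fin d → ℤ) →₀ ℂ) :
    eLpNorm (rieszPoly i j a) (3 / 2) volume ≤ 30 * eLpNorm (trigPoly a) (3 / 2) volume := by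
  have key : ∀ {f : Torus d → ℝ}, Continuous f → eLpNorm f (3 / 2) volume =
      ENNReal.ofReal ((∫ x, |f x| ^ (3 / 2 : ℝ)) ^ (2 / 3 : ℝ)) := fun {f} hf => by
    have hm : MemLp f (3 / 2) volume := by
      obtain ⟨C, -, hC⟩ := exists_norm_le hf
      exact MemLp.of_bound hf.aestronglyMeasurable C (.of_forall hC)
    rw [hm.eLpNorm_eq_integral_rpow_norm (by simp) (ENNReal.div_ne_top (by simp) (by simp))]
    simp [ENNReal.toReal_div]
  rw [key (continuous_rieszPoly i j a), key (continuous_trigPoly a),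
    show (30 : ℝ≥0∞) = ENNReal.ofReal 30 by simp, ← ENNReal.ofReal_mul (by norm_num)]
  refine ENNReal.ofReal_le_ofReal ?_
  have h0 : 0 ≤ ∫ x, |trigPoly a x| ^ (3 / 2 : ℝ) := integral_nonneg fun x => by positivity
  refine (Real.rpow_le_rpow (integral_nonneg fun x => by positivity)
    (integral_rieszPoly_le i j a) (by norm_num)).trans ?_
  rw [Real.mul_rpow (by norm_num) h0]
  refine mul_le_mul_of_nonneg_right ?_ (by positivity)
  calc (30 : ℝ) ^ (2 / 3 : ℝ) ≤ 30 ^ (1 : ℝ) :=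
        Real.rpow_le_rpow_of_exponent_le (by norm_num) (by norm_num)
    _ = 30 := Real.rpow_one _

theorem integral_tmode_eq_zero {m : Fin d → ℤ} (hm : m ≠ 0) (c : ℂ) : ∫ x, tmode m c x = 0 := by
  have h0 : ∫ x, lapl (tmode m c) x = 0 := by
    simp only [lapl]
    rw [integral_finsetSum _ fun k _ =>
      integrable_of_continuous (((tmode_smooth m c).pd k).pd k).continuous]
    exact Finset.sum_eq_zero fun k _ => (((tmode_smooth m c).pd k).hasPd k).integral_eq_zero
      ((tmode_smooth m c).pd k).continuous (((tmode_smooth m c).pd k).pd k).continuous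
  simp_rw [lapl_tmode, integral_const_mul] at h0
  have := freqSq_pos hm
  exact (mul_eq_zero.1 h0).resolve_left (by have := Real.pi_pos; simp; positivity)

theorem integral_rieszPoly (i j : Fin d) (a : (Fin d → ℤ) →₀ ℂ) : ∫ x, rieszPoly i j a x = 0 := by
  simp only [rieszPoly]
  rw [integral_finsetSum _ fun m _ => integrable_of_continuous (continuous_tmode m _)]
  refine Finset.sum_eq_zero fun m _ => ?_
  by_cases hm : m = 0
  · subst hm; simp [rieszMult, tmode_zero]
  · exact integral_tmode_eq_zero hm _

/-- Two integrations by parts on the torus. -/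
theorem integral_pd_pd_mul {f g : Torus d → ℝ} (hf : SmoothOnTorus f) (hg : SmoothOnTorus g)
    (i j : Fin d) : ∫ x, pd i (pd j f) x * g x = ∫ x, f x * pd j (pd i g) x := by
  have e1 := ((hf.pd j).hasPd i).integral_mul_eq (hg.hasPd i) (hf.pd j).continuous
    ((hf.pd j).pd i).continuous hg.continuous (hg.pd i).continuous
  have e2 := (hf.hasPd j).integral_mul_eq ((hg.pd i).hasPd j) hf.continuous
    (hf.pd j).continuous (hg.pd i).continuous ((hg.pd i).pd j).continuous
  linarith

theorem integral_lapl_mul {f g : Torus d → ℝ} (hf : SmoothOnTorus f) (hg : SmoothOnTorus g) :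
    ∫ x, lapl f x * g x = ∫ x, f x * lapl g x := by
  simp only [lapl, Finset.sum_mul, Finset.mul_sum]
  have c1 : ∀ k, Continuous fun x => pd k (pd k f) x * g x := fun k =>
    ((hf.pd k).pd k).continuous.mul hg.continuous
  have c2 : ∀ k, Continuous fun x => f x * pd k (pd k g) x := fun k =>
    hf.continuous.mul ((hg.pd k).pd k).continuous
  rw [integral_finsetSum _ fun k _ => integrable_of_continuous (c1 k),
    integral_finsetSum _ fun k _ => integrable_of_continuous (c2 k)]
  exact Finset.sum_congr rfl fun k _ => integral_pd_pd_mul hf hg k k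

theorem freqSq_mul_integral_rieszPoly (i j : Fin d) (a : (Fin d → ℤ) →₀ ℂ) (m : Fin d → ℤ)
    (c : ℂ) : freqSq m * ∫ x, rieszPoly i j a x * tmode m c x =
      m i * m j * ∫ x, trigPoly a x * tmode m c x := by
  have sf : SmoothOnTorus (trigPoly a) := SmoothOnTorus.sum _ fun m _ => tmode_smooth m _
  have sr : SmoothOnTorus (rieszPoly i j a) := SmoothOnTorus.sum _ fun m _ => tmode_smooth m _
  have h1 : ∀ x, lapl (rieszPoly i j a) x = pd i (pd j (trigPoly a)) x := fun x => by
    have e1 : ∀ k, pd k (rieszPoly i j a) =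
        fun x => ∑ m ∈ a.support, tmode m (freq m k * (rieszMult i j m * a m)) x := fun k =>
      HasPd.pd_eq (HasPd.sum _ fun m _ => tmode_hasPd m _ k)
    have e2 : ∀ k, pd k (pd k (rieszPoly i j a)) =
        fun x => ∑ m ∈ a.support, tmode m (freq m k * (freq m k * (rieszMult i j m * a m))) x :=
      fun k => by rw [e1]; exact HasPd.pd_eq (HasPd.sum _ fun m _ => tmode_hasPd m _ k)
    have e3 : pd j (trigPoly a) = fun x => ∑ m ∈ a.support, tmode m (freq m j * a m) x :=
      HasPd.pd_eq (HasPd.sum _ fun m _ => tmode_hasPd m _ j)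
    have e4 : pd i (pd j (trigPoly a)) =
        fun x => ∑ m ∈ a.support, tmode m (freq m i * (freq m j * a m)) x := by
      rw [e3]; exact HasPd.pd_eq (HasPd.sum _ fun m _ => tmode_hasPd m _ i)
    have h := sum_heat_riesz a.support a 0 x i j
    simp only [heat_zero] at h
    simp only [lapl, e2, e4, h]
  have h2 := integral_lapl_mul sr (tmode_smooth m c)
  simp_rw [h1, integral_pd_pd_mul sf (tmode_smooth m c), lapl_tmode, pd_pd_tmode,
    mul_left_comm _ _ (tmode m c _), integral_const_mul] at h2
  have hpi : (4 * Real.pi ^ 2) ≠ 0 := by have := Real.pi_pos; positivity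
  apply mul_left_cancel₀ hpi
  linarith

theorem exists_trigPoly_eLpNorm_sub_le {h : Torus d → ℝ} (hh : MemLp h (3 / 2) volume) {δ : ℝ}
    (hδ : 0 < δ) : ∃ a : (Fin d → ℤ) →₀ ℂ,
      eLpNorm (h - trigPoly a) (3 / 2) volume ≤ ENNReal.ofReal δ := by
  have hp : (3 / 2 : ℝ≥0∞) ≠ ⊤ := ENNReal.div_ne_top (by simp) (by simp)
  have hp1 : (1 : ℝ≥0∞) ≤ 3 / 2 := by
    rw [ENNReal.le_div_iff_mul_le (by simp) (by simp)]; norm_num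
  obtain ⟨g, hg1, hg2⟩ := hh.exists_boundedContinuous_eLpNorm_sub_le hp
    (ε := ENNReal.ofReal (δ / 2)) (by simpa using hδ)
  obtain ⟨a, ha⟩ := exists_trigPoly_close g.continuous (half_pos hδ)
  refine ⟨a, ?_⟩
  have e : h - trigPoly a = (h - g) + (⇑g - trigPoly a) := by abel
  have m1 : AEStronglyMeasurable (⇑g - trigPoly a) volume :=
    (g.continuous.sub (continuous_trigPoly a)).aestronglyMeasurable
  rw [e]
  refine (eLpNorm_add_le (hh.aestronglyMeasurable.sub g.continuous.aestronglyMeasurable)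
    m1 hp1).trans ?_
  have h2 : eLpNorm (⇑g - trigPoly a) (3 / 2) volume ≤ ENNReal.ofReal (δ / 2) := by
    refine (eLpNorm_le_of_ae_bound (.of_forall fun x => (ha x).le)).trans ?_
    simp
  refine (add_le_add hg1 h2).trans (le_of_eq ?_)
  rw [← ENNReal.ofReal_add (by positivity) (by positivity), add_halves]

theorem tendsto_integral_mul_of_eLpNorm {f : ℕ → Torus d → ℝ} {g : Torus d → ℝ}
    (hf : ∀ n, MemLp (f n) (3 / 2) volume) (hg : MemLp g (3 / 2) volume)
    (hlim : Filter.Tendsto (fun n => eLpNorm (f n - g) (3 / 2) volume) Filter.atTop (nhds 0))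
    {τ : Torus d → ℝ} (hτ : Continuous τ) :
    Filter.Tendsto (fun n => ∫ x, f n x * τ x) Filter.atTop (nhds (∫ x, g x * τ x)) := by
  have hp1 : (1 : ℝ≥0∞) ≤ 3 / 2 := by
    rw [ENNReal.le_div_iff_mul_le (by simp) (by simp)]; norm_num
  obtain ⟨C, hC0, hC⟩ := exists_norm_le hτ
  refine tendsto_integral_of_L1' _
    (integrable_mul_continuous (hg.integrable hp1) hτ).aestronglyMeasurable
    (.of_forall fun n => integrable_mul_continuous ((hf n).integrable hp1) hτ) ?_
  have h2 : Filter.Tendsto (fun n => ENNReal.ofReal C * eLpNorm (f n - g) (3 / 2) volume)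
      Filter.atTop (nhds 0) := by
    simpa using ENNReal.Tendsto.const_mul hlim (Or.inr ENNReal.ofReal_ne_top)
  refine tendsto_of_tendsto_of_tendsto_of_le_of_le tendsto_const_nhds h2 (fun _ => zero_le)
    fun n => ?_
  have h3 : eLpNorm (fun x => f n x * τ x - g x * τ x) 1 volume ≤
      ENNReal.ofReal C * eLpNorm (f n - g) 1 volume := by
    refine eLpNorm_le_mul_eLpNorm_of_ae_le_mul (.of_forall fun x => ?_) 1
    rw [← sub_mul, norm_mul, mul_comm]
    exact mul_le_mul_of_nonneg_right (hC x) (norm_nonneg _)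
  exact h3.trans (mul_le_mul_right (eLpNorm_le_eLpNorm_of_exponent_le hp1
    ((hf n).sub hg).aestronglyMeasurable) _)

/-- The double Riesz transform extends to `L^{3/2}`, with its Fourier coefficients. -/
theorem exists_riesz {h : Torus d → ℝ} (hh : MemLp h (3 / 2) volume) (i j : Fin d) :
    ∃ r : Torus d → ℝ, MemLp r (3 / 2) volume ∧
      eLpNorm r (3 / 2) volume ≤ 30 * eLpNorm h (3 / 2) volume ∧ ∫ x, r x = 0 ∧
      ∀ m c, freqSq m * ∫ x, r x * tmode m c x = m i * m j * ∫ x, h x * tmode m c x := by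
  have hp1 : (1 : ℝ≥0∞) ≤ 3 / 2 := by
    rw [ENNReal.le_div_iff_mul_le (by simp) (by simp)]; norm_num
  have hmem : ∀ {f : Torus d → ℝ}, Continuous f → MemLp f (3 / 2) volume := fun {f} hf => by
    obtain ⟨C, -, hC⟩ := exists_norm_le hf
    exact MemLp.of_bound hf.aestronglyMeasurable C (.of_forall hC)
  choose a ha using fun n : ℕ => exists_trigPoly_eLpNorm_sub_le hh
    (δ := (1 / 2) ^ n) (by positivity)
  have mt : ∀ n, MemLp (trigPoly (a n)) (3 / 2) volume := fun n => hmem (continuous_trigPoly _)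
  have mr : ∀ n, MemLp (rieszPoly i j (a n)) (3 / 2) volume := fun n =>
    hmem (continuous_rieszPoly _ _ _)
  have hpow : Filter.Tendsto (fun n : ℕ => ENNReal.ofReal ((1 / 2) ^ n)) Filter.atTop (nhds 0) := by
    have := ENNReal.tendsto_ofReal
      (tendsto_pow_atTop_nhds_zero_of_lt_one (r := (1 / 2 : ℝ)) (by norm_num) (by norm_num))
    simpa using this
  have hsub : ∀ n k, eLpNorm (trigPoly (a n) - trigPoly (a k)) (3 / 2) volume ≤
      ENNReal.ofReal ((1 / 2) ^ n) + ENNReal.ofReal ((1 / 2) ^ k) := fun n k => by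
    have e : trigPoly (a n) - trigPoly (a k) = -(h - trigPoly (a n)) + (h - trigPoly (a k)) := by
      abel
    rw [e]
    refine (eLpNorm_add_le (hh.sub (mt n)).neg.aestronglyMeasurable
      (hh.sub (mt k)).aestronglyMeasurable hp1).trans ?_
    rw [eLpNorm_neg]
    exact add_le_add (ha n) (ha k)
  -- the constant `61` exceeds `30 * 2`, to make the Cauchy estimate strict
  have hB : ∑' n : ℕ, ENNReal.ofReal (61 * (1 / 2) ^ n) ≠ ⊤ :=
    (Summable.mul_left 61 (summable_geometric_of_lt_one (by norm_num)
      (by norm_num : (1 / 2 : ℝ) < 1))).tsum_ofReal_ne_top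
  have hcau : ∀ N n k : ℕ, N ≤ n → N ≤ k →
      eLpNorm (rieszPoly i j (a n) - rieszPoly i j (a k)) (3 / 2) volume <
        ENNReal.ofReal (61 * (1 / 2) ^ N) := fun N n k hn hk => by
    have e1 : rieszPoly i j (a n) - rieszPoly i j (a k) = rieszPoly i j (a n - a k) :=
      funext fun x => (rieszPoly_sub i j _ _ x).symm
    have e2 : trigPoly (a n) - trigPoly (a k) = trigPoly (a n - a k) :=
      funext fun x => (trigPoly_sub _ _ x).symm
    have mono : ∀ l, N ≤ l → ENNReal.ofReal ((1 / 2) ^ l) ≤ ENNReal.ofReal ((1 / 2) ^ N) :=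
      fun l hl => ENNReal.ofReal_le_ofReal
        (pow_le_pow_of_le_one (by norm_num) (by norm_num) hl)
    have h1 := eLpNorm_rieszPoly_le i j (a n - a k)
    rw [← e1, ← e2] at h1
    refine (h1.trans (mul_le_mul_right ((hsub n k).trans (add_le_add (mono n hn) (mono k hk)))
      _)).trans_lt ?_
    rw [← ENNReal.ofReal_add (by positivity) (by positivity),
      show (30 : ℝ≥0∞) = ENNReal.ofReal 30 by simp, ← ENNReal.ofReal_mul (by norm_num),
      ENNReal.ofReal_lt_ofReal_iff (by positivity)]
    have : (0:ℝ) < (1 / 2) ^ N := by positivity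
    linarith
  obtain ⟨r, hr, hlim⟩ := Lp.cauchy_complete_eLpNorm hp1 mr hB hcau
  have hlim_t : Filter.Tendsto (fun n => eLpNorm (trigPoly (a n) - h) (3 / 2) volume)
      Filter.atTop (nhds 0) := by
    refine tendsto_of_tendsto_of_tendsto_of_le_of_le tendsto_const_nhds hpow (fun _ => zero_le)
      fun n => ?_
    rw [← neg_sub, eLpNorm_neg]
    exact ha n
  refine ⟨r, hr, ?_, ?_, fun m c => ?_⟩
  · have h1 : ∀ n, eLpNorm r (3 / 2) volume ≤
        eLpNorm (rieszPoly i j (a n) - r) (3 / 2) volume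
          + 30 * (eLpNorm (trigPoly (a n) - h) (3 / 2) volume + eLpNorm h (3 / 2) volume) := by
      intro n
      have e : r = -(rieszPoly i j (a n) - r) + rieszPoly i j (a n) := by abel
      have e' : trigPoly (a n) = (trigPoly (a n) - h) + h := by abel
      calc eLpNorm r (3 / 2) volume
          = eLpNorm (-(rieszPoly i j (a n) - r) + rieszPoly i j (a n)) (3 / 2) volume := by
            rw [← e]
        _ ≤ eLpNorm (-(rieszPoly i j (a n) - r)) (3 / 2) volume
            + eLpNorm (rieszPoly i j (a n)) (3 / 2) volume :=
            eLpNorm_add_le ((mr n).sub hr).neg.aestronglyMeasurable (mr n).aestronglyMeasurable hp1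
        _ ≤ _ := by
            rw [eLpNorm_neg]
            refine add_le_add le_rfl ((eLpNorm_rieszPoly_le i j (a n)).trans
              (mul_le_mul_right ?_ _))
            conv_lhs => rw [e']
            exact eLpNorm_add_le ((mt n).sub hh).aestronglyMeasurable hh.aestronglyMeasurable hp1
    have h2 : Filter.Tendsto (fun n => eLpNorm (rieszPoly i j (a n) - r) (3 / 2) volume
          + 30 * (eLpNorm (trigPoly (a n) - h) (3 / 2) volume + eLpNorm h (3 / 2) volume))
        Filter.atTop (nhds (0 + 30 * (0 + eLpNorm h (3 / 2) volume))) :=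
      hlim.add (ENNReal.Tendsto.const_mul (hlim_t.add_const _) (Or.inr (by simp)))
    simpa using ge_of_tendsto' h2 h1
  · have := tendsto_integral_mul_of_eLpNorm mr hr hlim (τ := fun _ => 1) continuous_const
    simp only [mul_one, integral_rieszPoly] at this
    exact tendsto_nhds_unique this tendsto_const_nhds
  · have l1 := (tendsto_integral_mul_of_eLpNorm mr hr hlim (continuous_tmode m c)).const_mul
      (freqSq m)
    have l2 := (tendsto_integral_mul_of_eLpNorm mt hh hlim_t (continuous_tmode m c)).const_mul
      ((m i : ℝ) * m j)
    simp_rw [freqSq_mul_integral_rieszPoly] at l1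
    exact tendsto_nhds_unique l1 l2

/-- The Calderón–Zygmund estimate for the pressure on the torus, at a fixed time: a mean-free
integrable `q` with `-Δq = ∑ ∂_i ∂_j h_{ij}` is in `L^{3/2}` when the `h_{ij}` are. -/
theorem eLpNorm_pressure_le {q H : Torus d → ℝ} {h : Fin d → Fin d → Torus d → ℝ}
    (hq : Integrable q) (hq0 : ∫ x, q x = 0) (hh : ∀ i j, MemLp (h i j) (3 / 2) volume)
    (hH : ∀ i j x, ‖h i j x‖ ≤ ‖H x‖)
    (hqh : ∀ m c, freqSq m * ∫ x, q x * tmode m c x =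
      -∑ i, ∑ j, (m i : ℝ) * m j * ∫ x, h i j x * tmode m c x) :
    eLpNorm q (3 / 2) volume ≤ (d * d * 30) * eLpNorm H (3 / 2) volume := by
  have hp1 : (1 : ℝ≥0∞) ≤ 3 / 2 := by
    rw [ENNReal.le_div_iff_mul_le (by simp) (by simp)]; norm_num
  choose r hr hrn hr0 hrc using fun i j => exists_riesz (hh i j) i j
  have ir : ∀ i j, Integrable (r i j) := fun i j => (hr i j).integrable hp1
  have hsum : Integrable fun x => ∑ i, ∑ j, r i j x :=
    integrable_finsetSum _ fun i _ => integrable_finsetSum _ fun j _ => ir i j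
  have hexp : ∀ m c, ∫ x, (q x + ∑ i, ∑ j, r i j x) * tmode m c x =
      (∫ x, q x * tmode m c x) + ∑ i, ∑ j, ∫ x, r i j x * tmode m c x := fun m c => by
    simp_rw [add_mul, Finset.sum_mul]
    have k1 : ∀ i j, Integrable fun x => r i j x * tmode m c x := fun i j =>
      integrable_mul_continuous (ir i j) (continuous_tmode m c)
    rw [integral_add (integrable_mul_continuous hq (continuous_tmode m c))
      (integrable_finsetSum _ fun i _ => integrable_finsetSum _ fun j _ => k1 i j),
      integral_finsetSum _ fun i _ => integrable_finsetSum _ fun j _ => k1 i j]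
    simp_rw [integral_finsetSum _ fun j _ => k1 _ j]
  -- `q = -∑ R_i R_j h_{ij}`, because all Fourier coefficients agree
  have hz : (fun x => q x + ∑ i, ∑ j, r i j x) =ᵐ[volume] 0 := by
    refine ae_eq_zero_of_tmode (hq.add hsum) fun m c => ?_
    rw [hexp]
    by_cases hm : m = 0
    · subst hm
      have e : ∀ x : Torus d, tmode 0 c x = c.re := fun x => by
        simp [tmode, UnitAddTorus.mFourier_zero]
      simp_rw [e, integral_mul_const, hq0, hr0]
      simp
    · have h1 := hqh m c
      simp_rw [← hrc] at h1
      simp_rw [← Finset.mul_sum] at h1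
      have := (freqSq_pos hm).ne'
      apply mul_left_cancel₀ this
      rw [mul_add, h1]; ring
  have hq_eq : q =ᵐ[volume] -∑ i, ∑ j, r i j := by
    filter_upwards [hz] with x hx
    simp only [Pi.zero_apply] at hx
    simp only [Pi.neg_apply, Finset.sum_apply]
    linarith
  rw [eLpNorm_congr_ae hq_eq, eLpNorm_neg]
  have b : ∀ i j, eLpNorm (r i j) (3 / 2) volume ≤ 30 * eLpNorm H (3 / 2) volume := fun i j =>
    (hrn i j).trans (mul_le_mul_right (eLpNorm_mono (hH i j)) _)
  refine (eLpNorm_sum_le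
    (fun i _ => (integrable_finsetSum' _ fun j _ => ir i j).aestronglyMeasurable) hp1).trans ?_
  refine (Finset.sum_le_sum fun i _ => (eLpNorm_sum_le
    (fun j _ => (ir i j).aestronglyMeasurable) hp1).trans
      (Finset.sum_le_sum fun j _ => b i j)).trans (le_of_eq ?_)
  simp only [Finset.sum_const, Finset.card_univ, Fintype.card_fin, nsmul_eq_mul]
  ring

end CalderonZygmund

end TorusFluid

namespace TorusFluid

/-! ### Weak derivatives in time -/

section TimeDerivative

/-- Smooth functions with compact support in `(0,T)`. -/
structure IsTimeTest (T : ℝ) (χ : ℝ → ℝ) : Prop where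
  smooth : ContDiff ℝ ∞ χ
  support : ∃ a b : ℝ, 0 < a ∧ b < T ∧ ∀ t, t ∉ Icc a b → χ t = 0

/-- `g` is the weak derivative of the integrable function `f` on `(0,T)`. -/
structure HasWeakDeriv (T : ℝ) (f g : ℝ → ℝ) : Prop where
  left : IntegrableOn f (Ioo 0 T)
  right : IntegrableOn g (Ioo 0 T)
  eq : ∀ χ, IsTimeTest T χ → ∫ t in Ioo 0 T, f t * deriv χ t = -∫ t in Ioo 0 T, g t * χ t

namespace IsTimeTest

variable {T : ℝ} {χ ψ : ℝ → ℝ}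

lemma differentiable (h : IsTimeTest T χ) : Differentiable ℝ χ :=
  h.smooth.differentiable (by simp)

lemma continuous (h : IsTimeTest T χ) : Continuous χ := h.smooth.continuous

lemma eq_zero (h : IsTimeTest T χ) {t : ℝ} (ht : t ∉ Ioo 0 T) : χ t = 0 := by
  obtain ⟨a, b, ha, hb, hab⟩ := h.support
  exact hab t fun h' => ht ⟨ha.trans_le h'.1, h'.2.trans_lt hb⟩

lemma exists_norm_le (h : IsTimeTest T χ) : ∃ C, 0 ≤ C ∧ ∀ t, ‖χ t‖ ≤ C := by
  obtain ⟨a, b, -, -, hab⟩ := h.support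
  obtain ⟨C, hC⟩ := isCompact_Icc.exists_bound_of_continuousOn
    (h.continuous.continuousOn (s := Icc a b))
  refine ⟨max C 0, le_max_right _ _, fun t => ?_⟩
  by_cases ht : t ∈ Icc a b
  · exact (hC t ht).trans (le_max_left _ _)
  · simp [hab t ht]

lemma deriv (h : IsTimeTest T χ) : IsTimeTest T (deriv χ) := by
  obtain ⟨a, b, ha, hb, hab⟩ := h.support
  refine ⟨(contDiff_infty_iff_deriv.1 h.smooth).2, a, b, ha, hb, fun t ht => ?_⟩
  have : χ =ᶠ[nhds t] fun _ => 0 := by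
    filter_upwards [isClosed_Icc.isOpen_compl.mem_nhds ht] with s hs using hab s hs
  rw [this.deriv_eq]; simp

lemma absolutelyContinuous (h : IsTimeTest T χ) : AbsolutelyContinuousOnInterval χ 0 T :=
  (h.smooth.of_le (by simp)).contDiffOn.absolutelyContinuousOnInterval

lemma const_mul (h : IsTimeTest T χ) (c : ℝ) : IsTimeTest T fun t => c * χ t := by
  obtain ⟨a, b, ha, hb, hab⟩ := h.support
  exact ⟨contDiff_const.mul h.smooth, a, b, ha, hb, fun t ht => by simp [hab t ht]⟩

lemma sub (h : IsTimeTest T χ) (h' : IsTimeTest T ψ) : IsTimeTest T fun t => χ t - ψ t := by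
  obtain ⟨a, b, ha, hb, hab⟩ := h.support
  obtain ⟨a', b', ha', hb', hab'⟩ := h'.support
  refine ⟨h.smooth.sub h'.smooth, min a a', max b b', lt_min ha ha', max_lt hb hb',
    fun t ht => ?_⟩
  rw [hab t fun h => ht ⟨(min_le_left _ _).trans h.1, h.2.trans (le_max_left _ _)⟩,
    hab' t fun h => ht ⟨(min_le_right _ _).trans h.1, h.2.trans (le_max_right _ _)⟩, sub_zero]

lemma integrable (h : IsTimeTest T χ) : IntegrableOn χ (Ioo 0 T) :=
  (h.continuous.integrableOn_Icc (a := 0) (b := T)).mono_set Ioo_subset_Icc_self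

lemma integrable_mul (h : IsTimeTest T χ) {f : ℝ → ℝ} (hf : IntegrableOn f (Ioo 0 T)) :
    IntegrableOn (fun t => f t * χ t) (Ioo 0 T) := by
  obtain ⟨C, -, hC⟩ := h.exists_norm_le
  exact Integrable.mul_bdd (c := C) hf h.continuous.aestronglyMeasurable (.of_forall hC)

end IsTimeTest

lemma setIntegral_Ioo_eq {T : ℝ} (hT : 0 < T) (f : ℝ → ℝ) :
    ∫ t in Ioo 0 T, f t = ∫ t in (0 : ℝ)..T, f t := by
  rw [intervalIntegral.integral_of_le hT.le, integral_Ioc_eq_integral_Ioo]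

lemma exists_isTimeTest_integral_eq_one {T : ℝ} (hT : 0 < T) :
    ∃ η, IsTimeTest T η ∧ ∫ t in Ioo 0 T, η t = 1 := by
  let b : ContDiffBump (T / 2) := ⟨T / 8, T / 4, by positivity, by linarith⟩
  have hsupp : ∀ t, t ∉ Icc (T / 4) (3 * T / 4) → b.normed volume t = 0 := by
    intro t ht
    have : t ∉ Function.support (b.normed volume) := by
      rw [b.support_normed_eq, Real.ball_eq_Ioo]
      intro h
      refine ht ⟨?_, ?_⟩
      · have := h.1; simp only [b] at this; linarith
      · have := h.2; simp only [b] at this; linarith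
    simpa using! this
  refine ⟨b.normed volume, ⟨b.contDiff_normed, T / 4, 3 * T / 4, by linarith, by linarith, hsupp⟩,
    ?_⟩
  rw [← b.integral_normed (μ := volume)]
  refine setIntegral_eq_integral_of_forall_compl_eq_zero fun t ht => hsupp t fun h => ht ?_
  exact ⟨by linarith [h.1], by linarith [h.2]⟩

/-- A test function with zero integral is the derivative of a test function. -/
lemma IsTimeTest.exists_primitive {T : ℝ} (hT : 0 < T) {θ : ℝ → ℝ} (h : IsTimeTest T θ)
    (h0 : ∫ t in Ioo 0 T, θ t = 0) : ∃ χ, IsTimeTest T χ ∧ _root_.deriv χ = θ := by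
  obtain ⟨a, b, ha, hb, hab⟩ := h.support
  have hd : ∀ t, HasDerivAt (fun t => ∫ s in (0 : ℝ)..t, θ s) (θ t) t := fun t =>
    intervalIntegral.integral_hasDerivAt_right (h.continuous.intervalIntegrable _ _)
      h.continuous.aestronglyMeasurable.stronglyMeasurableAtFilter h.continuous.continuousAt
  have hderiv : _root_.deriv (fun t => ∫ s in (0 : ℝ)..t, θ s) = θ := funext fun t => (hd t).deriv
  refine ⟨_, ⟨contDiff_infty_iff_deriv.2 ⟨fun t => (hd t).differentiableAt, ?_⟩,
    min a (T / 2), max b (T / 2), lt_min ha (by linarith), max_lt hb (by linarith),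
    fun t ht => ?_⟩, hderiv⟩
  · rw [hderiv]; exact h.smooth
  · have key : ∀ x y : ℝ, (∀ s ∈ uIcc x y, θ s = 0) → ∫ s in x..y, θ s = 0 := by
      intro x y hxy
      rw [intervalIntegral.integral_congr (g := fun _ => 0) hxy]; simp
    rcases lt_or_ge t (min a (T / 2)) with h1 | h1
    · refine key _ _ fun s hs => hab s fun hs' => ?_
      have h2 := h1.trans_le (min_le_left _ _)
      rcases le_total 0 t with h3 | h3
      · rw [uIcc_of_le h3] at hs; linarith [hs.2, hs'.1]
      · rw [uIcc_of_ge h3] at hs; linarith [hs.2, hs'.1]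
    · have h2 : max b (T / 2) < t := by
        by_contra! h2; exact ht ⟨h1, h2⟩
      have hbt := (le_max_left _ _).trans_lt h2
      rw [← intervalIntegral.integral_add_adjacent_intervals (b := T)
        (h.continuous.intervalIntegrable _ _) (h.continuous.intervalIntegrable _ _),
        ← setIntegral_Ioo_eq hT, h0, zero_add]
      refine key _ _ fun s hs => hab s fun hs' => ?_
      rcases le_total T t with h3 | h3
      · rw [uIcc_of_le h3] at hs; linarith [hs.1, hs'.2]
      · rw [uIcc_of_ge h3] at hs; linarith [hs.1, hs'.2]

/-- The lemma of du Bois-Reymond. -/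
lemma exists_ae_eq_const {T : ℝ} (hT : 0 < T) {f : ℝ → ℝ} (hf : IntegrableOn f (Ioo 0 T))
    (h : ∀ χ, IsTimeTest T χ → ∫ t in Ioo 0 T, f t * deriv χ t = 0) :
    ∃ c, ∀ᵐ t ∂(volume.restrict (Ioo 0 T)), f t = c := by
  obtain ⟨η, hη, hη1⟩ := exists_isTimeTest_integral_eq_one hT
  set c := ∫ t in Ioo 0 T, f t * η t with hc
  have key : ∀ ψ, IsTimeTest T ψ → ∫ t in Ioo 0 T, (f t - c) * ψ t = 0 := by
    intro ψ hψ
    set I := ∫ t in Ioo 0 T, ψ t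
    -- `ψ - I η` has zero integral, so it is the derivative of a test function
    have hθ := hψ.sub (hη.const_mul I)
    obtain ⟨χ, hχ, hχ'⟩ := hθ.exists_primitive hT (by
      rw [integral_sub hψ.integrable (hη.const_mul I).integrable, integral_const_mul, hη1]
      simp [I])
    have h1 := h χ hχ
    rw [hχ'] at h1
    have h2 : ∀ t, f t * (ψ t - I * η t) = f t * ψ t - I * (f t * η t) := fun t => by ring
    simp only [h2] at h1
    rw [integral_sub (hψ.integrable_mul hf) ((hη.integrable_mul hf).const_mul I),
      integral_const_mul, ← hc] at h1
    have h3 : ∀ t, (f t - c) * ψ t = f t * ψ t - c * ψ t := fun t => by ring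
    simp only [h3]
    rw [integral_sub (hψ.integrable_mul hf) (hψ.integrable.const_mul c), integral_const_mul]
    linarith
  have hloc : LocallyIntegrableOn (fun t => f t - c) (Ioo 0 T) :=
    (hf.sub (integrableOn_const (by simp))).locallyIntegrableOn
  have := isOpen_Ioo.ae_eq_zero_of_integral_contDiff_smul_eq_zero hloc
    (fun g hg hgc hgs => ?_)
  · refine ⟨c, (ae_restrict_iff' measurableSet_Ioo).2 ?_⟩
    filter_upwards [this] with t ht h' using sub_eq_zero.1 (ht h')
  · have hg' : IsTimeTest T g := by
      refine ⟨hg, ?_⟩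
      rcases (tsupport g).eq_empty_or_nonempty with he | hne
      · refine ⟨T / 2, T / 2, by linarith, by linarith, fun t _ => ?_⟩
        exact image_eq_zero_of_notMem_tsupport (by simp [he])
      · have hK : IsCompact (tsupport g) := hgc
        refine ⟨sInf (tsupport g), sSup (tsupport g), (hgs (hK.sInf_mem hne)).1,
          (hgs (hK.sSup_mem hne)).2, fun t ht => ?_⟩
        refine image_eq_zero_of_notMem_tsupport fun h => ht ?_
        exact ⟨csInf_le hK.bddBelow h, le_csSup hK.bddAbove h⟩
    rw [← key g hg', ← setIntegral_eq_integral_of_forall_compl_eq_zero (s := Ioo 0 T)]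
    · simp only [smul_eq_mul, mul_comm]
    · intro t ht; simp [hg'.eq_zero ht]

/-- A weakly differentiable function is almost everywhere the integral of its derivative. -/
lemma HasWeakDeriv.exists_ae_eq {T : ℝ} (hT : 0 < T) {f g : ℝ → ℝ} (h : HasWeakDeriv T f g) :
    ∃ c, ∀ᵐ t ∂(volume.restrict (Ioo 0 T)), f t = c + ∫ s in (0 : ℝ)..t, g s := by
  have hgi : IntervalIntegrable g volume 0 T :=
    (intervalIntegrable_iff_integrableOn_Ioo_of_le hT.le).2 h.right
  have hac := hgi.absolutelyContinuousOnInterval_intervalIntegral (c := 0) (by simp)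
  have hGi : IntegrableOn (fun t => ∫ s in (0 : ℝ)..t, g s) (Ioo 0 T) := by
    have := hac.continuousOn
    rw [uIcc_of_le hT.le] at this
    exact this.integrableOn_Icc.mono_set Ioo_subset_Icc_self
  obtain ⟨c, hc⟩ := exists_ae_eq_const hT (f := fun t => f t - ∫ s in (0 : ℝ)..t, g s)
    (h.left.sub hGi) (fun χ hχ => by
      have h1 := hac.integral_mul_deriv_eq_deriv_mul hχ.absolutelyContinuous
      rw [hχ.eq_zero (by simp), hχ.eq_zero (by simp)] at h1
      have h2 : ∫ t in (0 : ℝ)..T, deriv (fun t => ∫ s in (0 : ℝ)..t, g s) t * χ t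
          = ∫ t in (0 : ℝ)..T, g t * χ t := by
        refine intervalIntegral.integral_congr_ae ?_
        filter_upwards [hgi.ae_hasDerivAt_integral] with t ht h'
        rw [(ht (uIoc_subset_uIcc h') 0 (by simp)).deriv]
      simp only [mul_zero, sub_self, zero_sub] at h1
      rw [h2, ← setIntegral_Ioo_eq hT, ← setIntegral_Ioo_eq hT] at h1
      simp only [sub_mul]
      rw [integral_sub (hχ.deriv.integrable_mul h.left) (hχ.deriv.integrable_mul hGi), h.eq χ hχ,
        h1]
      ring)
  exact ⟨c, hc.mono fun t ht => by linarith⟩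

/-- The product rule for weak derivatives, in integrated form. -/
lemma HasWeakDeriv.integral_mul {T : ℝ} (hT : 0 < T) {f₁ g₁ f₂ g₂ χ : ℝ → ℝ}
    (h₁ : HasWeakDeriv T f₁ g₁) (h₂ : HasWeakDeriv T f₂ g₂) (hχ : IsTimeTest T χ) :
    ∫ t in Ioo 0 T, f₁ t * f₂ t * deriv χ t
      = -∫ t in Ioo 0 T, (g₁ t * f₂ t + f₁ t * g₂ t) * χ t := by
  obtain ⟨c₁, hc₁⟩ := h₁.exists_ae_eq hT
  obtain ⟨c₂, hc₂⟩ := h₂.exists_ae_eq hT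
  have hi₁ : IntervalIntegrable g₁ volume 0 T :=
    (intervalIntegrable_iff_integrableOn_Ioo_of_le hT.le).2 h₁.right
  have hi₂ : IntervalIntegrable g₂ volume 0 T :=
    (intervalIntegrable_iff_integrableOn_Ioo_of_le hT.le).2 h₂.right
  have hconst : ∀ c : ℝ, AbsolutelyContinuousOnInterval (fun _ => c) 0 T := fun c =>
    ContDiffOn.absolutelyContinuousOnInterval contDiffOn_const
  have hac₁ := (hconst c₁).fun_add
    (hi₁.absolutelyContinuousOnInterval_intervalIntegral (c := 0) (by simp))
  have hac₂ := (hconst c₂).fun_add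
    (hi₂.absolutelyContinuousOnInterval_intervalIntegral (c := 0) (by simp))
  have h := (hac₁.fun_mul hac₂).integral_mul_deriv_eq_deriv_mul hχ.absolutelyContinuous
  rw [hχ.eq_zero (by simp), hχ.eq_zero (by simp)] at h
  have h2 : ∫ t in (0 : ℝ)..T, deriv (fun t => (c₁ + ∫ s in (0 : ℝ)..t, g₁ s)
        * (c₂ + ∫ s in (0 : ℝ)..t, g₂ s)) t * χ t
      = ∫ t in (0 : ℝ)..T, (g₁ t * (c₂ + ∫ s in (0 : ℝ)..t, g₂ s)
          + (c₁ + ∫ s in (0 : ℝ)..t, g₁ s) * g₂ t) * χ t := by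
    refine intervalIntegral.integral_congr_ae ?_
    filter_upwards [hi₁.ae_hasDerivAt_integral, hi₂.ae_hasDerivAt_integral] with t ht₁ ht₂ h'
    have h₁' := (ht₁ (uIoc_subset_uIcc h') 0 (by simp)).const_add c₁
    have h₂' := (ht₂ (uIoc_subset_uIcc h') 0 (by simp)).const_add c₂
    rw [(h₁'.fun_mul h₂').deriv]
  simp only [mul_zero, sub_self, zero_sub] at h
  rw [h2, ← setIntegral_Ioo_eq hT, ← setIntegral_Ioo_eq hT] at h
  calc _ = ∫ t in Ioo 0 T, (c₁ + ∫ s in (0 : ℝ)..t, g₁ s) * (c₂ + ∫ s in (0 : ℝ)..t, g₂ s)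
        * deriv χ t := by
        refine integral_congr_ae ?_
        filter_upwards [hc₁, hc₂] with t h1 h2
        rw [h1, h2]
    _ = -∫ t in Ioo 0 T, (g₁ t * (c₂ + ∫ s in (0 : ℝ)..t, g₂ s)
          + (c₁ + ∫ s in (0 : ℝ)..t, g₁ s) * g₂ t) * χ t := h
    _ = _ := by
        congr 1
        refine integral_congr_ae ?_
        filter_upwards [hc₁, hc₂] with t h1 h2
        rw [h1, h2]

end TimeDerivative

/-! ### Test functions with separated variables -/

section Separated

variable {d : ℕ} {T : ℝ} {χ : ℝ → ℝ} {ψ : Torus d → ℝ} {F : ℝ → Torus d → ℝ}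

/-- Integrability on `(0,T) × 𝕋^d` of a function of `(t, x)`. -/
abbrev SpaceTimeIntegrable (T : ℝ) (F : ℝ → Torus d → ℝ) : Prop :=
  Integrable (fun p : ℝ × Torus d => F p.1 p.2) (spaceTime d T)

/-- The pairing of `F` with the separated function `χ(t) ψ(x)`. -/
noncomputable def sepPair (T : ℝ) (F : ℝ → Torus d → ℝ) (χ : ℝ → ℝ) (ψ : Torus d → ℝ) : ℝ :=
  ∫ p, F p.1 p.2 * (χ p.1 * ψ p.2) ∂(spaceTime d T)

lemma IsTimeTest.isTest_smul {E : Type*} [NormedAddCommGroup E] [NormedSpace ℝ E]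
    (hχ : IsTimeTest T χ) (hψ : SmoothOnTorus ψ) (a : E) :
    IsTest T fun t (x : Torus d) => (χ t * ψ x) • a := by
  obtain ⟨a, b, ha, hb, hab⟩ := hχ.support
  have hψ' : ContDiff ℝ ∞ fun y : Vec d => ψ (proj y) := hψ
  exact ⟨((hχ.smooth.comp contDiff_fst).mul (hψ'.comp contDiff_snd)).smul contDiff_const,
    a, b, ha, hb, fun t x ht => by simp [hab t ht]⟩

lemma IsTimeTest.isTest (hχ : IsTimeTest T χ) (hψ : SmoothOnTorus ψ) :
    IsTest T fun t (x : Torus d) => χ t * ψ x := by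
  simpa using hχ.isTest_smul hψ (1 : ℝ)

lemma SmoothOnTorus.pd_const_mul (hψ : SmoothOnTorus ψ) (c : ℝ) (i : Fin d) :
    TorusFluid.pd i (fun x => c * ψ x) = fun x => c * TorusFluid.pd i ψ x :=
  ((hψ.hasPd i).const_mul c).pd_eq

lemma SmoothOnTorus.lapl_const_mul (hψ : SmoothOnTorus ψ) (c : ℝ) :
    TorusFluid.lapl (fun x => c * ψ x) = fun x => c * TorusFluid.lapl ψ x := by
  funext x
  simp only [TorusFluid.lapl, Finset.mul_sum]
  exact Finset.sum_congr rfl fun i _ => by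
    rw [hψ.pd_const_mul, (hψ.pd i).pd_const_mul]

lemma SpaceTimeIntegrable.mul_bounded (hF : SpaceTimeIntegrable T F) {θ : ℝ × Torus d → ℝ}
    (hθ : Continuous θ) {C : ℝ} (hC : ∀ p, ‖θ p‖ ≤ C) :
    Integrable (fun p : ℝ × Torus d => F p.1 p.2 * θ p) (spaceTime d T) :=
  Integrable.mul_bdd (c := C) hF hθ.aestronglyMeasurable (.of_forall hC)

lemma SpaceTimeIntegrable.mul_sep (hF : SpaceTimeIntegrable T F) (hχ : IsTimeTest T χ)
    (hψ : Continuous ψ) :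
    Integrable (fun p : ℝ × Torus d => F p.1 p.2 * (χ p.1 * ψ p.2)) (spaceTime d T) := by
  obtain ⟨C, hC0, hC⟩ := hχ.exists_norm_le
  obtain ⟨D, hD0, hD⟩ := TorusFluid.exists_norm_le hψ
  have hχc := hχ.continuous
  refine hF.mul_bounded (θ := fun p => χ p.1 * ψ p.2) (by fun_prop) (C := C * D) fun p => ?_
  rw [norm_mul]
  exact mul_le_mul (hC _) (hD _) (norm_nonneg _) hC0

lemma SpaceTimeIntegrable.ae_integrable (hF : SpaceTimeIntegrable T F) :
    ∀ᵐ t ∂(volume.restrict (Ioo 0 T)), Integrable (F t) :=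
  Integrable.prod_right_ae hF

lemma sepPair_eq_integral_time (hF : SpaceTimeIntegrable T F) (hχ : IsTimeTest T χ)
    (hψ : Continuous ψ) :
    sepPair T F χ ψ = ∫ t in Ioo 0 T, (∫ x, F t x * ψ x) * χ t := by
  rw [sepPair, spaceTime, integral_prod _ (hF.mul_sep hχ hψ)]
  refine integral_congr_ae (.of_forall fun t => ?_)
  change ∫ x, F t x * (χ t * ψ x) = (∫ x, F t x * ψ x) * χ t
  rw [← integral_mul_const]
  exact integral_congr_ae (.of_forall fun x => by ring)

lemma sepPair_eq_integral_space (hF : SpaceTimeIntegrable T F) (hχ : IsTimeTest T χ)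
    (hψ : Continuous ψ) :
    sepPair T F χ ψ = ∫ x, (∫ t in Ioo 0 T, F t x * χ t) * ψ x := by
  rw [sepPair, spaceTime, integral_prod_symm _ (hF.mul_sep hχ hψ)]
  refine integral_congr_ae (.of_forall fun x => ?_)
  change ∫ t in Ioo 0 T, F t x * (χ t * ψ x) = (∫ t in Ioo 0 T, F t x * χ t) * ψ x
  rw [← integral_mul_const]
  exact integral_congr_ae (.of_forall fun t => by ring)

lemma sepPair_const_mul (r : ℝ) :
    sepPair T F χ (fun x => r * ψ x) = r * sepPair T F χ ψ := by
  rw [sepPair, sepPair, ← integral_const_mul]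
  exact integral_congr_ae (.of_forall fun p => by ring)

lemma sepPair_tmode_real_mul (m : Fin d → ℤ) (r : ℝ) (c : ℂ) :
    sepPair T F χ (tmode m (r * c)) = r * sepPair T F χ (tmode m c) := by
  rw [← sepPair_const_mul]
  congr 1
  funext x
  exact tmode_real_mul m r c x

lemma integrableOn_integral_mul (hF : SpaceTimeIntegrable T F) (hψ : Continuous ψ) :
    IntegrableOn (fun t => ∫ x, F t x * ψ x) (Ioo 0 T) := by
  obtain ⟨D, hD0, hD⟩ := TorusFluid.exists_norm_le hψ
  exact (hF.mul_bounded (θ := fun p => ψ p.2) (by fun_prop) fun p => hD p.2).integral_prod_left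

lemma integrable_timeIntegral (hF : SpaceTimeIntegrable T F) (hχ : IsTimeTest T χ) :
    Integrable fun x => ∫ t in Ioo 0 T, F t x * χ t := by
  obtain ⟨C, hC0, hC⟩ := hχ.exists_norm_le
  have hχc := hχ.continuous
  exact (hF.mul_bounded (θ := fun p => χ p.1) (by fun_prop) fun p => hC p.1).integral_prod_right

lemma ae_eq_zero_of_timeTest (hT : 0 < T) {f : ℝ → ℝ} (hf : IntegrableOn f (Ioo 0 T))
    (h : ∀ χ, IsTimeTest T χ → ∫ t in Ioo 0 T, f t * χ t = 0) :
    ∀ᵐ t ∂(volume.restrict (Ioo 0 T)), f t = 0 := by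
  obtain ⟨c, hc⟩ := exists_ae_eq_const hT hf fun χ hχ => h _ hχ.deriv
  obtain ⟨η, hη, hη1⟩ := exists_isTimeTest_integral_eq_one hT
  have h1 := h η hη
  have h2 : ∫ t in Ioo 0 T, f t * η t = ∫ t in Ioo 0 T, c * η t :=
    integral_congr_ae (hc.mono fun t ht => by simp [ht])
  rw [h2, integral_const_mul, hη1, mul_one] at h1
  exact hc.mono fun t ht => ht.trans h1

/-- Countably many linear relations between Fourier coefficients that hold in the sense of
distributions in time hold simultaneously at almost every time. -/
lemma ae_forall_tmode {ι : Type*} [Fintype ι] (hT : 0 < T) {F : ι → ℝ → Torus d → ℝ}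
    (hF : ∀ k, SpaceTimeIntegrable T (F k)) (z : ι → (Fin d → ℤ) → ℂ)
    (h : ∀ χ m c, IsTimeTest T χ → ∑ k, sepPair T (F k) χ (tmode m (z k m * c)) = 0) :
    ∀ᵐ t ∂(volume.restrict (Ioo 0 T)), ∀ m c, ∑ k, ∫ x, F k t x * tmode m (z k m * c) x = 0 := by
  have key : ∀ m c, ∀ᵐ t ∂(volume.restrict (Ioo 0 T)),
      ∑ k, ∫ x, F k t x * tmode m (z k m * c) x = 0 := by
    intro m c
    have hi : ∀ k, IntegrableOn (fun t => ∫ x, F k t x * tmode m (z k m * c) x) (Ioo 0 T) :=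
      fun k => integrableOn_integral_mul (hF k) (continuous_tmode _ _)
    refine ae_eq_zero_of_timeTest hT (integrable_finsetSum _ fun k _ => hi k) fun χ hχ => ?_
    refine Eq.trans ?_ (h χ m c hχ)
    simp only [Finset.sum_mul]
    rw [integral_finsetSum _ fun k _ => hχ.integrable_mul (hi k)]
    exact Finset.sum_congr rfl fun k _ =>
      (sepPair_eq_integral_time (hF k) hχ (continuous_tmode _ _)).symm
  -- by real linearity in `c`, the coefficients `1` and `I` suffice, which leaves countably many
  -- conditions
  have h1 := ae_all_iff.2 fun m => key m 1
  have hI := ae_all_iff.2 fun m => key m Complex.I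
  have hint := ae_all_iff.2 fun k => (hF k).ae_integrable
  filter_upwards [h1, hI, hint] with t h1 hI hint m c
  have hdec : ∀ k x, tmode m (z k m * c) x
      = c.re * tmode m (z k m * 1) x + c.im * tmode m (z k m * Complex.I) x := by
    intro k x
    rw [← tmode_real_mul, ← tmode_real_mul, ← tmode_add]
    congr 1
    conv_lhs => rw [← Complex.re_add_im c]
    ring
  have hk : ∀ k, ∫ x, F k t x * tmode m (z k m * c) x
      = c.re * (∫ x, F k t x * tmode m (z k m * 1) x)
        + c.im * ∫ x, F k t x * tmode m (z k m * Complex.I) x := by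
    intro k
    rw [← integral_const_mul, ← integral_const_mul, ← integral_add
      ((integrable_mul_continuous (hint k) (continuous_tmode _ _)).const_mul _)
      ((integrable_mul_continuous (hint k) (continuous_tmode _ _)).const_mul _)]
    exact integral_congr_ae (.of_forall fun x => by
      simp only [hdec k x]; ring)
  simp only [hk]
  rw [Finset.sum_add_distrib, ← Finset.mul_sum, ← Finset.mul_sum, h1 m, hI m]
  simp

end Separated

/-! ### The weak formulations in Fourier modes -/

section Modes

variable {d : ℕ} {T ν : ℝ} {u : ℝ → Torus d → Vec d} {q : ℝ → Torus d → ℝ} {χ : ℝ → ℝ}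

lemma aemeasurable_coord {f : ℝ × Torus d → Vec d} {μ : Measure (ℝ × Torus d)}
    (hf : AEStronglyMeasurable f μ) (i : Fin d) : AEStronglyMeasurable (fun p => f p i) μ :=
  (EuclideanSpace.proj (𝕜 := ℝ) i).continuous.comp_aestronglyMeasurable hf

lemma memLp_coord {f : ℝ × Torus d → Vec d} {μ : Measure (ℝ × Torus d)} {r : ENNReal}
    (hf : MemLp f r μ) (i : Fin d) : MemLp (fun p => f p i) r μ :=
  hf.mono (aemeasurable_coord hf.1 i) (.of_forall fun _ => abs_coord_le _ i)

instance : IsFiniteMeasure (spaceTime d T) := by unfold spaceTime; infer_instance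

lemma integrable_u (hu : MemLp (fun p : ℝ × Torus d => u p.1 p.2) 3 (spaceTime d T)) (i : Fin d) :
    SpaceTimeIntegrable T fun t x => u t x i :=
  (memLp_coord hu i).integrable (by norm_num)

lemma integrable_uu (hu : MemLp (fun p : ℝ × Torus d => u p.1 p.2) 3 (spaceTime d T))
    (i j : Fin d) : SpaceTimeIntegrable T fun t x => u t x i * u t x j := by
  have h2 : ∀ i, MemLp (fun p : ℝ × Torus d => u p.1 p.2 i) 2 (spaceTime d T) := fun i =>
    (memLp_coord hu i).mono_exponent (by norm_num)
  exact (h2 i).integrable_mul (h2 j)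

/-- Incompressibility tested with `χ(t) ψ(x)`. -/
lemma sepPair_incompressible
    (hu : MemLp (fun p : ℝ × Torus d => u p.1 p.2) 3 (spaceTime d T)) (h : IsWeakSolution T ν u)
    (hχ : IsTimeTest T χ) {ψ : Torus d → ℝ} (hψ : SmoothOnTorus ψ) :
    ∑ k, sepPair T (fun t x => u t x k) χ (pd k ψ) = 0 := by
  rw [← h.incompressible _ (hχ.isTest hψ)]
  simp only [sepPair]
  rw [← integral_finsetSum _ fun k _ => (integrable_u hu k).mul_sep hχ (hψ.pd k).continuous]
  refine integral_congr_ae (.of_forall fun p => ?_)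
  simp only [grad, hψ.pd_const_mul, PiLp.inner_apply, RCLike.inner_apply, conj_trivial]
  exact Finset.sum_congr rfl fun k _ => by ring

/-- The Poisson equation of the pressure tested with `χ(t) ψ(x)`. -/
lemma sepPair_poisson
    (hu : MemLp (fun p : ℝ × Torus d => u p.1 p.2) 3 (spaceTime d T)) (hq : IsPressure T u q)
    (hχ : IsTimeTest T χ) {ψ : Torus d → ℝ} (hψ : SmoothOnTorus ψ) :
    sepPair T q χ (lapl ψ) + ∑ i, ∑ j, sepPair T (fun t x => u t x i * u t x j) χ
      (pd i (pd j ψ)) = 0 := by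
  have h := hq.poisson _ (hχ.isTest hψ)
  have hpd : ∀ (c : ℝ) i j, pd i (pd j fun x => c * ψ x) = fun x => c * pd i (pd j ψ) x := by
    intro c i j
    rw [hψ.pd_const_mul, (hψ.pd j).pd_const_mul]
  have e1 : ∑ i, ∑ j, sepPair T (fun t x => u t x i * u t x j) χ (pd i (pd j ψ))
      = ∫ p, (∑ i, ∑ j, u p.1 p.2 i * u p.1 p.2 j * pd i (pd j fun x => χ p.1 * ψ x) p.2)
        ∂(spaceTime d T) := by
    have hi : ∀ i j, Integrable (fun p : ℝ × Torus d => u p.1 p.2 i * u p.1 p.2 j *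
        pd i (pd j fun x => χ p.1 * ψ x) p.2) (spaceTime d T) := fun i j => by
      simp only [hpd]
      exact (integrable_uu hu i j).mul_sep hχ ((hψ.pd j).pd i).continuous
    rw [integral_finsetSum _ fun i _ => integrable_finsetSum _ fun j _ => hi i j]
    refine Finset.sum_congr rfl fun i _ => ?_
    rw [integral_finsetSum _ fun j _ => hi i j]
    simp only [sepPair, hpd]
  have e2 : sepPair T q χ (lapl ψ)
      = ∫ p, q p.1 p.2 * lapl (fun x => χ p.1 * ψ x) p.2 ∂(spaceTime d T) := by
    simp only [sepPair, hψ.lapl_const_mul]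
  rw [e1, e2, ← h]
  ring

/-- The momentum equation tested with `χ(t) ψ(x) a`, where `a · ∇ψ = 0`. -/
lemma sepPair_momentum
    (hu : MemLp (fun p : ℝ × Torus d => u p.1 p.2) 3 (spaceTime d T)) (h : IsWeakSolution T ν u)
    (hχ : IsTimeTest T χ) {ψ : Torus d → ℝ} (hψ : SmoothOnTorus ψ) (a : Vec d)
    (ha : ∀ x, ∑ i, a i * pd i ψ x = 0) :
    ∑ i, a i * (sepPair T (fun t x => u t x i) (deriv χ) ψ
      + (∑ j, sepPair T (fun t x => u t x i * u t x j) χ (pd j ψ))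
      + ν * sepPair T (fun t x => u t x i) χ (lapl ψ)) = 0 := by
  have hpd : ∀ (c : ℝ) (i j : Fin d), pd j (fun x => ((c * ψ x) • a) i)
      = fun x => a i * (c * pd j ψ x) := by
    intro c i j
    have := (((hψ.hasPd j).const_mul c).const_mul (a i)).pd_eq
    rw [← this]
    congr 1
    funext x
    simp [mul_comm]
  have hdiv : ∀ t x, divg (fun x => (χ t * ψ x) • a) x = 0 := by
    intro t x
    simp only [divg, hpd]
    have : ∀ i, a i * (χ t * pd i ψ x) = χ t * (a i * pd i ψ x) := fun i => by ring
    simp only [this, ← Finset.mul_sum, ha, mul_zero]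
  have hm := h.momentum _ (hχ.isTest_smul hψ a) hdiv
  rw [← hm]
  have hdt : ∀ t x, dt (fun t x => (χ t * ψ x) • a) t x = (deriv χ t * ψ x) • a := fun t x =>
    (((hχ.differentiable t).hasDerivAt.mul_const (ψ x)).smul_const a).deriv
  have hlap : ∀ t x, lapl (fun x => (χ t * ψ x) • a) x = (χ t * lapl ψ x) • a := by
    intro t x
    have h1 : ∀ i, pd i (pd i fun x => (χ t * ψ x) • a)
        = fun x => (χ t * pd i (pd i ψ) x) • a := fun i => by
      rw [(((hψ.hasPd i).const_mul (χ t)).smul_const a).pd_eq,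
        ((((hψ.pd i).hasPd i).const_mul (χ t)).smul_const a).pd_eq]
    simp only [lapl, h1, Finset.mul_sum, Finset.sum_smul]
  have i1 : ∀ i, Integrable (fun p : ℝ × Torus d => u p.1 p.2 i * (deriv χ p.1 * ψ p.2))
    (spaceTime d T) := fun i => (integrable_u hu i).mul_sep hχ.deriv hψ.continuous
  have i2 : ∀ i j, Integrable (fun p : ℝ × Torus d => u p.1 p.2 i * u p.1 p.2 j *
    (χ p.1 * pd j ψ p.2)) (spaceTime d T) := fun i j =>
      (integrable_uu hu i j).mul_sep hχ (hψ.pd j).continuous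
  have i3 : ∀ i, Integrable (fun p : ℝ × Torus d => u p.1 p.2 i * (χ p.1 * lapl ψ p.2))
    (spaceTime d T) := fun i => (integrable_u hu i).mul_sep hχ hψ.lapl.continuous
  have i12 : ∀ i, Integrable (fun p : ℝ × Torus d => u p.1 p.2 i * (deriv χ p.1 * ψ p.2)
      + ∑ j, u p.1 p.2 i * u p.1 p.2 j * (χ p.1 * pd j ψ p.2)) (spaceTime d T) := fun i =>
    (i1 i).add (integrable_finsetSum _ fun j _ => i2 i j)
  have i123 : ∀ i, Integrable (fun p : ℝ × Torus d => u p.1 p.2 i * (deriv χ p.1 * ψ p.2)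
      + (∑ j, u p.1 p.2 i * u p.1 p.2 j * (χ p.1 * pd j ψ p.2))
      + ν * (u p.1 p.2 i * (χ p.1 * lapl ψ p.2))) (spaceTime d T) := fun i =>
    (i12 i).add ((i3 i).const_mul ν)
  have e : ∀ i, sepPair T (fun t x => u t x i) (deriv χ) ψ
      + (∑ j, sepPair T (fun t x => u t x i * u t x j) χ (pd j ψ))
      + ν * sepPair T (fun t x => u t x i) χ (lapl ψ)
      = ∫ p, (u p.1 p.2 i * (deriv χ p.1 * ψ p.2)
        + (∑ j, u p.1 p.2 i * u p.1 p.2 j * (χ p.1 * pd j ψ p.2))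
        + ν * (u p.1 p.2 i * (χ p.1 * lapl ψ p.2))) ∂(spaceTime d T) := by
    intro i
    rw [integral_add (i12 i) ((i3 i).const_mul ν),
      integral_add (i1 i) (integrable_finsetSum _ fun j _ => i2 i j),
      integral_finsetSum _ fun j _ => i2 i j, integral_const_mul]
    rfl
  simp only [e]
  simp only [← integral_const_mul]
  rw [← integral_finsetSum _ fun i _ => (i123 i).const_mul (a i)]
  refine integral_congr_ae (.of_forall fun p => ?_)
  have hjac : ∀ t x i j, jac (fun x => (χ t * ψ x) • a) x i j = a i * (χ t * pd j ψ x) :=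
    fun t x i j => by rw [jac, hpd]
  simp only [hdt, hlap, hjac, PiLp.inner_apply, RCLike.inner_apply, conj_trivial,
    PiLp.smul_apply, smul_eq_mul]
  simp only [mul_add, Finset.sum_add_distrib, Finset.mul_sum]
  congr 1
  · congr 1
    · exact Finset.sum_congr rfl fun i _ => by ring
    · exact Finset.sum_congr rfl fun i _ => Finset.sum_congr rfl fun j _ => by ring
  · exact Finset.sum_congr rfl fun i _ => by ring

end Modes

section MomentumPressure

variable {d : ℕ} {T ν : ℝ} {u : ℝ → Torus d → Vec d} {q : ℝ → Torus d → ℝ} {χ : ℝ → ℝ}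

lemma freq_mul (m : Fin d → ℤ) (j : Fin d) (c : ℂ) :
    freq m j * c = ((m j : ℝ) : ℂ) * (2 * Real.pi * Complex.I * c) := by
  rw [freq]; push_cast; ring

lemma sepPair_pd_tmode (F : ℝ → Torus d → ℝ) (m : Fin d → ℤ) (c : ℂ) (j : Fin d) :
    sepPair T F χ (pd j (tmode m c))
      = m j * sepPair T F χ (tmode m (2 * Real.pi * Complex.I * c)) := by
  rw [pd_tmode, freq_mul, sepPair_tmode_real_mul]

lemma sepPair_lapl_tmode (F : ℝ → Torus d → ℝ) (m : Fin d → ℤ) (c : ℂ) :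
    sepPair T F χ (lapl (tmode m c))
      = -(4 * Real.pi ^ 2 * freqSq m) * sepPair T F χ (tmode m c) := by
  rw [← sepPair_const_mul]
  congr 1
  funext x
  exact lapl_tmode m c x

/-- Incompressibility in Fourier modes: `∑ m_k û_k(m) = 0`. -/
lemma sum_sepPair_tmode
    (hu : MemLp (fun p : ℝ × Torus d => u p.1 p.2) 3 (spaceTime d T)) (h : IsWeakSolution T ν u)
    (hχ : IsTimeTest T χ) (m : Fin d → ℤ) (c : ℂ) :
    ∑ k, m k * sepPair T (fun t x => u t x k) χ (tmode m c) = 0 := by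
  have h0 : (2 * Real.pi * Complex.I : ℂ) ≠ 0 := by
    simp [Real.pi_ne_zero, Complex.I_ne_zero]
  have := sepPair_incompressible hu h hχ (tmode_smooth m (c / (2 * Real.pi * Complex.I)))
  simp only [sepPair_pd_tmode, mul_div_cancel₀ _ h0] at this
  exact this

/-- The Poisson equation of the pressure in Fourier modes, in the sense of distributions in time. -/
lemma freqSq_mul_sepPair
    (hu : MemLp (fun p : ℝ × Torus d => u p.1 p.2) 3 (spaceTime d T)) (hq : IsPressure T u q)
    (hχ : IsTimeTest T χ) (m : Fin d → ℤ) (c : ℂ) :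
    freqSq m * sepPair T q χ (tmode m c) + ∑ i, ∑ j, (m i : ℝ) * m j *
      sepPair T (fun t x => u t x i * u t x j) χ (tmode m c) = 0 := by
  have h := sepPair_poisson hu hq hχ (tmode_smooth m c)
  have h1 : ∀ i j, sepPair T (fun t x => u t x i * u t x j) χ (pd i (pd j (tmode m c)))
      = -(4 * Real.pi ^ 2) * ((m i : ℝ) * m j *
        sepPair T (fun t x => u t x i * u t x j) χ (tmode m c)) := by
    intro i j
    rw [← mul_assoc, ← sepPair_const_mul]
    congr 1
    funext x
    rw [pd_pd_tmode]; ring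
  simp only [h1, ← Finset.mul_sum, sepPair_lapl_tmode] at h
  have hπ : (4 * Real.pi ^ 2 : ℝ) ≠ 0 := by positivity
  have h2 : -(4 * Real.pi ^ 2) * (freqSq m * sepPair T q χ (tmode m c) + ∑ i, ∑ j, (m i : ℝ) * m j *
      sepPair T (fun t x => u t x i * u t x j) χ (tmode m c)) = 0 := by
    rw [← h]; ring
  exact (mul_eq_zero.1 h2).resolve_left (neg_ne_zero.2 hπ)

/-- The momentum equation with pressure, in Fourier modes. The momentum equation tested with
divergence-free fields determines the component of each mode orthogonal to the frequency `m`; the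
component along `m` is the Poisson equation of the pressure. -/
lemma sepPair_momentum_pressure
    (hu : MemLp (fun p : ℝ × Torus d => u p.1 p.2) 3 (spaceTime d T)) (hq : IsPressure T u q)
    (h : IsWeakSolution T ν u) (hχ : IsTimeTest T χ) (m : Fin d → ℤ) (c : ℂ) (i : Fin d) :
    sepPair T (fun t x => u t x i) (deriv χ) (tmode m c)
      + (∑ j, sepPair T (fun t x => u t x i * u t x j) χ (pd j (tmode m c)))
      + ν * sepPair T (fun t x => u t x i) χ (lapl (tmode m c))
      + sepPair T q χ (pd i (tmode m c)) = 0 := by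
  set c' : ℂ := 2 * Real.pi * Complex.I * c with hc'
  set V : Fin d → ℝ := fun i => sepPair T (fun t x => u t x i) (deriv χ) (tmode m c)
      + (∑ j, sepPair T (fun t x => u t x i * u t x j) χ (pd j (tmode m c)))
      + ν * sepPair T (fun t x => u t x i) χ (lapl (tmode m c)) with hV
  change V i + sepPair T q χ (pd i (tmode m c)) = 0
  rw [sepPair_pd_tmode, ← hc']
  have hmom : ∀ a : Vec d, ∑ k, a k * (m k : ℝ) = 0 → ∑ k, a k * V k = 0 := by
    intro a ha
    refine sepPair_momentum hu h hχ (tmode_smooth m c) a fun x => ?_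
    simp only [pd_tmode, freq_mul, tmode_real_mul]
    rw [← zero_mul (tmode m (2 * Real.pi * Complex.I * c) x), ← ha, Finset.sum_mul]
    exact Finset.sum_congr rfl fun k _ => by ring
  -- constant fields are divergence-free, so the mode `m = 0` needs no pressure
  by_cases hm : m = 0
  · have h1 := hmom (EuclideanSpace.single i 1) (by simp [hm])
    have h2 : V i = 0 := by simpa [Pi.single_apply] using h1
    rw [h2, hm]; simp
  · have hpos := freqSq_pos hm
    -- the field `|m|² e_i - m_i m` is `|m|²` times the projection of `e_i` orthogonal to `m`
    have h1 := hmom (WithLp.toLp 2 fun k => freqSq m * (if k = i then 1 else 0) - m i * m k) (by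
      simp only [sub_mul, Finset.sum_sub_distrib, mul_assoc, ← Finset.mul_sum]
      simp [freqSq, pow_two]; ring)
    have h2 : freqSq m * V i = m i * ∑ k, m k * V k := by
      simp only [sub_mul, Finset.sum_sub_distrib, mul_assoc, ← Finset.mul_sum] at h1
      simp at h1
      linarith
    have h3 : ∑ k, m k * V k = -(freqSq m * sepPair T q χ (tmode m c')) := by
      have e1 := sum_sepPair_tmode hu h hχ.deriv m c
      have e2 := sum_sepPair_tmode hu h hχ m c
      have e3 := freqSq_mul_sepPair hu hq hχ m c'
      have e4 : ∑ k, m k * V k = ∑ k, m k * sepPair T (fun t x => u t x k) (deriv χ) (tmode m c)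
          + (∑ i, ∑ j, (m i : ℝ) * m j *
            sepPair T (fun t x => u t x i * u t x j) χ (tmode m c'))
          + ν * (-(4 * Real.pi ^ 2 * freqSq m)) *
            ∑ k, m k * sepPair T (fun t x => u t x k) χ (tmode m c) := by
        simp only [hV, sepPair_pd_tmode, sepPair_lapl_tmode, ← hc']
        rw [Finset.mul_sum, ← Finset.sum_add_distrib, ← Finset.sum_add_distrib]
        refine Finset.sum_congr rfl fun k _ => ?_
        simp only [mul_add, Finset.mul_sum]
        congr 1
        · congr 1
          exact Finset.sum_congr rfl fun j _ => by ring
        · ring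
      rw [e4, e1, e2]
      linarith
    rw [h3] at h2
    refine (mul_eq_zero.1
      (?_ : freqSq m * (V i + m i * sepPair T q χ (tmode m c')) = 0)).resolve_left hpos.ne'
    rw [mul_add, h2]; ring

end MomentumPressure

/-! ### Time derivatives of mollified solutions -/

section MollifiedEquation

variable {d : ℕ} {T ν : ℝ} {u : ℝ → Torus d → Vec d} {q : ℝ → Torus d → ℝ} {χ : ℝ → ℝ}
  {F : ℝ → Torus d → ℝ} {K : Torus d → ℝ}

lemma integrable_conv_prod (hF : SpaceTimeIntegrable T F) (hK : Continuous K) (x : Torus d) :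
    Integrable (fun p : ℝ × Torus d => F p.1 p.2 * K (x - p.2)) (spaceTime d T) := by
  obtain ⟨C, -, hC⟩ := exists_norm_le hK
  exact hF.mul_bounded (θ := fun p => K (x - p.2)) (by fun_prop) fun p => hC _

lemma integrableOn_conv (hF : SpaceTimeIntegrable T F) (hK : Continuous K) (x : Torus d) :
    IntegrableOn (fun t => conv K (F t) x) (Ioo 0 T) := by
  have := (integrable_conv_prod hF hK x).integral_prod_left
  simpa only [IntegrableOn, conv, mul_comm (K _)] using this

/-- Convolution in space commutes with integration in time. -/
lemma conv_timeIntegral (hF : SpaceTimeIntegrable T F) (hχ : IsTimeTest T χ) (hK : Continuous K)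
    (x : Torus d) : conv K (fun z => ∫ t in Ioo 0 T, F t z * χ t) x
      = ∫ t in Ioo 0 T, conv K (F t) x * χ t := by
  have h1 := sepPair_eq_integral_space hF hχ (ψ := fun z => K (x - z)) (by fun_prop)
  have h2 := sepPair_eq_integral_time hF hχ (ψ := fun z => K (x - z)) (by fun_prop)
  simp only [conv, mul_comm (K _)]
  rw [← h1, h2]

/-- The right hand side of the equation for `∂_t (K * u_i)`. -/
noncomputable def convRhs (ν : ℝ) (u : ℝ → Torus d → Vec d) (q : ℝ → Torus d → ℝ) (K : Torus d → ℝ)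
    (i : Fin d) (t : ℝ) (x : Torus d) : ℝ :=
  -(∑ j, conv (pd j K) (fun z => u t z i * u t z j) x) - conv (pd i K) (q t) x
    + ν * conv (lapl K) (fun z => u t z i) x

/-- The equation for the convolution of a weak solution with a smooth kernel, at each point. -/
lemma hasWeakDeriv_conv
    (hu : MemLp (fun p : ℝ × Torus d => u p.1 p.2) 3 (spaceTime d T)) (hq : IsPressure T u q)
    (h : IsWeakSolution T ν u) (hK : SmoothOnTorus K) (i : Fin d) (x : Torus d) :
    HasWeakDeriv T (fun t => conv K (fun z => u t z i) x) (fun t => convRhs ν u q K i t x) := by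
  have hqi : SpaceTimeIntegrable T q := hq.integrable
  have j1 : ∀ j, IntegrableOn (fun t => conv (pd j K) (fun z => u t z i * u t z j) x) (Ioo 0 T) :=
    fun j => integrableOn_conv (integrable_uu hu i j) (hK.pd j).continuous x
  have j2 := integrableOn_conv hqi (hK.pd i).continuous x
  have j3 := integrableOn_conv (integrable_u hu i) hK.lapl.continuous x
  have j1' : IntegrableOn (fun t => ∑ j, conv (pd j K) (fun z => u t z i * u t z j) x) (Ioo 0 T) :=
    integrable_finsetSum _ fun j _ => j1 j
  refine ⟨integrableOn_conv (integrable_u hu i) hK.continuous x,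
    (j1'.neg.sub j2).add (j3.const_mul ν), fun χ hχ => ?_⟩
  -- integrating the momentum equation against `χ` in time leaves a stationary equation
  -- `A + div B + Δ C = 0`, which holds on modes, hence after convolution
  have key := conv_eq_zero_of_tmode
    (A := fun x => ∫ t in Ioo 0 T, u t x i * deriv χ t)
    (B := fun j x => -((∫ t in Ioo 0 T, (u t x i * u t x j) * χ t)
      + (if j = i then 1 else 0) * ∫ t in Ioo 0 T, q t x * χ t))
    (C := fun x => ν * ∫ t in Ioo 0 T, u t x i * χ t)
    (integrable_timeIntegral (integrable_u hu i) hχ.deriv)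
    (fun j => ((integrable_timeIntegral (integrable_uu hu i j) hχ).add
      ((integrable_timeIntegral hqi hχ).const_mul _)).neg)
    ((integrable_timeIntegral (integrable_u hu i) hχ).const_mul ν)
    (fun m c => by
      have hs := sepPair_momentum_pressure hu hq h hχ m c i
      have cτ := tmode_smooth m c
      rw [sepPair_eq_integral_space (integrable_u hu i) hχ.deriv cτ.continuous,
        sepPair_eq_integral_space (integrable_u hu i) hχ cτ.lapl.continuous,
        sepPair_eq_integral_space hqi hχ (cτ.pd i).continuous,
        Finset.sum_congr rfl fun j _ => sepPair_eq_integral_space (integrable_uu hu i j) hχ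
          (cτ.pd j).continuous] at hs
      have e : ∀ j, ∫ x, -((∫ t in Ioo 0 T, (u t x i * u t x j) * χ t)
          + (if j = i then 1 else 0) * ∫ t in Ioo 0 T, q t x * χ t) * pd j (tmode m c) x
          = -((∫ x, (∫ t in Ioo 0 T, (u t x i * u t x j) * χ t) * pd j (tmode m c) x)
          + if j = i then ∫ x, (∫ t in Ioo 0 T, q t x * χ t) * pd j (tmode m c) x else 0) := by
        intro j
        have k1 := integrable_mul_continuous (integrable_timeIntegral (integrable_uu hu i j) hχ)
          (cτ.pd j).continuous
        have k2 := integrable_mul_continuous (integrable_timeIntegral hqi hχ) (cτ.pd j).continuous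
        split_ifs
        · rw [← integral_add k1 k2, ← integral_neg]
          exact integral_congr_ae (.of_forall fun x => by ring)
        · rw [add_zero, ← integral_neg]
          exact integral_congr_ae (.of_forall fun x => by ring)
      simp only [e, Finset.sum_neg_distrib, Finset.sum_add_distrib, Finset.sum_ite_eq',
        Finset.mem_univ, if_true, mul_assoc ν]
      rw [integral_const_mul]
      linarith) hK x
  have eB : ∀ j, conv (pd j K) (fun x => -((∫ t in Ioo 0 T, (u t x i * u t x j) * χ t)
      + (if j = i then 1 else 0) * ∫ t in Ioo 0 T, q t x * χ t)) x
      = -((∫ t in Ioo 0 T, conv (pd j K) (fun z => u t z i * u t z j) x * χ t)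
      + if j = i then ∫ t in Ioo 0 T, conv (pd j K) (q t) x * χ t else 0) := by
    intro j
    have cK := (hK.pd j).continuous
    rw [← conv_timeIntegral (integrable_uu hu i j) hχ cK, ← conv_timeIntegral hqi hχ cK]
    have k1 := integrable_conv_integrand cK (integrable_timeIntegral (integrable_uu hu i j) hχ) x
    have k2 := integrable_conv_integrand cK (integrable_timeIntegral hqi hχ) x
    simp only [conv]
    split_ifs
    · rw [← integral_add k1 k2, ← integral_neg]
      exact integral_congr_ae (.of_forall fun x => by ring)
    · rw [add_zero, ← integral_neg]
      exact integral_congr_ae (.of_forall fun x => by ring)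
  have eC : conv (lapl K) (fun x => ν * ∫ t in Ioo 0 T, u t x i * χ t) x
      = ν * ∫ t in Ioo 0 T, conv (lapl K) (fun z => u t z i) x * χ t := by
    rw [← conv_timeIntegral (integrable_u hu i) hχ hK.lapl.continuous, conv, conv,
      ← integral_const_mul]
    exact integral_congr_ae (.of_forall fun x => by ring)
  simp only [eB, eC, conv_timeIntegral (integrable_u hu i) hχ.deriv hK.continuous,
    Finset.sum_neg_distrib, Finset.sum_add_distrib, Finset.sum_ite_eq', Finset.mem_univ,
    if_true] at key
  have eR : ∫ t in Ioo 0 T, convRhs ν u q K i t x * χ t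
      = -(∑ j, ∫ t in Ioo 0 T, conv (pd j K) (fun z => u t z i * u t z j) x * χ t)
        - (∫ t in Ioo 0 T, conv (pd i K) (q t) x * χ t)
        + ν * ∫ t in Ioo 0 T, conv (lapl K) (fun z => u t z i) x * χ t := by
    have l1 : ∀ j, IntegrableOn (fun t => conv (pd j K) (fun z => u t z i * u t z j) x * χ t)
      (Ioo 0 T) := fun j => hχ.integrable_mul (j1 j)
    have l2 := hχ.integrable_mul j2
    have l3 := (hχ.integrable_mul j3).const_mul ν
    have l1' : IntegrableOn (fun t => -∑ j, conv (pd j K) (fun z => u t z i * u t z j) x * χ t)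
      (Ioo 0 T) := (integrable_finsetSum _ fun j _ => l1 j).neg
    have l12 : IntegrableOn (fun t => (-∑ j, conv (pd j K) (fun z => u t z i * u t z j) x * χ t)
      - conv (pd i K) (q t) x * χ t) (Ioo 0 T) := l1'.sub l2
    rw [← integral_const_mul, ← integral_finsetSum _ fun j _ => l1 j, ← integral_neg,
      ← integral_sub l1' l2, ← integral_add l12 l3]
    refine integral_congr_ae (.of_forall fun t => ?_)
    simp only [convRhs, ← Finset.sum_mul]
    ring
  rw [eR]
  linarith

end MollifiedEquation

end TorusFluid

namespace TorusFluid

open scoped ENNReal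

/-! ### Relations at almost every time -/

section Slices

variable {d : ℕ} {T ν : ℝ} {u : ℝ → Torus d → Vec d} {q : ℝ → Torus d → ℝ}

/-- At almost every time the velocity is weakly divergence-free in space. The exceptional set of
times does not depend on the test function, since countably many modes suffice. -/
lemma ae_divergence_free (hT : 0 < T)
    (hu : MemLp (fun p : ℝ × Torus d => u p.1 p.2) 3 (spaceTime d T)) (h : IsWeakSolution T ν u) :
    ∀ᵐ t ∂(volume.restrict (Ioo 0 T)), ∀ ψ : Torus d → ℝ, SmoothOnTorus ψ →
      ∑ k, ∫ x, u t x k * pd k ψ x = 0 := by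
  have h1 := ae_forall_tmode hT (fun k => integrable_u hu k) (fun k m => freq m k)
    (fun χ m c hχ => by
      simp only [← pd_tmode]
      exact sepPair_incompressible hu h hχ (tmode_smooth m c))
  have hint := ae_all_iff.2 fun k => (integrable_u hu k).ae_integrable
  filter_upwards [h1, hint] with t h1 hint ψ hψ
  have := integral_eq_zero_of_tmode (A := fun _ => 0) (B := fun k x => u t x k)
    (integrable_zero _ _ _) hint (fun m c => by simp only [pd_tmode, h1]; simp) hψ
  simpa using this

/-- At almost every time `G` is the weak gradient of `u` in space. -/
lemma ae_weak_grad (hT : 0 < T) {G : ℝ → Torus d → Fin d → Fin d → ℝ} (h : IsL2H1 T u G) :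
    ∀ᵐ t ∂(volume.restrict (Ioo 0 T)), ∀ i j, ∀ ψ : Torus d → ℝ, SmoothOnTorus ψ →
      ∫ x, u t x i * pd j ψ x = -∫ x, G t x i j * ψ x := by
  have hui : ∀ i, SpaceTimeIntegrable T fun t x => u t x i := fun i =>
    (memLp_coord h.memLp i).integrable (by norm_num)
  have hGi : ∀ i j, SpaceTimeIntegrable T fun t x => G t x i j := fun i j =>
    (h.grad_memLp i j).integrable (by norm_num)
  refine ae_all_iff.2 fun i => ae_all_iff.2 fun j => ?_
  have h1 := ae_forall_tmode hT (F := fun (b : Bool) t x => bif b then u t x i else G t x i j)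
    (by rintro (_ | _); exacts [hGi i j, hui i]) (fun b m => bif b then freq m j else 1)
    (fun χ m c hχ => by
      have := h.weak_grad i j _ (hχ.isTest (tmode_smooth m c))
      simp only [(tmode_smooth m c).pd_const_mul] at this
      simp only [Fintype.sum_bool, cond_true, cond_false, one_mul, ← pd_tmode, sepPair, this]
      ring)
  filter_upwards [h1, (hui i).ae_integrable, (hGi i j).ae_integrable] with t h1 i1 i2 ψ hψ
  have := integral_eq_zero_of_tmode (A := fun x => -G t x i j)
    (B := fun k x => (if k = j then 1 else 0) * u t x i)
    i2.neg (fun k => i1.const_mul _) (fun m c => by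
      have h2 := h1 m c
      simp only [Fintype.sum_bool, cond_true, cond_false, one_mul, ← pd_tmode] at h2
      simp only [mul_assoc, integral_const_mul, neg_mul, integral_neg]
      simp
      linarith) hψ
  simp only [mul_assoc, integral_const_mul, neg_mul, integral_neg] at this
  simp at this
  linarith

/-- The Fourier coefficients of the pressure at almost every time. -/
lemma ae_poisson (hT : 0 < T)
    (hu : MemLp (fun p : ℝ × Torus d => u p.1 p.2) 3 (spaceTime d T)) (hq : IsPressure T u q) :
    ∀ᵐ t ∂(volume.restrict (Ioo 0 T)), ∀ m c, freqSq m * ∫ x, q t x * tmode m c x =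
      -∑ i, ∑ j, (m i : ℝ) * m j * ∫ x, u t x i * u t x j * tmode m c x := by
  have h1 := ae_forall_tmode hT
    (F := fun (k : Option (Fin d × Fin d)) t x =>
      k.elim (q t x) fun ij => u t x ij.1 * u t x ij.2)
    (by rintro (_ | ⟨i, j⟩); exacts [hq.integrable, integrable_uu hu i j])
    (fun k m => ((k.elim (freqSq m) fun ij => (m ij.1 : ℝ) * m ij.2 : ℝ) : ℂ))
    (fun χ m c hχ => by
      have := freqSq_mul_sepPair hu hq hχ m c
      simp only [Fintype.sum_option, Option.elim, sepPair_tmode_real_mul, Fintype.sum_prod_type]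
      exact this)
  filter_upwards [h1] with t h1 m c
  have h2 := h1 m c
  simp only [Fintype.sum_option, Option.elim, tmode_real_mul, Fintype.sum_prod_type,
    mul_left_comm _ (_ : ℝ) (tmode _ _ _), integral_const_mul] at h2
  rw [integral_congr_ae (.of_forall fun x => mul_left_comm (q t x) (freqSq m) (tmode m c x)),
    integral_const_mul] at h2
  linarith

end Slices

/-! ### Lebesgue spaces of functions on space-time -/

section Lp

variable {d : ℕ} {T : ℝ} {F H : ℝ → Torus d → ℝ} {r : ℝ≥0∞} {K : Torus d → ℝ}

/-- Membership in `L^r ((0,T) × 𝕋^d)` of a function of `(t, x)`. -/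
abbrev SpaceTimeMemLp (T : ℝ) (r : ℝ≥0∞) (F : ℝ → Torus d → ℝ) : Prop :=
  MemLp (fun p : ℝ × Torus d => F p.1 p.2) r (spaceTime d T)

/-- The `r`-th power of the `L^r` norm on space-time, through the `L^r` norms of the slices. -/
lemma lintegral_slices (hr0 : r ≠ 0) (hr : r ≠ ⊤)
    (hF : AEStronglyMeasurable (fun p : ℝ × Torus d => F p.1 p.2) (spaceTime d T)) :
    ∫⁻ p, ‖F p.1 p.2‖ₑ ^ r.toReal ∂(spaceTime d T)
      = ∫⁻ t in Ioo 0 T, eLpNorm (F t) r volume ^ r.toReal := by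
  rw [spaceTime, lintegral_prod _ (hF.enorm.pow_const _)]
  refine lintegral_congr fun t => ?_
  rw [eLpNorm_eq_lintegral_rpow_enorm_toReal hr0 hr, ← ENNReal.rpow_mul, one_div,
    inv_mul_cancel₀ (ENNReal.toReal_pos hr0 hr).ne', ENNReal.rpow_one]

/-- A function whose slices are bounded in `L^r` by the slices of a function in `L^r` is in
`L^r`. -/
lemma memLp_of_slices (hr0 : r ≠ 0) (hr : r ≠ ⊤)
    (hF : AEStronglyMeasurable (fun p : ℝ × Torus d => F p.1 p.2) (spaceTime d T))
    (hH : SpaceTimeMemLp T r H) {C : ℝ≥0∞} (hC : C ≠ ⊤)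
    (h : ∀ᵐ t ∂(volume.restrict (Ioo 0 T)),
      eLpNorm (F t) r volume ≤ C * eLpNorm (H t) r volume) : SpaceTimeMemLp T r F := by
  refine ⟨hF, (eLpNorm_lt_top_iff_lintegral_rpow_enorm_lt_top hr0 hr).2 ?_⟩
  have hH' := (eLpNorm_lt_top_iff_lintegral_rpow_enorm_lt_top hr0 hr).1 hH.2
  rw [lintegral_slices hr0 hr hH.1] at hH'
  rw [lintegral_slices hr0 hr hF]
  calc _ ≤ ∫⁻ t in Ioo 0 T, C ^ r.toReal * eLpNorm (H t) r volume ^ r.toReal := by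
        refine lintegral_mono_ae (h.mono fun t ht => ?_)
        rw [← ENNReal.mul_rpow_of_nonneg _ _ ENNReal.toReal_nonneg]
        exact ENNReal.rpow_le_rpow ht ENNReal.toReal_nonneg
    _ = C ^ r.toReal * ∫⁻ t in Ioo 0 T, eLpNorm (H t) r volume ^ r.toReal :=
        lintegral_const_mul' _ _ (ENNReal.rpow_ne_top_of_nonneg ENNReal.toReal_nonneg hC)
    _ < ⊤ := ENNReal.mul_lt_top
        (ENNReal.rpow_lt_top_of_nonneg ENNReal.toReal_nonneg hC) hH'

lemma ae_memLp_slice (hr0 : r ≠ 0) (hr : r ≠ ⊤) (hF : SpaceTimeMemLp T r F) :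
    ∀ᵐ t ∂(volume.restrict (Ioo 0 T)), MemLp (F t) r volume := by
  have h1 := (eLpNorm_lt_top_iff_lintegral_rpow_enorm_lt_top hr0 hr).1 hF.2
  rw [spaceTime, lintegral_prod _ (hF.1.enorm.pow_const _)] at h1
  have h2 := ae_lt_top' (AEMeasurable.lintegral_prod_right' (hF.1.enorm.pow_const _)) h1.ne
  filter_upwards [h2, AEStronglyMeasurable.prodMk_left hF.1] with t ht hm
  exact ⟨hm, (eLpNorm_lt_top_iff_lintegral_rpow_enorm_lt_top hr0 hr).2 ht⟩

/-- The pressure of a velocity in `L^3` is in `L^{3/2}`. -/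
lemma IsPressure.memLp (hT : 0 < T) {u : ℝ → Torus d → Vec d} {q : ℝ → Torus d → ℝ}
    (hu : MemLp (fun p : ℝ × Torus d => u p.1 p.2) 3 (spaceTime d T)) (hq : IsPressure T u q) :
    SpaceTimeMemLp T (3 / 2) q := by
  have h32 : (3 / 2 : ℝ≥0∞) ≠ 0 := by norm_num
  have h32' : (3 / 2 : ℝ≥0∞) ≠ ⊤ := ENNReal.div_ne_top (by norm_num) (by norm_num)
  have hH : SpaceTimeMemLp T (3 / 2) fun t x => ‖u t x‖ ^ 2 := by
    have := hu.norm_rpow_div 2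
    refine (this.congr_norm ?_ ?_)
    · exact (hu.1.norm.pow 2)
    · exact .of_forall fun p => by simp
  have hUm : ∀ i j, AEStronglyMeasurable (fun p : ℝ × Torus d => u p.1 p.2 i * u p.1 p.2 j)
    (spaceTime d T) := fun i j => (integrable_uu hu i j).1
  have hUb : ∀ t x i j, ‖u t x i * u t x j‖ ≤ ‖‖u t x‖ ^ 2‖ := fun t x i j => by
    rw [norm_mul, norm_pow, norm_norm, pow_two]
    exact mul_le_mul (abs_coord_le _ _) (abs_coord_le _ _) (norm_nonneg _) (norm_nonneg _)
  have hU : ∀ i j, SpaceTimeMemLp T (3 / 2) fun t x => u t x i * u t x j := fun i j =>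
    hH.mono (hUm i j) (.of_forall fun p => hUb _ _ i j)
  have hsl := ae_all_iff.2 fun i => ae_all_iff.2 fun j => ae_memLp_slice h32 h32' (hU i j)
  refine memLp_of_slices h32 h32' hq.integrable.1 hH (C := d * d * 30) (by finiteness) ?_
  filter_upwards [ae_poisson hT hu hq, hsl, hq.zero_mean,
    SpaceTimeIntegrable.ae_integrable hq.integrable] with t h1 h2 h3 h4
  exact eLpNorm_pressure_le h4 h3 h2 (fun i j x => hUb t x i j) h1

/-- Joint measurability. The convolution of a measurable representative is jointly measurable, and
agrees with the given one at every `x` for almost every time. -/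
lemma aestronglyMeasurable_conv (hK : Continuous K)
    (hF : AEStronglyMeasurable (fun p : ℝ × Torus d => F p.1 p.2) (spaceTime d T)) :
    AEStronglyMeasurable (fun p : ℝ × Torus d => conv K (F p.1) p.2) (spaceTime d T) := by
  refine ⟨fun p => conv K (fun z => hF.mk _ (p.1, z)) p.2, ?_, ?_⟩
  · have h : StronglyMeasurable fun w : (ℝ × Torus d) × Torus d =>
        K (w.1.2 - w.2) * hF.mk _ (w.1.1, w.2) := by
      have h1 : StronglyMeasurable fun w : (ℝ × Torus d) × Torus d => K (w.1.2 - w.2) :=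
        Continuous.stronglyMeasurable (by fun_prop)
      exact h1.mul (hF.stronglyMeasurable_mk.comp_measurable (by fun_prop))
    exact h.integral_prod_right'
  · have h1 := Measure.ae_ae_of_ae_prod hF.ae_eq_mk
    have h2 := (Measure.quasiMeasurePreserving_fst (μ := volume.restrict (Ioo 0 T))
      (ν := (volume : Measure (Torus d)))).ae h1
    filter_upwards [h2] with p hp
    exact integral_congr_ae (hp.mono fun z hz => by simp only [hz])

end Lp

/-! ### Functions that are continuous in space, uniformly controlled in time -/

section Controlled

variable {d : ℕ} {T : ℝ} {F η θ : ℝ → Torus d → ℝ} {r s : ℝ≥0∞} {K : Torus d → ℝ}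

/-- The function `η` belongs to `L^r (0,T; C(𝕋^d))`. The bound `M` of `|η(t, ·)|` is read as a
function on space-time. -/
structure MemLpC (T : ℝ) (r : ℝ≥0∞) (η : ℝ → Torus d → ℝ) : Prop where
  meas : AEStronglyMeasurable (fun p : ℝ × Torus d => η p.1 p.2) (spaceTime d T)
  cont : ∀ᵐ t ∂(volume.restrict (Ioo 0 T)), Continuous (η t)
  bound : ∃ M : ℝ → ℝ, SpaceTimeMemLp (d := d) T r (fun t _ => M t) ∧
    ∀ᵐ t ∂(volume.restrict (Ioo 0 T)), ∀ x, ‖η t x‖ ≤ M t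

lemma ae_spaceTime_of_ae {P : ℝ → Prop} (h : ∀ᵐ t ∂(volume.restrict (Ioo 0 T)), P t) :
    ∀ᵐ p ∂(spaceTime d T), P p.1 :=
  Measure.quasiMeasurePreserving_fst.ae h

namespace MemLpC

lemma memLp (h : MemLpC T r η) : SpaceTimeMemLp T r η := by
  obtain ⟨M, hM, hb⟩ := h.bound
  exact hM.mono h.meas ((ae_spaceTime_of_ae hb).mono fun p hp =>
    (hp p.2).trans (le_abs_self _))

lemma congr (h : MemLpC T r η) (he : ∀ᵐ t ∂(volume.restrict (Ioo 0 T)), η t = θ t) :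
    MemLpC T r θ := by
  obtain ⟨M, hM, hb⟩ := h.bound
  refine ⟨h.meas.congr ((ae_spaceTime_of_ae he).mono fun p hp => congrFun hp p.2), ?_, M, hM, ?_⟩
  · filter_upwards [h.cont, he] with t h1 h2 using h2 ▸ h1
  · filter_upwards [hb, he] with t h1 h2 using h2 ▸ h1

lemma add (h : MemLpC T r η) (h' : MemLpC T r θ) : MemLpC T r fun t x => η t x + θ t x := by
  obtain ⟨M, hM, hb⟩ := h.bound
  obtain ⟨M', hM', hb'⟩ := h'.bound
  refine ⟨h.meas.add h'.meas, ?_, fun t => M t + M' t, hM.add hM', ?_⟩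
  · filter_upwards [h.cont, h'.cont] with t h1 h2 using h1.add h2
  · filter_upwards [hb, hb'] with t h1 h2 x using (norm_add_le _ _).trans (add_le_add (h1 x) (h2 x))

lemma zero : MemLpC T r fun (_ : ℝ) (_ : Torus d) => (0 : ℝ) :=
  ⟨aestronglyMeasurable_const, .of_forall fun _ => continuous_const, fun _ => 0,
    MemLp.zero' , .of_forall fun _ _ => by simp⟩

lemma sum {ι : Type*} (S : Finset ι) {f : ι → ℝ → Torus d → ℝ} (h : ∀ k ∈ S, MemLpC T r (f k)) :
    MemLpC T r fun t x => ∑ k ∈ S, f k t x := by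
  classical
  induction S using Finset.induction_on with
  | empty => simpa using zero
  | insert k S hk ih =>
    simp_rw [Finset.sum_insert hk]
    exact (h k (Finset.mem_insert_self _ _)).add
      (ih fun j hj => h j (Finset.mem_insert_of_mem hj))

lemma mul {r' r'' : ℝ≥0∞} [ENNReal.HolderTriple r r' r''] (h : MemLpC T r η)
    (h' : MemLpC T r' θ) : MemLpC T r'' fun t x => η t x * θ t x := by
  obtain ⟨M, hM, hb⟩ := h.bound
  obtain ⟨M', hM', hb'⟩ := h'.bound
  refine ⟨h.meas.mul h'.meas, ?_, fun t => M t * M' t, hM'.mul hM, ?_⟩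
  · filter_upwards [h.cont, h'.cont] with t h1 h2 using h1.mul h2
  · filter_upwards [hb, hb'] with t h1 h2 x
    rw [norm_mul]
    exact mul_le_mul (h1 x) (h2 x) (norm_nonneg _) ((norm_nonneg _).trans (h1 x))

lemma of_isTest (h : IsTest T η) : MemLpC T ⊤ η := by
  obtain ⟨C, -, hC⟩ := h.exists_norm_le
  exact ⟨h.continuous.aestronglyMeasurable, .of_forall fun t => (h.smoothOnTorus t).continuous,
    fun _ => C, memLp_const _, .of_forall hC⟩

lemma const (c : ℝ) : MemLpC T ⊤ fun (_ : ℝ) (_ : Torus d) => c :=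
  ⟨aestronglyMeasurable_const, .of_forall fun _ => continuous_const, fun _ => ‖c‖,
    memLp_const _, .of_forall fun _ _ => le_rfl⟩

lemma const_mul (c : ℝ) (h : MemLpC T r η) : MemLpC T r fun t x => c * η t x :=
  (const c).mul h

lemma neg (h : MemLpC T r η) : MemLpC T r fun t x => -η t x := by
  simpa using h.const_mul (-1)

lemma sub (h : MemLpC T r η) (h' : MemLpC T r θ) : MemLpC T r fun t x => η t x - θ t x := by
  simpa [sub_eq_add_neg] using h.add h'.neg

lemma mono_exponent (h : MemLpC T r η) (hs : s ≤ r) : MemLpC T s η := by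
  obtain ⟨M, hM, hb⟩ := h.bound
  exact ⟨h.meas, h.cont, M, hM.mono_exponent hs, hb⟩

/-- Convolution in space maps `L^r` to `L^r (0,T; C(𝕋^d))`. -/
lemma of_conv (hr1 : 1 ≤ r) (hr : r ≠ ⊤) (hF : SpaceTimeMemLp T r F) (hK : Continuous K) :
    MemLpC T r fun t => conv K (F t) := by
  obtain ⟨C, hC0, hC⟩ := exists_norm_le hK
  have hint := SpaceTimeIntegrable.ae_integrable (hF.integrable hr1)
  refine ⟨aestronglyMeasurable_conv hK hF.1, hint.mono fun t ht => continuous_conv hK ht,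
    fun t => C * ∫ z, ‖F t z‖, ?_, hint.mono fun t ht x => abs_conv_le hK hC ht x⟩
  have hm := (aestronglyMeasurable_conv (K := fun _ => 1) (F := fun t x => ‖F t x‖)
    continuous_const hF.1.norm)
  simp only [conv, one_mul] at hm
  refine MemLp.const_mul (f := fun p : ℝ × Torus d => ∫ z, ‖F p.1 z‖) ?_ C
  refine memLp_of_slices (F := fun t _ => ∫ z, ‖F t z‖) (zero_lt_one.trans_le hr1).ne' hr hm hF
    (C := 1) (by simp) ?_
  filter_upwards [hint] with t ht
  rw [one_mul]
  calc eLpNorm (fun _ : Torus d => ∫ z, ‖F t z‖) r volume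
      = ‖∫ z, ‖F t z‖‖ₑ := by
        rw [eLpNorm_const _ (zero_lt_one.trans_le hr1).ne' (NeZero.ne _)]; simp
    _ = eLpNorm (F t) 1 volume := by
        rw [eLpNorm_one_eq_lintegral_enorm, ← ofReal_integral_norm_eq_lintegral_enorm ht,
          Real.enorm_of_nonneg (integral_nonneg fun _ => norm_nonneg _)]
    _ ≤ _ := eLpNorm_le_eLpNorm_of_exponent_le hr1 ht.1

end MemLpC

end Controlled

/-! ### Integration by parts in space-time -/

instance holderTriple_three_three : ENNReal.HolderTriple 3 3 (3 / 2) := ⟨by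
  rw [ENNReal.inv_div (by simp) (by simp), ← two_mul, div_eq_mul_inv]⟩

instance holderTriple_threeHalves_three : ENNReal.HolderTriple (3 / 2) 3 1 := ⟨by
  rw [ENNReal.inv_div (by simp) (by simp), div_eq_mul_inv, inv_one]
  nth_rewrite 2 [← one_mul (3⁻¹ : ℝ≥0∞)]
  rw [← add_mul, show (2 + 1 : ℝ≥0∞) = 3 by norm_num]
  exact ENNReal.mul_inv_cancel (by simp) (by simp)⟩

instance holderTriple_three_threeHalves : ENNReal.HolderTriple 3 (3 / 2) 1 :=
  ENNReal.HolderTriple.symm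

instance holderTriple_top_left (r : ℝ≥0∞) : ENNReal.HolderTriple ⊤ r r := ⟨by simp⟩

instance holderTriple_top_right (r : ℝ≥0∞) : ENNReal.HolderTriple r ⊤ r := ⟨by simp⟩

lemma one_le_threeHalves : (1 : ℝ≥0∞) ≤ 3 / 2 := by
  rw [ENNReal.le_div_iff_mul_le (by simp) (by simp)]; norm_num

lemma threeHalves_ne_top : (3 / 2 : ℝ≥0∞) ≠ ⊤ := ENNReal.div_ne_top (by simp) (by simp)

lemma threeHalves_le_three : (3 / 2 : ℝ≥0∞) ≤ 3 :=
  ENNReal.div_le_of_le_mul (by norm_num)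

section Adjoint

variable {d : ℕ} {T : ℝ} {F η θ : ℝ → Torus d → ℝ} {r s : ℝ≥0∞} {K : Torus d → ℝ} {ρ : Vec d → ℝ}

lemma MemLpC.integrable_mul [ENNReal.HolderTriple r s 1] (hF : SpaceTimeMemLp T r F)
    (hη : MemLpC T s η) : SpaceTimeIntegrable T fun t x => F t x * η t x :=
  memLp_one_iff_integrable.1 (hη.memLp.mul hF)

/-- Identities between space integrals at almost every time integrate to identities on
space-time. -/
lemma integral_spaceTime_congr {F H : ℝ → Torus d → ℝ} (hF : SpaceTimeIntegrable T F)
    (hH : SpaceTimeIntegrable T H)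
    (h : ∀ᵐ t ∂(volume.restrict (Ioo 0 T)), ∫ x, F t x = ∫ x, H t x) :
    ∫ p, F p.1 p.2 ∂(spaceTime d T) = ∫ p, H p.1 p.2 ∂(spaceTime d T) := by
  rw [spaceTime, integral_prod _ hF, integral_prod _ hH]
  exact integral_congr_ae h

/-- The adjoint of convolution with `K` is convolution with the reflected kernel. -/
lemma integral_conv_mul_spaceTime [ENNReal.HolderTriple r s 1] (hr1 : 1 ≤ r) (hr : r ≠ ⊤)
    (hs1 : 1 ≤ s) (hs : s ≠ ⊤) (hK : Continuous K) (hF : SpaceTimeMemLp T r F)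
    (hη : MemLpC T s η) :
    ∫ p, conv K (F p.1) p.2 * η p.1 p.2 ∂(spaceTime d T)
      = ∫ p, F p.1 p.2 * conv (fun w => K (-w)) (η p.1) p.2 ∂(spaceTime d T) := by
  refine integral_spaceTime_congr (F := fun t x => conv K (F t) x * η t x)
    (H := fun t x => F t x * conv (fun w => K (-w)) (η t) x)
    (hη.integrable_mul (MemLpC.of_conv hr1 hr hF hK).memLp)
    ((MemLpC.of_conv hs1 hs hη.memLp (K := fun w => K (-w)) (by fun_prop)).integrable_mul hF) ?_
  filter_upwards [SpaceTimeIntegrable.ae_integrable (hF.integrable hr1), hη.cont] with t h1 h2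
  exact integral_conv_mul hK h1 (integrable_of_continuous h2)

/-- Mollifications of `F` converge to `F` weakly. The mollification is moved to the other factor,
where it converges pointwise. -/
lemma tendsto_integral_conv_mul (hρ : IsMollifier ρ) [ENNReal.HolderTriple r s 1] (hr1 : 1 ≤ r)
    (hr : r ≠ ⊤) (hs1 : 1 ≤ s) (hs : s ≠ ⊤) (hF : SpaceTimeMemLp T r F) (hη : MemLpC T s η) :
    Filter.Tendsto (fun n : ℕ => ∫ p, conv (mollKernel ρ (1 / (n + 1))) (F p.1) p.2 * η p.1 p.2
      ∂(spaceTime d T)) Filter.atTop (nhds (∫ p, F p.1 p.2 * η p.1 p.2 ∂(spaceTime d T))) := by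
  have hℓ : ∀ n : ℕ, 0 < 1 / ((n : ℝ) + 1) := fun n => by positivity
  have hK : ∀ n : ℕ, Continuous (mollKernel ρ (1 / ((n : ℝ) + 1))) := fun n =>
    (hρ.smooth_mollKernel (hℓ n)).continuous
  have hK' : ∀ n : ℕ, Continuous fun w => mollKernel ρ (1 / ((n : ℝ) + 1)) (-w) := fun n =>
    (hK n).comp continuous_neg
  simp only [fun n => integral_conv_mul_spaceTime hr1 hr hs1 hs (hK n) hF hη]
  obtain ⟨M, hM, hb⟩ := hη.bound
  refine tendsto_integral_of_dominated_convergence (fun p => ‖F p.1 p.2‖ * M p.1)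
    (fun n => ((MemLpC.of_conv hs1 hs hη.memLp (hK' n)).integrable_mul hF).1)
    (memLp_one_iff_integrable.1 (hM.mul hF.norm)) (fun n => ?_) ?_
  · filter_upwards [ae_spaceTime_of_ae hη.cont, ae_spaceTime_of_ae hb] with p h1 h2
    rw [norm_mul]
    exact mul_le_mul_of_nonneg_left (abs_conv_neg_mollKernel_le hρ (hℓ n) h1 h2 _) (norm_nonneg _)
  · filter_upwards [ae_spaceTime_of_ae hη.cont] with p h1
    exact (tendsto_conv_neg_mollKernel hρ h1 p.2).const_mul _

/-- Integration by parts with the derivative falling on the kernel. -/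
lemma integral_conv_pd_mul [ENNReal.HolderTriple r s 1] (hr1 : 1 ≤ r) (hr : r ≠ ⊤)
    (hK : SmoothOnTorus K) (hF : SpaceTimeMemLp T r F) (hθ : MemLpC T s θ)
    (hθs : ∀ᵐ t ∂(volume.restrict (Ioo 0 T)), SmoothOnTorus (θ t)) (j : Fin d)
    (hθj : MemLpC T s fun t => pd j (θ t)) :
    ∫ p, conv (pd j K) (F p.1) p.2 * θ p.1 p.2 ∂(spaceTime d T)
      = -∫ p, conv K (F p.1) p.2 * pd j (θ p.1) p.2 ∂(spaceTime d T) := by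
  rw [← integral_neg]
  refine integral_spaceTime_congr (F := fun t x => conv (pd j K) (F t) x * θ t x)
    (H := fun t x => -(conv K (F t) x * pd j (θ t) x))
    (hθ.integrable_mul (MemLpC.of_conv hr1 hr hF (hK.pd j).continuous).memLp)
    (hθj.integrable_mul (MemLpC.of_conv hr1 hr hF hK.continuous).memLp).neg ?_
  filter_upwards [SpaceTimeIntegrable.ae_integrable (hF.integrable hr1), hθs] with t h1 h2
  rw [integral_neg, ← pd_conv hK h1]
  have h3 := hK.conv h1
  exact (h3.hasPd j).integral_mul_eq (h2.hasPd j) h3.continuous (h3.pd j).continuous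
    h2.continuous (h2.pd j).continuous

lemma lapl_conv {f : Torus d → ℝ} (hK : SmoothOnTorus K) (hf : Integrable f) :
    lapl (conv K f) = conv (lapl K) f := by
  funext x
  have : ∀ i, pd i (pd i (conv K f)) = conv (pd i (pd i K)) f := fun i => by
    rw [pd_conv hK hf, pd_conv (hK.pd i) hf]
  simp only [lapl, this]
  exact (conv_sum_left _ (fun i _ => ((hK.pd i).pd i).continuous) hf x).symm

lemma integral_conv_lapl_mul [ENNReal.HolderTriple r s 1] (hr1 : 1 ≤ r) (hr : r ≠ ⊤)
    (hK : SmoothOnTorus K) (hF : SpaceTimeMemLp T r F) (hθ : MemLpC T s θ)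
    (hθs : ∀ᵐ t ∂(volume.restrict (Ioo 0 T)), SmoothOnTorus (θ t))
    (hθl : MemLpC T s fun t => lapl (θ t)) :
    ∫ p, conv (lapl K) (F p.1) p.2 * θ p.1 p.2 ∂(spaceTime d T)
      = ∫ p, conv K (F p.1) p.2 * lapl (θ p.1) p.2 ∂(spaceTime d T) := by
  refine integral_spaceTime_congr (F := fun t x => conv (lapl K) (F t) x * θ t x)
    (H := fun t x => conv K (F t) x * lapl (θ t) x)
    (hθ.integrable_mul (MemLpC.of_conv hr1 hr hF hK.lapl.continuous).memLp)
    (hθl.integrable_mul (MemLpC.of_conv hr1 hr hF hK.continuous).memLp) ?_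
  filter_upwards [SpaceTimeIntegrable.ae_integrable (hF.integrable hr1), hθs] with t h1 h2
  rw [← lapl_conv hK h1]
  exact integral_lapl_mul (hK.conv h1) h2

variable {φ : ℝ → Torus d → ℝ}

lemma IsTest.lapl {T : ℝ} (hT : 0 < T) (hφ : IsTest T φ) : IsTest T fun t => lapl (φ t) :=
  IsTest.sum _ (fun i _ => (hφ.pd i).pd i) hT

lemma memLpC_test_mul_conv (hr1 : 1 ≤ r) (hr : r ≠ ⊤) (hφ : IsTest T φ)
    (hF : SpaceTimeMemLp T r F) (hK : Continuous K) :
    MemLpC T r fun t x => φ t x * conv K (F t) x :=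
  (MemLpC.of_isTest hφ).mul (MemLpC.of_conv hr1 hr hF hK)

lemma ae_smooth_conv (hr1 : 1 ≤ r) (hF : SpaceTimeMemLp T r F) (hK : SmoothOnTorus K) :
    ∀ᵐ t ∂(volume.restrict (Ioo 0 T)), SmoothOnTorus (conv K (F t)) :=
  (SpaceTimeIntegrable.ae_integrable (hF.integrable hr1)).mono fun _ ht => hK.conv ht

lemma ae_pd_test_mul_conv (hr1 : 1 ≤ r) (hφ : IsTest T φ) (hF : SpaceTimeMemLp T r F)
    (hK : SmoothOnTorus K) (j : Fin d) : ∀ᵐ t ∂(volume.restrict (Ioo 0 T)),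
      pd j (fun x => φ t x * conv K (F t) x)
        = fun x => pd j (φ t) x * conv K (F t) x + φ t x * conv (pd j K) (F t) x := by
  filter_upwards [SpaceTimeIntegrable.ae_integrable (hF.integrable hr1)] with t ht
  rw [((hφ.smoothOnTorus t |>.hasPd j).mul ((hK.conv ht).hasPd j)).pd_eq, pd_conv hK ht]

lemma memLpC_pd_test_mul_conv (hr1 : 1 ≤ r) (hr : r ≠ ⊤) (hφ : IsTest T φ)
    (hF : SpaceTimeMemLp T r F) (hK : SmoothOnTorus K) (j : Fin d) :
    MemLpC T r fun t => pd j fun x => φ t x * conv K (F t) x :=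
  ((memLpC_test_mul_conv hr1 hr (hφ.pd j) hF hK.continuous).add
    (memLpC_test_mul_conv hr1 hr hφ hF (hK.pd j).continuous)).congr
    ((ae_pd_test_mul_conv hr1 hφ hF hK j).mono fun _ h => h.symm)

lemma memLpC_lapl_test_mul_conv (hr1 : 1 ≤ r) (hr : r ≠ ⊤) (hφ : IsTest T φ)
    (hF : SpaceTimeMemLp T r F) (hK : SmoothOnTorus K) :
    MemLpC T r fun t => lapl fun x => φ t x * conv K (F t) x := by
  refine MemLpC.sum _ fun j _ => ?_
  refine ((memLpC_pd_test_mul_conv hr1 hr (hφ.pd j) hF hK j).add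
    (memLpC_pd_test_mul_conv hr1 hr hφ hF (hK.pd j) j)).congr ?_
  filter_upwards [ae_pd_test_mul_conv hr1 hφ hF hK j,
    SpaceTimeIntegrable.ae_integrable (hF.integrable hr1)] with t h1 h2
  rw [h1]
  have s1 := ((hφ.pd j).smoothOnTorus t).mul (hK.conv h2)
  have s2 := (hφ.smoothOnTorus t).mul ((hK.pd j).conv h2)
  exact ((s1.hasPd j).add (s2.hasPd j)).pd_eq.symm

end Adjoint

/-! ### Evolution of the mollified energy and of the correlation -/

section Energy

variable {d : ℕ} {T ν : ℝ} {u : ℝ → Torus d → Vec d} {q : ℝ → Torus d → ℝ}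
  {K K' : Torus d → ℝ} {φ : ℝ → Torus d → ℝ} {ρ : Vec d → ℝ}

lemma memLp_uu (hu : MemLp (fun p : ℝ × Torus d => u p.1 p.2) 3 (spaceTime d T)) (i j : Fin d) :
    SpaceTimeMemLp T (3 / 2) fun t x => u t x i * u t x j :=
  (memLp_coord hu j).mul (memLp_coord hu i)

lemma memLpC_conv_u (hu : MemLp (fun p : ℝ × Torus d => u p.1 p.2) 3 (spaceTime d T))
    (hK : Continuous K) (i : Fin d) : MemLpC T 3 fun t => conv K (fun z => u t z i) :=
  MemLpC.of_conv (F := fun t z => u t z i) (by norm_num) (by simp) (memLp_coord hu i) hK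

lemma memLpC_convRhs (hT : 0 < T)
    (hu : MemLp (fun p : ℝ × Torus d => u p.1 p.2) 3 (spaceTime d T)) (hq : IsPressure T u q)
    (hK : SmoothOnTorus K) (i : Fin d) : MemLpC T (3 / 2) (convRhs ν u q K i) := by
  have h1 := one_le_threeHalves
  have h2 := threeHalves_ne_top
  exact ((MemLpC.sum _ fun j _ => MemLpC.of_conv (F := fun t z => u t z i * u t z j) h1 h2
    (memLp_uu hu i j) (hK.pd j).continuous).neg.sub
    (MemLpC.of_conv h1 h2 (hq.memLp hT hu) (hK.pd i).continuous)).add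
    (((memLpC_conv_u hu hK.lapl.continuous i).mono_exponent threeHalves_le_three).const_mul ν)

lemma IsTest.isTimeTest (hφ : IsTest T φ) (x : Torus d) : IsTimeTest T fun t => φ t x := by
  obtain ⟨a, b, ha, hb, hab⟩ := hφ.support
  obtain ⟨y, rfl⟩ := proj_surjective x
  exact ⟨hφ.smooth.comp (by fun_prop : ContDiff ℝ ∞ fun t : ℝ => (t, y)), a, b, ha, hb,
    fun t ht => hab t _ ht⟩

/-- The product rule in time for two convolutions of a weak solution with smooth kernels. -/
lemma integral_conv_mul_conv_mul_dt (hT : 0 < T)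
    (hu : MemLp (fun p : ℝ × Torus d => u p.1 p.2) 3 (spaceTime d T)) (hq : IsPressure T u q)
    (h : IsWeakSolution T ν u) (hK : SmoothOnTorus K) (hK' : SmoothOnTorus K') (hφ : IsTest T φ)
    (i : Fin d) :
    ∫ p, conv K (fun z => u p.1 z i) p.2 * conv K' (fun z => u p.1 z i) p.2 * dt φ p.1 p.2
      ∂(spaceTime d T)
      = -∫ p, (convRhs ν u q K i p.1 p.2 * conv K' (fun z => u p.1 z i) p.2
        + conv K (fun z => u p.1 z i) p.2 * convRhs ν u q K' i p.1 p.2) * φ p.1 p.2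
      ∂(spaceTime d T) := by
  have v := memLpC_conv_u hu hK.continuous i
  have v' := memLpC_conv_u hu hK'.continuous i
  have g := memLpC_convRhs (ν := ν) hT hu hq hK i
  have g' := memLpC_convRhs (ν := ν) hT hu hq hK' i
  have i1 : SpaceTimeIntegrable T fun t x =>
      conv K (fun z => u t z i) x * conv K' (fun z => u t z i) x * dt φ t x :=
    ((v.mul v' (r'' := 3 / 2)).mul (MemLpC.of_isTest hφ.dt)).memLp.integrable one_le_threeHalves
  have i2 : SpaceTimeIntegrable T fun t x =>
      (convRhs ν u q K i t x * conv K' (fun z => u t z i) x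
        + conv K (fun z => u t z i) x * convRhs ν u q K' i t x) * φ t x :=
    (((g.mul v' (r'' := 1)).add (v.mul g' (r'' := 1))).mul
      (MemLpC.of_isTest hφ)).memLp.integrable le_rfl
  rw [spaceTime, integral_prod_symm _ i1, integral_prod_symm _ i2, ← integral_neg]
  refine integral_congr_ae (.of_forall fun x => ?_)
  exact (hasWeakDeriv_conv hu hq h hK i x).integral_mul hT (hasWeakDeriv_conv hu hq h hK' i x)
    (hφ.isTimeTest x)

/-- The evolution of the correlation `u_i (K * u)_i`. -/
lemma integral_u_mul_conv_mul_dt (hT : 0 < T) (hρ : IsMollifier ρ)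
    (hu : MemLp (fun p : ℝ × Torus d => u p.1 p.2) 3 (spaceTime d T)) (hq : IsPressure T u q)
    (h : IsWeakSolution T ν u) (hK : SmoothOnTorus K) (hφ : IsTest T φ) (i : Fin d) :
    ∫ p, u p.1 p.2 i * (dt φ p.1 p.2 * conv K (fun z => u p.1 z i) p.2) ∂(spaceTime d T)
      = -((∑ j, ∫ p, u p.1 p.2 i * u p.1 p.2 j *
            pd j (fun x => φ p.1 x * conv K (fun z => u p.1 z i) x) p.2 ∂(spaceTime d T))
          + (∫ p, q p.1 p.2 * pd i (fun x => φ p.1 x * conv K (fun z => u p.1 z i) x) p.2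
            ∂(spaceTime d T))
          + ν * ∫ p, u p.1 p.2 i * lapl (fun x => φ p.1 x * conv K (fun z => u p.1 z i) x) p.2
            ∂(spaceTime d T))
        - ∫ p, u p.1 p.2 i * (φ p.1 p.2 * convRhs ν u q K i p.1 p.2) ∂(spaceTime d T) := by
  have h1 := one_le_threeHalves
  have h2 := threeHalves_ne_top
  have h3 : (1 : ℝ≥0∞) ≤ 3 := by norm_num
  have h4 : (3 : ℝ≥0∞) ≠ ⊤ := by simp
  have hui := memLp_coord hu i
  have hui' : SpaceTimeMemLp T (3 / 2) fun t x => u t x i := hui.mono_exponent threeHalves_le_three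
  have hqm := hq.memLp hT hu
  have θ0 := memLpC_test_mul_conv (F := fun t z => u t z i) h3 h4 hφ hui hK.continuous
  have θt : MemLpC T (3 / 2) fun t x => dt φ t x * conv K (fun z => u t z i) x :=
    (memLpC_test_mul_conv (F := fun t z => u t z i) h3 h4 hφ.dt hui
      hK.continuous).mono_exponent threeHalves_le_three
  have θj := memLpC_pd_test_mul_conv (F := fun t z => u t z i) h3 h4 hφ hui hK
  have θl := memLpC_lapl_test_mul_conv (F := fun t z => u t z i) h3 h4 hφ hui hK
  have θs : ∀ᵐ t ∂(volume.restrict (Ioo 0 T)),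
      SmoothOnTorus fun x => φ t x * conv K (fun z => u t z i) x :=
    (ae_smooth_conv (F := fun t z => u t z i) h3 hui hK).mono fun t ht =>
      (hφ.smoothOnTorus t).mul ht
  have hg := memLpC_convRhs (ν := ν) hT hu hq hK i
  have θg : MemLpC T (3 / 2) fun t x => φ t x * convRhs ν u q K i t x :=
    (MemLpC.of_isTest hφ).mul hg
  -- for a mollified first factor, this is the product rule for two convolutions, with the
  -- derivatives of the first kernel integrated by parts
  have key : ∀ n : ℕ,
      ∫ p, conv (mollKernel ρ (1 / (n + 1))) (fun z => u p.1 z i) p.2 *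
        (dt φ p.1 p.2 * conv K (fun z => u p.1 z i) p.2) ∂(spaceTime d T)
      = -((∑ j, ∫ p, conv (mollKernel ρ (1 / (n + 1))) (fun z => u p.1 z i * u p.1 z j) p.2 *
            pd j (fun x => φ p.1 x * conv K (fun z => u p.1 z i) x) p.2 ∂(spaceTime d T))
          + (∫ p, conv (mollKernel ρ (1 / (n + 1))) (q p.1) p.2 *
            pd i (fun x => φ p.1 x * conv K (fun z => u p.1 z i) x) p.2 ∂(spaceTime d T))
          + ν * ∫ p, conv (mollKernel ρ (1 / (n + 1))) (fun z => u p.1 z i) p.2 *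
            lapl (fun x => φ p.1 x * conv K (fun z => u p.1 z i) x) p.2 ∂(spaceTime d T))
        - ∫ p, conv (mollKernel ρ (1 / (n + 1))) (fun z => u p.1 z i) p.2 *
            (φ p.1 p.2 * convRhs ν u q K i p.1 p.2) ∂(spaceTime d T) := by
    intro n
    have hk : SmoothOnTorus (mollKernel ρ (1 / ((n : ℝ) + 1))) :=
      hρ.smooth_mollKernel (by positivity)
    generalize mollKernel ρ (1 / ((n : ℝ) + 1)) = k at hk
    have e0 := integral_conv_mul_conv_mul_dt hT hu hq h hk hK hφ i
    have eU : ∀ j, _ := fun j => integral_conv_pd_mul (F := fun t z => u t z i * u t z j)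
      h1 h2 hk (memLp_uu hu i j) θ0 θs j (θj j)
    have eq' := integral_conv_pd_mul h1 h2 hk hqm θ0 θs i (θj i)
    have eu := integral_conv_lapl_mul (F := fun t z => u t z i) h1 h2 hk hui' θ0 θs θl
    have kU : ∀ j, MemLpC T (3 / 2) fun t => conv (pd j k) (fun z => u t z i * u t z j) := fun j =>
      MemLpC.of_conv (F := fun t z => u t z i * u t z j) h1 h2 (memLp_uu hu i j)
        (hk.pd j).continuous
    have kq := MemLpC.of_conv h1 h2 hqm (hk.pd i).continuous
    have ku := MemLpC.of_conv (F := fun t z => u t z i) h1 h2 hui' hk.lapl.continuous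
    have iU : ∀ j, Integrable (fun p : ℝ × Torus d => conv (pd j k)
      (fun z => u p.1 z i * u p.1 z j) p.2 * (φ p.1 p.2 * conv K (fun z => u p.1 z i) p.2))
      (spaceTime d T) := fun j => θ0.integrable_mul (kU j).memLp
    have iq : Integrable (fun p : ℝ × Torus d => conv (pd i k) (q p.1) p.2 *
      (φ p.1 p.2 * conv K (fun z => u p.1 z i) p.2)) (spaceTime d T) := θ0.integrable_mul kq.memLp
    have iu : Integrable (fun p : ℝ × Torus d => conv (lapl k) (fun z => u p.1 z i) p.2 *
      (φ p.1 p.2 * conv K (fun z => u p.1 z i) p.2)) (spaceTime d T) := θ0.integrable_mul ku.memLp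
    have ig : Integrable (fun p : ℝ × Torus d => conv k (fun z => u p.1 z i) p.2 *
        (φ p.1 p.2 * convRhs ν u q K i p.1 p.2)) (spaceTime d T) :=
      θg.integrable_mul (memLpC_conv_u hu hk.continuous i).memLp
    have iU' : Integrable (fun p : ℝ × Torus d => ∑ j, conv (pd j k)
      (fun z => u p.1 z i * u p.1 z j) p.2 * (φ p.1 p.2 * conv K (fun z => u p.1 z i) p.2))
      (spaceTime d T) := integrable_finsetSum _ fun j _ => iU j
    have iUq : Integrable (fun p : ℝ × Torus d => (∑ j, conv (pd j k)
      (fun z => u p.1 z i * u p.1 z j) p.2 * (φ p.1 p.2 * conv K (fun z => u p.1 z i) p.2))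
      + conv (pd i k) (q p.1) p.2 * (φ p.1 p.2 * conv K (fun z => u p.1 z i) p.2))
      (spaceTime d T) := iU'.add iq
    have iUqu : Integrable (fun p : ℝ × Torus d => (∑ j, conv (pd j k)
      (fun z => u p.1 z i * u p.1 z j) p.2 * (φ p.1 p.2 * conv K (fun z => u p.1 z i) p.2))
      + conv (pd i k) (q p.1) p.2 * (φ p.1 p.2 * conv K (fun z => u p.1 z i) p.2)
      - ν * (conv (lapl k) (fun z => u p.1 z i) p.2 *
        (φ p.1 p.2 * conv K (fun z => u p.1 z i) p.2)))
      (spaceTime d T) := iUq.sub (iu.const_mul ν)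
    have e1 : ∫ p, conv k (fun z => u p.1 z i) p.2 *
        (dt φ p.1 p.2 * conv K (fun z => u p.1 z i) p.2) ∂(spaceTime d T)
      = ((∑ j, ∫ p, conv (pd j k) (fun z => u p.1 z i * u p.1 z j) p.2 *
            (φ p.1 p.2 * conv K (fun z => u p.1 z i) p.2) ∂(spaceTime d T))
          + (∫ p, conv (pd i k) (q p.1) p.2 * (φ p.1 p.2 * conv K (fun z => u p.1 z i) p.2)
            ∂(spaceTime d T))
          - ν * ∫ p, conv (lapl k) (fun z => u p.1 z i) p.2 *
            (φ p.1 p.2 * conv K (fun z => u p.1 z i) p.2) ∂(spaceTime d T))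
        - ∫ p, conv k (fun z => u p.1 z i) p.2 *
            (φ p.1 p.2 * convRhs ν u q K i p.1 p.2) ∂(spaceTime d T) := by
      rw [← integral_finsetSum _ fun j _ => iU j, ← integral_const_mul, ← integral_add iU' iq,
        ← integral_sub iUq (iu.const_mul ν), ← integral_sub iUqu ig]
      refine (integral_congr_ae (.of_forall fun p => ?_)).trans (e0.trans ?_)
      · ring
      rw [← integral_neg]
      refine integral_congr_ae (.of_forall fun p => ?_)
      simp only [← Finset.sum_mul]
      rw [convRhs]
      ring
    rw [e1, Finset.sum_congr rfl fun j _ => eU j, eq', eu, Finset.sum_neg_distrib]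
    ring
  -- all terms converge weakly as the first mollification is removed
  have l0 := tendsto_integral_conv_mul (F := fun t z => u t z i) hρ h3 h4 h1 h2 hui θt
  have lU : ∀ j, _ := fun j => tendsto_integral_conv_mul (F := fun t z => u t z i * u t z j)
    hρ h1 h2 h3 h4 (memLp_uu hu i j) (θj j)
  have lq := tendsto_integral_conv_mul hρ h1 h2 h3 h4 hqm (θj i)
  have lu := tendsto_integral_conv_mul (F := fun t z => u t z i) hρ h1 h2 h3 h4 hui' θl
  have lg := tendsto_integral_conv_mul (F := fun t z => u t z i) hρ h3 h4 h1 h2 hui θg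
  refine tendsto_nhds_unique l0 ?_
  simp only [key]
  exact ((((tendsto_finsetSum _ fun j _ => lU j).add lq).add (lu.const_mul ν)).neg).sub lg

end Energy

/-! ### The pointwise algebra of the energy identity -/

section Algebra

/-- The algebraic identity behind the energy balance of the fluctuation `u - V`. Here `V` stands for
the mollified velocity with gradient `DV`, second derivatives `DDV` and Laplacian `LV`, `DU i j` for
`∂_j (u_i u_j)_ℓ`, `P` for the mollified pressure with gradient `DP`, and `φ`, `φt`, `Dφ`, `Lφ` for
the test function and its derivatives. After the terms on the left, the right hand side consists of
the evolution of `u · V` and `|V|²`, of total derivatives, and of the viscous term `∇u : ∇V`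
integrated by parts. -/
lemma energy_algebra {d : ℕ} (u V Dφ DP LV : Fin d → ℝ) (DV DU DDV : Fin d → Fin d → ℝ)
    (φ φt Lφ q P ν : ℝ) (hdiv : ∑ i, DV i i = 0) (hL : ∀ i, ∑ j, DDV i j = LV i) :
    (∑ i, u i ^ 2) / 2 * φt + ν * ((∑ i, u i ^ 2) / 2 * Lφ)
      + (∑ i, ((∑ i, u i ^ 2) / 2 + q) * u i * Dφ i)
      - (∑ i, (u i - V i) ^ 2) / 2 * φt
      - (∑ i, (u i - V i) ^ 2) / 2 * (∑ i, (Dφ i * V i + φ * DV i i))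
      - ν * ((∑ i, (u i - V i) ^ 2) / 2 * Lφ)
      - (∑ i, ((∑ i, (u i - V i) ^ 2) / 2 + (q - P)) * (u i - V i) * Dφ i)
      + ((∑ i, (u i - V i) * ∑ j, (DV i j * V j + V i * DV j j - DU i j))
          + ∑ i, ∑ j, (u i - V i) * (u j - V j) * DV i j) * φ
      + ν * ((∑ i, ∑ j, DV i j * DV i j) * φ)
    = (∑ i, (u i * (φt * V i) + (∑ j, u i * u j * (Dφ j * V i + φ * DV i j))
          + q * (Dφ i * V i + φ * DV i i)
          + ν * (u i * ((Lφ * V i + 2 * ∑ j, Dφ j * DV i j) + φ * LV i))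
          + u i * (φ * (-(∑ j, DU i j) - DP i + ν * LV i))))
      - (∑ i, (V i * V i * φt + 2 * ((-(∑ j, DU i j) - DP i + ν * LV i) * V i * φ))) / 2
      - (∑ k, u k * (Dφ k * ((∑ i, V i * V i) / 2) + φ * ∑ i, V i * DV i k))
      + (∑ k, (u k - V k) * (Dφ k * P + φ * DP k))
      + ν * (φ * (∑ j, ∑ i, (DV i j * DV i j + V i * DDV i j)) - (∑ i, V i * V i) / 2 * Lφ)
      - 2 * ν * ∑ i, ∑ j, u i * (Dφ j * DV i j + φ * DDV i j) := by
  -- inner sums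
  set r : Fin d → ℝ := fun i => ∑ j, DU i j with hr
  set mV : Fin d → ℝ := fun i => ∑ j, DV i j * V j with hmV
  set mu : Fin d → ℝ := fun i => ∑ j, DV i j * u j with hmu
  set n : Fin d → ℝ := fun i => ∑ j, Dφ j * DV i j with hn
  have a1 : ∀ i, ∑ j, (DV i j * V j + V i * DV j j - DU i j) = mV i - r i := fun i => by
    rw [Finset.sum_sub_distrib, Finset.sum_add_distrib, ← Finset.mul_sum, hdiv]; ring
  have a2 : ∀ i, ∑ j, (u i - V i) * (u j - V j) * DV i j = (u i - V i) * (mu i - mV i) :=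
    fun i => by
      rw [hmu, hmV, ← Finset.sum_sub_distrib, Finset.mul_sum]
      exact Finset.sum_congr rfl fun j _ => by ring
  have a3 : ∀ i, ∑ j, u i * u j * (Dφ j * V i + φ * DV i j)
      = u i * V i * (∑ j, u j * Dφ j) + φ * (u i * mu i) := fun i => by
    rw [hmu, Finset.mul_sum, Finset.mul_sum, Finset.mul_sum, ← Finset.sum_add_distrib]
    exact Finset.sum_congr rfl fun j _ => by ring
  have a4 : ∀ i, ∑ j, u i * (Dφ j * DV i j + φ * DDV i j) = u i * n i + φ * (u i * LV i) :=
    fun i => by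
      rw [← Finset.mul_sum, Finset.sum_add_distrib, ← Finset.mul_sum, hL]; ring
  have a5 : ∑ j, ∑ i, (DV i j * DV i j + V i * DDV i j)
      = (∑ i, ∑ j, DV i j * DV i j) + ∑ i, V i * LV i := by
    rw [Finset.sum_comm, ← Finset.sum_add_distrib]
    refine Finset.sum_congr rfl fun i _ => ?_
    rw [Finset.sum_add_distrib, ← Finset.mul_sum, hL]
  have a6 : ∑ k, u k * (∑ i, V i * DV i k) = ∑ i, V i * mu i := by
    simp only [hmu, Finset.mul_sum]
    rw [Finset.sum_comm]
    exact Finset.sum_congr rfl fun i _ => Finset.sum_congr rfl fun j _ => by ring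
  -- outer sums
  have b1 : ∑ i, (u i - V i) ^ 2 = (∑ i, u i ^ 2) - 2 * (∑ i, u i * V i) + ∑ i, V i * V i := by
    rw [Finset.mul_sum, ← Finset.sum_sub_distrib, ← Finset.sum_add_distrib]
    exact Finset.sum_congr rfl fun j _ => by ring
  have b2 : ∀ c : ℝ, ∑ i, c * u i * Dφ i = c * ∑ i, u i * Dφ i := fun c => by
    rw [Finset.mul_sum]; exact Finset.sum_congr rfl fun j _ => by ring
  have b3 : ∀ c : ℝ, ∑ i, c * (u i - V i) * Dφ i
      = c * ((∑ i, u i * Dφ i) - ∑ i, V i * Dφ i) := fun c => by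
    rw [← Finset.sum_sub_distrib, Finset.mul_sum]
    exact Finset.sum_congr rfl fun j _ => by ring
  have b4 : ∑ i, (Dφ i * V i + φ * DV i i) = ∑ i, V i * Dφ i := by
    rw [Finset.sum_add_distrib, ← Finset.mul_sum, hdiv, mul_zero, add_zero]
    exact Finset.sum_congr rfl fun j _ => by ring
  have b5 : ∑ i, (u i - V i) * (mV i - r i) = (∑ i, u i * mV i) - (∑ i, V i * mV i)
      - (∑ i, u i * r i) + ∑ i, V i * r i := by
    rw [← Finset.sum_sub_distrib, ← Finset.sum_sub_distrib, ← Finset.sum_add_distrib]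
    exact Finset.sum_congr rfl fun j _ => by ring
  have b6 : ∑ i, (u i - V i) * (mu i - mV i) = (∑ i, u i * mu i) - (∑ i, V i * mu i)
      - (∑ i, u i * mV i) + ∑ i, V i * mV i := by
    rw [← Finset.sum_sub_distrib, ← Finset.sum_sub_distrib, ← Finset.sum_add_distrib]
    exact Finset.sum_congr rfl fun j _ => by ring
  have b7 : ∑ i, (u i * (φt * V i) + (u i * V i * (∑ j, u j * Dφ j) + φ * (u i * mu i))
          + q * (Dφ i * V i + φ * DV i i)
          + ν * (u i * ((Lφ * V i + 2 * n i) + φ * LV i))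
          + u i * (φ * (-(r i) - DP i + ν * LV i)))
      = (φt + (∑ j, u j * Dφ j) + ν * Lφ) * (∑ i, u i * V i) + φ * (∑ i, u i * mu i)
        + q * (∑ i, (Dφ i * V i + φ * DV i i)) + 2 * ν * (∑ i, u i * n i)
        + 2 * ν * φ * (∑ i, u i * LV i) - φ * (∑ i, u i * r i) - φ * ∑ i, u i * DP i := by
    simp only [Finset.mul_sum, ← Finset.sum_sub_distrib, ← Finset.sum_add_distrib]
    exact Finset.sum_congr rfl fun j _ => by
      simp only [← Finset.mul_sum]; ring
  have b8 : ∑ i, (V i * V i * φt + 2 * ((-(r i) - DP i + ν * LV i) * V i * φ))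
      = φt * (∑ i, V i * V i) - 2 * φ * (∑ i, V i * r i) - 2 * φ * (∑ i, V i * DP i)
        + 2 * ν * φ * ∑ i, V i * LV i := by
    simp only [Finset.mul_sum, ← Finset.sum_sub_distrib, ← Finset.sum_add_distrib]
    exact Finset.sum_congr rfl fun j _ => by ring
  have b9 : ∀ c : ℝ, ∑ k, u k * (Dφ k * c + φ * ∑ i, V i * DV i k)
      = c * (∑ k, u k * Dφ k) + φ * ∑ i, V i * mu i := fun c => by
    rw [← a6, Finset.mul_sum, Finset.mul_sum, ← Finset.sum_add_distrib]
    exact Finset.sum_congr rfl fun j _ => by ring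
  have b10 : ∑ k, (u k - V k) * (Dφ k * P + φ * DP k) = P * (∑ i, u i * Dφ i)
      - P * (∑ i, V i * Dφ i) + φ * (∑ i, u i * DP i) - φ * ∑ i, V i * DP i := by
    simp only [Finset.mul_sum, ← Finset.sum_sub_distrib, ← Finset.sum_add_distrib]
    exact Finset.sum_congr rfl fun j _ => by ring
  have b11 : ∑ i, (u i * n i + φ * (u i * LV i)) = (∑ i, u i * n i) + φ * ∑ i, u i * LV i := by
    rw [Finset.mul_sum, ← Finset.sum_add_distrib]
  simp only [a1, a2, a3, a4, a5]
  rw [b7, b8, b9, b10, b11, b5, b6, b4, b3, b2, b1]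
  ring

end Algebra

/-! ### Total derivatives and evolution identities with zero integral -/

section ZeroIntegral

variable {d : ℕ} {T ν : ℝ} {F H : ℝ → Torus d → ℝ} {r s t : ℝ≥0∞}

/-- Integrable functions on space-time with zero integral. -/
structure IntegralZero (T : ℝ) (F : ℝ → Torus d → ℝ) : Prop where
  integrable : SpaceTimeIntegrable T F
  eq_zero : ∫ p, F p.1 p.2 ∂(spaceTime d T) = 0

lemma IntegralZero.of_slices (hF : SpaceTimeIntegrable T F)
    (h : ∀ᵐ t ∂(volume.restrict (Ioo 0 T)), ∫ x, F t x = 0) : IntegralZero T F := by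
  refine ⟨hF, ?_⟩
  rw [spaceTime, integral_prod _ hF]
  exact (integral_congr_ae h).trans (by simp)

lemma IntegralZero.congr (hF : IntegralZero T F)
    (h : ∀ᵐ t ∂(volume.restrict (Ioo 0 T)), ∀ x, F t x = H t x) : IntegralZero T H := by
  have h' : (fun p : ℝ × Torus d => F p.1 p.2) =ᵐ[spaceTime d T] fun p => H p.1 p.2 :=
    (ae_spaceTime_of_ae h).mono fun p hp => hp p.2
  exact ⟨hF.integrable.congr h', by rw [← integral_congr_ae h', hF.eq_zero]⟩

lemma SpaceTimeMemLp.mul [ENNReal.HolderTriple r s t] (hF : SpaceTimeMemLp T r F)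
    (hH : SpaceTimeMemLp T s H) : SpaceTimeMemLp T t fun t x => F t x * H t x :=
  MemLp.mul (p := r) (q := s) hH hF

lemma MemLpC.integrable (h : MemLpC T r F) (hr : 1 ≤ r) : SpaceTimeIntegrable T F :=
  MemLp.integrable hr h.memLp

end ZeroIntegral

section Identities

variable {d : ℕ} {T ν : ℝ} {u : ℝ → Torus d → Vec d} {q : ℝ → Torus d → ℝ}
  {K : Torus d → ℝ} {φ : ℝ → Torus d → ℝ} {ρ : Vec d → ℝ}

lemma ae_integrable_u (hu : MemLp (fun p : ℝ × Torus d => u p.1 p.2) 3 (spaceTime d T)) :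
    ∀ᵐ t ∂(volume.restrict (Ioo 0 T)), ∀ i, Integrable fun x => u t x i :=
  ae_all_iff.2 fun i => (integrable_u hu i).ae_integrable

lemma HasPd.half_sum_sq {V V' : Fin d → Torus d → ℝ} {k : Fin d}
    (h : ∀ i, HasPd k (V i) (V' i)) :
    HasPd k (fun x => (∑ i, V i x * V i x) / 2) (fun x => ∑ i, V i x * V' i x) := by
  have h1 := (HasPd.sum Finset.univ fun i _ => (h i).mul (h i)).const_mul (2⁻¹)
  have h2 : (fun x => (∑ i, V i x * V i x) / 2) = fun x => 2⁻¹ * ∑ i, V i x * V i x := by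
    funext x; ring
  rw [h2]
  refine h1.congr fun x => ?_
  rw [Finset.mul_sum]
  exact Finset.sum_congr rfl fun i _ => by ring

lemma SmoothOnTorus.half_sum_sq {V : Fin d → Torus d → ℝ} (h : ∀ i, SmoothOnTorus (V i)) :
    SmoothOnTorus fun x => (∑ i, V i x * V i x) / 2 := by
  have := (SmoothOnTorus.const (d := d) (2⁻¹ : ℝ)).mul
    (SmoothOnTorus.sum Finset.univ fun i _ => (h i).mul (h i))
  simpa only [div_eq_inv_mul] using this

/-- Convolution preserves incompressibility. -/
lemma ae_sum_conv_pd_eq_zero (hT : 0 < T)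
    (hu : MemLp (fun p : ℝ × Torus d => u p.1 p.2) 3 (spaceTime d T)) (h : IsWeakSolution T ν u)
    (hK : SmoothOnTorus K) : ∀ᵐ t ∂(volume.restrict (Ioo 0 T)), ∀ x,
      ∑ i, conv (pd i K) (fun z => u t z i) x = 0 := by
  filter_upwards [ae_divergence_free hT hu h] with t ht x
  have hs : SmoothOnTorus fun z => K (x + -z) := (hK.comp_add x).comp_neg
  have h1 := ht _ hs
  have h2 : ∀ k, pd k (fun z => K (x + -z)) = fun z => -pd k K (x + -z) := fun k =>
    ((hK.hasPd k).comp_add x).comp_neg.pd_eq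
  simp only [h2, mul_neg, integral_neg, Finset.sum_neg_distrib, neg_eq_zero] at h1
  simpa only [conv, sub_eq_add_neg, mul_comm (pd _ K _)] using h1

lemma sum_conv_pd_pd (hK : SmoothOnTorus K) {f : Torus d → ℝ} (hf : Integrable f) (x : Torus d) :
    ∑ j, conv (pd j (pd j K)) f x = conv (lapl K) f x :=
  (conv_sum_left _ (fun j _ => ((hK.pd j).pd j).continuous) hf x).symm

lemma pd_mul_conv {f g : Torus d → ℝ} (hg : SmoothOnTorus g) (hK : SmoothOnTorus K)
    (hf : Integrable f) (j : Fin d) : pd j (fun x => g x * conv K f x)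
      = fun x => pd j g x * conv K f x + g x * conv (pd j K) f x := by
  rw [((hg.hasPd j).mul ((hK.conv hf).hasPd j)).pd_eq, pd_conv hK hf]

lemma lapl_mul_conv {f g : Torus d → ℝ} (hg : SmoothOnTorus g) (hK : SmoothOnTorus K)
    (hf : Integrable f) (x : Torus d) : lapl (fun x => g x * conv K f x) x
      = (lapl g x * conv K f x + 2 * ∑ j, pd j g x * conv (pd j K) f x)
        + g x * conv (lapl K) f x := by
  have h1 : ∀ j, pd j (pd j fun x => g x * conv K f x) = fun x =>
      (pd j (pd j g) x * conv K f x + pd j g x * conv (pd j K) f x)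
      + (pd j g x * conv (pd j K) f x + g x * conv (pd j (pd j K)) f x) := fun j => by
    rw [pd_mul_conv hg hK hf]
    have s1 := (hg.pd j).mul (hK.conv hf)
    have s2 := hg.mul ((hK.pd j).conv hf)
    rw [((s1.hasPd j).add (s2.hasPd j)).pd_eq, pd_mul_conv (hg.pd j) hK hf,
      pd_mul_conv hg (hK.pd j) hf]
  rw [← sum_conv_pd_pd hK hf]
  simp only [lapl, h1, Finset.mul_sum, Finset.sum_mul, ← Finset.sum_add_distrib]
  exact Finset.sum_congr rfl fun j _ => by ring

/-- The velocity does not transport in the mean: `∫ u · ∇(φ |V|² / 2) = 0`. -/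
lemma integralZero_u_grad (hT : 0 < T)
    (hu : MemLp (fun p : ℝ × Torus d => u p.1 p.2) 3 (spaceTime d T)) (h : IsWeakSolution T ν u)
    (hK : SmoothOnTorus K) (hφ : IsTest T φ) :
    IntegralZero T fun t x => ∑ k, u t x k * (pd k (φ t) x *
      ((∑ i, conv K (fun z => u t z i) x * conv K (fun z => u t z i) x) / 2)
      + φ t x * ∑ i, conv K (fun z => u t z i) x * conv (pd k K) (fun z => u t z i) x) := by
  have hV := fun i => memLpC_conv_u hu hK.continuous i
  have hDV := fun k i => memLpC_conv_u hu (hK.pd k).continuous i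
  have hη : ∀ k, MemLpC T (3 / 2) fun t x => pd k (φ t) x *
      ((∑ i, conv K (fun z => u t z i) x * conv K (fun z => u t z i) x) / 2)
      + φ t x * ∑ i, conv K (fun z => u t z i) x * conv (pd k K) (fun z => u t z i) x := by
    intro k
    simp only [div_eq_inv_mul]
    exact ((MemLpC.of_isTest (hφ.pd k)).mul
      ((MemLpC.sum _ fun i _ => (hV i).mul (hV i) (r'' := 3 / 2)).const_mul 2⁻¹)).add
      ((MemLpC.of_isTest hφ).mul (MemLpC.sum _ fun i _ => (hV i).mul (hDV k i) (r'' := 3 / 2)))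
  have hint : ∀ k, SpaceTimeIntegrable T _ := fun k =>
    (hη k).integrable_mul (F := fun t x => u t x k) (memLp_coord hu k)
  refine .of_slices (integrable_finsetSum _ fun k _ => hint k) ?_
  filter_upwards [ae_divergence_free hT hu h, ae_integrable_u hu,
    ae_all_iff.2 fun k => (hint k).ae_integrable] with t h1 h2 h3
  rw [integral_finsetSum _ fun k _ => h3 k]
  have hs : SmoothOnTorus fun x =>
    (∑ i, conv K (fun z => u t z i) x * conv K (fun z => u t z i) x) / 2 :=
    .half_sum_sq fun i => hK.conv (h2 i)
  have h4 := h1 _ ((hφ.smoothOnTorus t).mul hs)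
  have h5 : ∀ k, _ := fun k => (((hφ.smoothOnTorus t).hasPd k).mul
    (HasPd.half_sum_sq fun i => (hK.hasPd k).conv hK.continuous (hK.pd k).continuous (h2 i))).pd_eq
  simp only [h5] at h4
  exact h4

/-- The fluctuation `u - V` is divergence-free, so it is orthogonal to `∇(φ p)`, where `p` is the
mollified pressure. -/
lemma integralZero_fluct_grad (hT : 0 < T)
    (hu : MemLp (fun p : ℝ × Torus d => u p.1 p.2) 3 (spaceTime d T)) (hq : IsPressure T u q)
    (h : IsWeakSolution T ν u) (hK : SmoothOnTorus K) (hφ : IsTest T φ) :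
    IntegralZero T fun t x => ∑ k, (u t x k - conv K (fun z => u t z k) x) *
      (pd k (φ t) x * conv K (q t) x + φ t x * conv (pd k K) (q t) x) := by
  have hV := fun i => memLpC_conv_u hu hK.continuous i
  have hP := MemLpC.of_conv one_le_threeHalves threeHalves_ne_top (hq.memLp hT hu) hK.continuous
  have hDP := fun k => MemLpC.of_conv one_le_threeHalves threeHalves_ne_top (hq.memLp hT hu)
    (hK.pd k).continuous
  have hη : ∀ k, MemLpC T (3 / 2) fun t x =>
      pd k (φ t) x * conv K (q t) x + φ t x * conv (pd k K) (q t) x := fun k =>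
    ((MemLpC.of_isTest (hφ.pd k)).mul hP).add ((MemLpC.of_isTest hφ).mul (hDP k))
  have hint : ∀ k, SpaceTimeIntegrable T fun t x => (u t x k - conv K (fun z => u t z k) x) *
      (pd k (φ t) x * conv K (q t) x + φ t x * conv (pd k K) (q t) x) := fun k =>
    (hη k).integrable_mul (F := fun t x => u t x k - conv K (fun z => u t z k) x)
      ((memLp_coord hu k).sub (hV k).memLp)
  have hint1 : ∀ k, SpaceTimeIntegrable T _ := fun k =>
    (hη k).integrable_mul (F := fun t x => u t x k) (memLp_coord hu k)
  refine .of_slices (integrable_finsetSum _ fun k _ => hint k) ?_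
  filter_upwards [ae_divergence_free hT hu h, ae_integrable_u hu,
    ae_all_iff.2 fun k => (hint k).ae_integrable, ae_all_iff.2 fun k => (hint1 k).ae_integrable,
    SpaceTimeIntegrable.ae_integrable hq.integrable, ae_sum_conv_pd_eq_zero hT hu h hK]
    with t h1 h2 h3 h3' hqt hdiv
  rw [integral_finsetSum _ fun k _ => h3 k]
  have hs := (hφ.smoothOnTorus t).mul (hK.conv hqt)
  have h4 := h1 _ hs
  have h5 : ∀ k, ∫ x, conv K (fun z => u t z k) x * pd k (fun x => φ t x * conv K (q t) x) x
      = -∫ x, conv (pd k K) (fun z => u t z k) x * (φ t x * conv K (q t) x) := fun k => by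
    have := ((hK.hasPd k).conv hK.continuous (hK.pd k).continuous (h2 k)).integral_mul_eq
      (hs.hasPd k) (continuous_conv hK.continuous (h2 k))
      (continuous_conv (hK.pd k).continuous (h2 k)) hs.continuous (hs.pd k).continuous
    rw [this, neg_neg]
  have h6 : ∑ k, ∫ x, conv K (fun z => u t z k) x * pd k (fun x => φ t x * conv K (q t) x) x
      = 0 := by
    simp only [h5, Finset.sum_neg_distrib]
    have hi : ∀ k, Integrable fun x =>
        conv (pd k K) (fun z => u t z k) x * (φ t x * conv K (q t) x) := fun k =>
      integrable_of_continuous ((continuous_conv (hK.pd k).continuous (h2 k)).mul hs.continuous)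
    rw [← integral_finsetSum _ fun k _ => hi k]
    simp only [← Finset.sum_mul, hdiv, zero_mul, integral_zero, neg_zero]
  simp only [pd_mul_conv (hφ.smoothOnTorus t) hK hqt] at h4 h6
  rw [← sub_zero (0 : ℝ)]
  nth_rewrite 1 [← h4]
  rw [← h6, ← Finset.sum_sub_distrib]
  refine Finset.sum_congr rfl fun k _ => ?_
  have hi : Integrable fun x => conv K (fun z => u t z k) x *
      (pd k (φ t) x * conv K (q t) x + φ t x * conv (pd k K) (q t) x) := by
    have := (hs.pd k).continuous
    rw [pd_mul_conv (hφ.smoothOnTorus t) hK hqt] at this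
    exact integrable_of_continuous ((continuous_conv hK.continuous (h2 k)).mul this)
  rw [← integral_sub (h3' k) hi]
  exact integral_congr_ae (.of_forall fun x => by ring)

/-- Green's identity for `φ` and `|V|² / 2`. -/
lemma integralZero_green (hT : 0 < T)
    (hu : MemLp (fun p : ℝ × Torus d => u p.1 p.2) 3 (spaceTime d T))
    (hK : SmoothOnTorus K) (hφ : IsTest T φ) :
    IntegralZero T fun t x => φ t x * (∑ j, ∑ i,
        (conv (pd j K) (fun z => u t z i) x * conv (pd j K) (fun z => u t z i) x
          + conv K (fun z => u t z i) x * conv (pd j (pd j K)) (fun z => u t z i) x))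
      - (∑ i, conv K (fun z => u t z i) x * conv K (fun z => u t z i) x) / 2 * lapl (φ t) x := by
  have hV := fun i => memLpC_conv_u hu hK.continuous i
  have hDV := fun k i => memLpC_conv_u hu (hK.pd k).continuous i
  have hDDV := fun k i => memLpC_conv_u hu ((hK.pd k).pd k).continuous i
  have h1 : MemLpC T (3 / 2) fun t x => φ t x * (∑ j, ∑ i,
        (conv (pd j K) (fun z => u t z i) x * conv (pd j K) (fun z => u t z i) x
          + conv K (fun z => u t z i) x * conv (pd j (pd j K)) (fun z => u t z i) x)) :=
    (MemLpC.of_isTest hφ).mul (MemLpC.sum _ fun j _ => MemLpC.sum _ fun i _ =>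
      ((hDV j i).mul (hDV j i) (r'' := 3 / 2)).add ((hV i).mul (hDDV j i)))
  have h2 : MemLpC T (3 / 2) fun t x =>
      (∑ i, conv K (fun z => u t z i) x * conv K (fun z => u t z i) x) / 2 * lapl (φ t) x := by
    simp only [div_eq_inv_mul]
    exact ((MemLpC.sum _ fun i _ => (hV i).mul (hV i) (r'' := 3 / 2)).const_mul 2⁻¹).mul
      (MemLpC.of_isTest (hφ.lapl hT))
  have i1 := h1.integrable one_le_threeHalves
  have i2 := h2.integrable one_le_threeHalves
  refine .of_slices (i1.sub i2) ?_
  filter_upwards [ae_integrable_u hu, i1.ae_integrable, i2.ae_integrable] with t ht i1 i2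
  rw [integral_sub i1 i2, sub_eq_zero]
  have hs : SmoothOnTorus fun x =>
    (∑ i, conv K (fun z => u t z i) x * conv K (fun z => u t z i) x) / 2 :=
    .half_sum_sq fun i => hK.conv (ht i)
  have h3 := integral_lapl_mul hs (hφ.smoothOnTorus t)
  have hpd : ∀ {k : Torus d → ℝ}, SmoothOnTorus k → ∀ j i,
      HasPd j (conv k fun z => u t z i) (conv (pd j k) fun z => u t z i) :=
    fun hk j i => (hk.hasPd j).conv hk.continuous (hk.pd j).continuous (ht i)
  have h4 : ∀ x, lapl (fun x =>
      (∑ i, conv K (fun z => u t z i) x * conv K (fun z => u t z i) x) / 2) x = ∑ j, ∑ i,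
        (conv (pd j K) (fun z => u t z i) x * conv (pd j K) (fun z => u t z i) x
          + conv K (fun z => u t z i) x * conv (pd j (pd j K)) (fun z => u t z i) x) := by
    intro x
    refine Finset.sum_congr rfl fun j _ => ?_
    rw [(HasPd.half_sum_sq fun i => hpd hK j i).pd_eq,
      (HasPd.sum Finset.univ fun i _ => (hpd hK j i).mul (hpd (hK.pd j) j i)).pd_eq]
  simp only [h4] at h3
  simpa only [mul_comm (φ t _)] using h3

/-- The viscous term `∇u : ∇V`, integrated by parts. -/
lemma integral_u_mul_pd_eq (hT : 0 < T) {G : ℝ → Torus d → Fin d → Fin d → ℝ}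
    (hG : IsL2H1 T u G)
    (hu : MemLp (fun p : ℝ × Torus d => u p.1 p.2) 3 (spaceTime d T))
    (hK : SmoothOnTorus K) (hφ : IsTest T φ) :
    ∫ p, (∑ i, ∑ j, u p.1 p.2 i * (pd j (φ p.1) p.2 * conv (pd j K) (fun z => u p.1 z i) p.2
        + φ p.1 p.2 * conv (pd j (pd j K)) (fun z => u p.1 z i) p.2)) ∂(spaceTime d T)
      = -∫ p, (∑ i, ∑ j, G p.1 p.2 i j * conv (pd j K) (fun z => u p.1 z i) p.2) * φ p.1 p.2
        ∂(spaceTime d T) := by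
  have hDV := fun k i => memLpC_conv_u hu (hK.pd k).continuous i
  have hDDV := fun k i => memLpC_conv_u hu ((hK.pd k).pd k).continuous i
  have hη : ∀ i j, MemLpC T 3 fun t x => pd j (φ t) x * conv (pd j K) (fun z => u t z i) x
        + φ t x * conv (pd j (pd j K)) (fun z => u t z i) x := fun i j =>
    ((MemLpC.of_isTest (hφ.pd j)).mul (hDV j i)).add ((MemLpC.of_isTest hφ).mul (hDDV j i))
  have i1 : ∀ i j, SpaceTimeIntegrable T _ := fun i j =>
    ((hη i j).mono_exponent threeHalves_le_three).integrable_mul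
      (F := fun t x => u t x i) (memLp_coord hu i)
  have i2 : ∀ i j, SpaceTimeIntegrable T fun t x =>
      G t x i j * (φ t x * conv (pd j K) (fun z => u t z i) x) := fun i j =>
    (hG.grad_memLp i j).integrable_mul (((MemLpC.of_isTest hφ).mul (hDV j i)
      (r'' := 3)).mono_exponent (by norm_num : (2 : ℝ≥0∞) ≤ 3)).memLp
  rw [← integral_neg]
  have i2' : SpaceTimeIntegrable T fun t x =>
      -((∑ i, ∑ j, G t x i j * conv (pd j K) (fun z => u t z i) x) * φ t x) := by
    have : SpaceTimeIntegrable T fun t x =>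
        -∑ i, ∑ j, G t x i j * (φ t x * conv (pd j K) (fun z => u t z i) x) :=
      (integrable_finsetSum _ fun i _ => integrable_finsetSum _ fun j _ => i2 i j).neg
    refine this.congr (.of_forall fun p => ?_)
    simp only [Finset.sum_mul]
    congr 1
    exact Finset.sum_congr rfl fun i _ => Finset.sum_congr rfl fun j _ => by ring
  have i1' : SpaceTimeIntegrable T fun t x => ∑ i, ∑ j, u t x i *
      (pd j (φ t) x * conv (pd j K) (fun z => u t z i) x
        + φ t x * conv (pd j (pd j K)) (fun z => u t z i) x) :=
    integrable_finsetSum _ fun i _ => integrable_finsetSum _ fun j _ => i1 i j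
  refine integral_spaceTime_congr i1' i2' ?_
  filter_upwards [ae_weak_grad hT hG, ae_integrable_u hu,
    ae_all_iff.2 fun i => ae_all_iff.2 fun j => (i1 i j).ae_integrable,
    ae_all_iff.2 fun i => ae_all_iff.2 fun j => (i2 i j).ae_integrable] with t h1 h2 k1 k2
  rw [integral_finsetSum _ fun i _ => integrable_finsetSum _ fun j _ => k1 i j]
  simp only [fun i => integral_finsetSum _ fun j (_ : j ∈ Finset.univ) => k1 i j]
  have h3 : ∀ i j, _ := fun i j => h1 i j _ ((hφ.smoothOnTorus t).mul ((hK.pd j).conv (h2 i)))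
  have h4 : ∀ i j, pd j (fun x => φ t x * conv (pd j K) (fun z => u t z i) x) = _ := fun i j =>
    pd_mul_conv (hφ.smoothOnTorus t) (hK.pd j) (h2 i) j
  simp only [h4] at h3
  simp only [h3, Finset.sum_neg_distrib, integral_neg]
  simp only [← fun i => integral_finsetSum _ fun j (_ : j ∈ Finset.univ) => k2 i j]
  rw [← integral_finsetSum _ fun i _ => integrable_finsetSum _ fun j _ => k2 i j]
  congr 1
  refine integral_congr_ae (.of_forall fun x => ?_)
  simp only [Finset.sum_mul]
  exact Finset.sum_congr rfl fun i _ => Finset.sum_congr rfl fun j _ => by ring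

end Identities

section Evolution

variable {d : ℕ} {T ν : ℝ} {u : ℝ → Torus d → Vec d} {q : ℝ → Torus d → ℝ}
  {K : Torus d → ℝ} {φ : ℝ → Torus d → ℝ} {ρ : Vec d → ℝ} {F : ℝ → Torus d → ℝ}

lemma SpaceTimeIntegrable.mul_test (hF : SpaceTimeIntegrable T F) (hφ : IsTest T φ) :
    SpaceTimeIntegrable T fun t x => F t x * φ t x := by
  obtain ⟨C, -, hC⟩ := hφ.exists_norm_le
  exact hF.mul_bounded hφ.continuous fun p => hC p.1 p.2

/-- The evolution of the mollified energy, summed over the components. -/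
lemma integralZero_mollified_energy (hT : 0 < T)
    (hu : MemLp (fun p : ℝ × Torus d => u p.1 p.2) 3 (spaceTime d T)) (hq : IsPressure T u q)
    (h : IsWeakSolution T ν u) (hK : SmoothOnTorus K) (hφ : IsTest T φ) :
    IntegralZero T fun t x => ∑ i, (conv K (fun z => u t z i) x * conv K (fun z => u t z i) x *
      dt φ t x + 2 * (convRhs ν u q K i t x * conv K (fun z => u t z i) x * φ t x)) := by
  have hV := fun i => memLpC_conv_u hu hK.continuous i
  have hg := fun i => memLpC_convRhs (ν := ν) hT hu hq hK i
  have i1 : ∀ i, SpaceTimeIntegrable T fun t x =>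
      conv K (fun z => u t z i) x * conv K (fun z => u t z i) x * dt φ t x := fun i =>
    ((((hV i).mul (hV i) (r'' := 3 / 2))).integrable one_le_threeHalves).mul_test hφ.dt
  have i2 : ∀ i, SpaceTimeIntegrable T fun t x =>
      convRhs ν u q K i t x * conv K (fun z => u t z i) x * φ t x := fun i =>
    ((((hg i).mul (hV i) (r'' := 1))).integrable le_rfl).mul_test hφ
  have i3 : ∀ i, SpaceTimeIntegrable T fun t x => conv K (fun z => u t z i) x *
      conv K (fun z => u t z i) x * dt φ t x
      + 2 * (convRhs ν u q K i t x * conv K (fun z => u t z i) x * φ t x) := fun i =>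
    (i1 i).add ((i2 i).const_mul 2)
  refine ⟨integrable_finsetSum _ fun i _ => i3 i, ?_⟩
  rw [integral_finsetSum _ fun i _ => i3 i]
  refine Finset.sum_eq_zero fun i _ => ?_
  rw [integral_add (i1 i) ((i2 i).const_mul 2),
    integral_conv_mul_conv_mul_dt hT hu hq h hK hK hφ i, integral_const_mul, neg_add_eq_zero,
    ← integral_const_mul]
  exact integral_congr_ae (.of_forall fun p => by ring)

/-- The evolution of the correlation `u · V`, summed over the components, with the derivatives of
`φ V` expanded. -/
lemma integralZero_correlation (hT : 0 < T) (hρ : IsMollifier ρ)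
    (hu : MemLp (fun p : ℝ × Torus d => u p.1 p.2) 3 (spaceTime d T)) (hq : IsPressure T u q)
    (h : IsWeakSolution T ν u) (hK : SmoothOnTorus K) (hφ : IsTest T φ) :
    IntegralZero T fun t x => ∑ i, (u t x i * (dt φ t x * conv K (fun z => u t z i) x)
      + (∑ j, u t x i * u t x j * (pd j (φ t) x * conv K (fun z => u t z i) x
          + φ t x * conv (pd j K) (fun z => u t z i) x))
      + q t x * (pd i (φ t) x * conv K (fun z => u t z i) x
          + φ t x * conv (pd i K) (fun z => u t z i) x)
      + ν * (u t x i * ((lapl (φ t) x * conv K (fun z => u t z i) x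
          + 2 * ∑ j, pd j (φ t) x * conv (pd j K) (fun z => u t z i) x)
          + φ t x * conv (lapl K) (fun z => u t z i) x))
      + u t x i * (φ t x * convRhs ν u q K i t x)) := by
  have h3 : (1 : ℝ≥0∞) ≤ 3 := by norm_num
  have h4 : (3 : ℝ≥0∞) ≠ ⊤ := by simp
  have hui : ∀ i, SpaceTimeMemLp T 3 fun t x => u t x i := memLp_coord hu
  have hui' : ∀ i, SpaceTimeMemLp T (3 / 2) fun t x => u t x i := fun i =>
    (hui i).mono_exponent threeHalves_le_three
  have hV := fun i => memLpC_conv_u hu hK.continuous i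
  have i1 : ∀ i, SpaceTimeIntegrable T fun t x =>
      u t x i * (dt φ t x * conv K (fun z => u t z i) x) := fun i =>
    ((MemLpC.of_isTest hφ.dt).mul (hV i) (r'' := 3)).integrable_mul (hui' i)
  have i2 : ∀ i j, SpaceTimeIntegrable T fun t x => u t x i * u t x j *
      pd j (fun x => φ t x * conv K (fun z => u t z i) x) x := fun i j =>
    (memLpC_pd_test_mul_conv (F := fun t z => u t z i) h3 h4 hφ (hui i) hK j).integrable_mul
      (memLp_uu hu i j)
  have i3 : ∀ i, SpaceTimeIntegrable T fun t x => q t x *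
      pd i (fun x => φ t x * conv K (fun z => u t z i) x) x := fun i =>
    (memLpC_pd_test_mul_conv (F := fun t z => u t z i) h3 h4 hφ (hui i) hK i).integrable_mul
      (hq.memLp hT hu)
  have i4 : ∀ i, SpaceTimeIntegrable T fun t x => u t x i *
      lapl (fun x => φ t x * conv K (fun z => u t z i) x) x := fun i =>
    (memLpC_lapl_test_mul_conv (F := fun t z => u t z i) h3 h4 hφ (hui i) hK).integrable_mul
      (hui' i)
  have i5 : ∀ i, SpaceTimeIntegrable T fun t x => u t x i * (φ t x * convRhs ν u q K i t x) :=
    fun i => ((MemLpC.of_isTest hφ).mul (memLpC_convRhs hT hu hq hK i)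
      (r'' := 3 / 2)).integrable_mul (hui i)
  have i2' : ∀ i, SpaceTimeIntegrable T fun t x => ∑ j, u t x i * u t x j *
      pd j (fun x => φ t x * conv K (fun z => u t z i) x) x := fun i =>
    integrable_finsetSum _ fun j _ => i2 i j
  have k2 : ∀ i, SpaceTimeIntegrable T fun t x =>
      u t x i * (dt φ t x * conv K (fun z => u t z i) x) + ∑ j, u t x i * u t x j *
        pd j (fun x => φ t x * conv K (fun z => u t z i) x) x := fun i => (i1 i).add (i2' i)
  have k3 : ∀ i, SpaceTimeIntegrable T fun t x =>
      u t x i * (dt φ t x * conv K (fun z => u t z i) x) + (∑ j, u t x i * u t x j *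
        pd j (fun x => φ t x * conv K (fun z => u t z i) x) x)
      + q t x * pd i (fun x => φ t x * conv K (fun z => u t z i) x) x := fun i =>
    (k2 i).add (i3 i)
  have k4 : ∀ i, SpaceTimeIntegrable T fun t x =>
      u t x i * (dt φ t x * conv K (fun z => u t z i) x) + (∑ j, u t x i * u t x j *
        pd j (fun x => φ t x * conv K (fun z => u t z i) x) x)
      + q t x * pd i (fun x => φ t x * conv K (fun z => u t z i) x) x
      + ν * (u t x i * lapl (fun x => φ t x * conv K (fun z => u t z i) x) x) := fun i =>
    (k3 i).add ((i4 i).const_mul ν)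
  have k5 : ∀ i, SpaceTimeIntegrable T fun t x =>
      u t x i * (dt φ t x * conv K (fun z => u t z i) x) + (∑ j, u t x i * u t x j *
        pd j (fun x => φ t x * conv K (fun z => u t z i) x) x)
      + q t x * pd i (fun x => φ t x * conv K (fun z => u t z i) x) x
      + ν * (u t x i * lapl (fun x => φ t x * conv K (fun z => u t z i) x) x)
      + u t x i * (φ t x * convRhs ν u q K i t x) := fun i => (k4 i).add (i5 i)
  have key : IntegralZero T fun t x => ∑ i,
      (u t x i * (dt φ t x * conv K (fun z => u t z i) x) + (∑ j, u t x i * u t x j *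
        pd j (fun x => φ t x * conv K (fun z => u t z i) x) x)
      + q t x * pd i (fun x => φ t x * conv K (fun z => u t z i) x) x
      + ν * (u t x i * lapl (fun x => φ t x * conv K (fun z => u t z i) x) x)
      + u t x i * (φ t x * convRhs ν u q K i t x)) := by
    refine ⟨integrable_finsetSum _ fun i _ => k5 i, ?_⟩
    rw [integral_finsetSum _ fun i _ => k5 i]
    refine Finset.sum_eq_zero fun i _ => ?_
    rw [integral_add (k4 i) (i5 i), integral_add (k3 i) ((i4 i).const_mul ν),
      integral_add (k2 i) (i3 i), integral_add (i1 i) (i2' i), integral_const_mul,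
      integral_finsetSum _ fun j _ => i2 i j,
      integral_u_mul_conv_mul_dt hT hρ hu hq h hK hφ i]
    ring
  refine key.congr ?_
  filter_upwards [ae_integrable_u hu] with t ht x
  simp only [pd_mul_conv (hφ.smoothOnTorus t) hK (ht _),
    lapl_mul_conv (hφ.smoothOnTorus t) hK (ht _)]

end Evolution

/-! ### The energy identity for a general smooth kernel -/

section Identity

variable {d : ℕ} {T ν : ℝ} {u : ℝ → Torus d → Vec d} {q : ℝ → Torus d → ℝ}
  {K : Torus d → ℝ} {φ : ℝ → Torus d → ℝ} {ρ : Vec d → ℝ} {F : ℝ → Torus d → ℝ}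

/-- The energy density of the fluctuation around the convolution of `u` with `K`. -/
noncomputable def fluctEnergy (K : Torus d → ℝ) (u : ℝ → Torus d → Vec d) (t : ℝ) (x : Torus d) :
    ℝ := (∑ i, (u t x i - conv K (fun z => u t z i) x) ^ 2) / 2

/-- The flux of the energy of the fluctuation. -/
noncomputable def fluctFlux (K : Torus d → ℝ) (u : ℝ → Torus d → Vec d) (q : ℝ → Torus d → ℝ)
    (t : ℝ) (x : Torus d) (i : Fin d) : ℝ :=
  (fluctEnergy K u t x + (q t x - conv K (q t) x)) * (u t x i - conv K (fun z => u t z i) x)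

/-- The commutator terms, with the derivatives falling on the kernel. -/
noncomputable def fluctCommutator (K : Torus d → ℝ) (u : ℝ → Torus d → Vec d)
    (t : ℝ) (x : Torus d) : ℝ :=
  (∑ i, (u t x i - conv K (fun z => u t z i) x) * ∑ j,
      (conv (pd j K) (fun z => u t z i) x * conv K (fun z => u t z j) x
        + conv K (fun z => u t z i) x * conv (pd j K) (fun z => u t z j) x
        - conv (pd j K) (fun z => u t z i * u t z j) x))
    + ∑ i, ∑ j, (u t x i - conv K (fun z => u t z i) x) * (u t x j - conv K (fun z => u t z j) x)
      * conv (pd j K) (fun z => u t z i) x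

lemma memLp_fluct (hu : MemLp (fun p : ℝ × Torus d => u p.1 p.2) 3 (spaceTime d T))
    (hK : Continuous K) (i : Fin d) :
    SpaceTimeMemLp T 3 fun t x => u t x i - conv K (fun z => u t z i) x :=
  (memLp_coord hu i).sub (memLpC_conv_u hu hK i).memLp

lemma memLp_half_sum_sq {w : Fin d → ℝ → Torus d → ℝ} (hw : ∀ i, SpaceTimeMemLp T 3 (w i)) :
    SpaceTimeMemLp T (3 / 2) fun t x => (∑ i, w i t x ^ 2) / 2 := by
  have h1 : ∀ i, SpaceTimeMemLp T (3 / 2) fun t x => w i t x * w i t x := fun i =>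
    SpaceTimeMemLp.mul (hw i) (hw i)
  have h2 : MemLp (fun p : ℝ × Torus d => ∑ i, w i p.1 p.2 * w i p.1 p.2) (3 / 2)
      (spaceTime d T) := memLp_finsetSum _ fun i _ => h1 i
  simp only [pow_two, div_eq_inv_mul]
  exact h2.const_mul _

lemma memLp_fluctEnergy (hu : MemLp (fun p : ℝ × Torus d => u p.1 p.2) 3 (spaceTime d T))
    (hK : Continuous K) : SpaceTimeMemLp T (3 / 2) (fluctEnergy K u) :=
  memLp_half_sum_sq (w := fun i t x => u t x i - conv K (fun z => u t z i) x)
    fun i => memLp_fluct hu hK i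

lemma memLp_kinetic (hu : MemLp (fun p : ℝ × Torus d => u p.1 p.2) 3 (spaceTime d T)) :
    SpaceTimeMemLp T (3 / 2) fun t x => (∑ i, u t x i ^ 2) / 2 :=
  memLp_half_sum_sq (w := fun i t x => u t x i) fun i => memLp_coord hu i

lemma integrable_flux (hT : 0 < T)
    (hu : MemLp (fun p : ℝ × Torus d => u p.1 p.2) 3 (spaceTime d T)) (hq : IsPressure T u q)
    (i : Fin d) : SpaceTimeIntegrable T fun t x => ((∑ i, u t x i ^ 2) / 2 + q t x) * u t x i :=
  memLp_one_iff_integrable.1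
    (SpaceTimeMemLp.mul (F := fun t x => (∑ i, u t x i ^ 2) / 2 + q t x) (H := fun t x => u t x i)
      ((memLp_kinetic hu).add (hq.memLp hT hu)) (memLp_coord hu i))

lemma integrable_fluctFlux (hT : 0 < T)
    (hu : MemLp (fun p : ℝ × Torus d => u p.1 p.2) 3 (spaceTime d T)) (hq : IsPressure T u q)
    (hK : SmoothOnTorus K) (i : Fin d) :
    SpaceTimeIntegrable T fun t x => fluctFlux K u q t x i := by
  have hP := MemLpC.of_conv one_le_threeHalves threeHalves_ne_top (hq.memLp hT hu) hK.continuous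
  exact memLp_one_iff_integrable.1 (SpaceTimeMemLp.mul
    (F := fun t x => fluctEnergy K u t x + (q t x - conv K (q t) x))
    (H := fun t x => u t x i - conv K (fun z => u t z i) x)
    ((memLp_fluctEnergy hu hK.continuous).add ((hq.memLp hT hu).sub hP.memLp))
    (memLp_fluct hu hK.continuous i))

lemma integrable_fluctCommutator
    (hu : MemLp (fun p : ℝ × Torus d => u p.1 p.2) 3 (spaceTime d T)) (hK : SmoothOnTorus K) :
    SpaceTimeIntegrable T (fluctCommutator K u) := by
  have hw := fun i => memLp_fluct hu hK.continuous i
  have hV := fun i => memLpC_conv_u hu hK.continuous i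
  have hDV := fun j i => memLpC_conv_u hu (hK.pd j).continuous i
  have hDU : ∀ i j, MemLpC T (3 / 2) fun t => conv (pd j K) fun z => u t z i * u t z j :=
    fun i j => MemLpC.of_conv (F := fun t z => u t z i * u t z j) one_le_threeHalves
      threeHalves_ne_top (memLp_uu hu i j) (hK.pd j).continuous
  have h1 : ∀ i, MemLpC T (3 / 2) fun t x => ∑ j,
      (conv (pd j K) (fun z => u t z i) x * conv K (fun z => u t z j) x
        + conv K (fun z => u t z i) x * conv (pd j K) (fun z => u t z j) x
        - conv (pd j K) (fun z => u t z i * u t z j) x) := fun i =>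
    MemLpC.sum _ fun j _ => (((hDV j i).mul (hV j)).add ((hV i).mul (hDV j j))).sub (hDU i j)
  have h2 : ∀ i j, SpaceTimeIntegrable T fun t x =>
      (u t x i - conv K (fun z => u t z i) x) * (u t x j - conv K (fun z => u t z j) x)
      * conv (pd j K) (fun z => u t z i) x := fun i j =>
    memLp_one_iff_integrable.1
      (SpaceTimeMemLp.mul (r := 3 / 2) (SpaceTimeMemLp.mul (hw i) (hw j)) (hDV j i).memLp)
  exact (integrable_finsetSum _ fun i _ => (h1 i).integrable_mul (hw i)).add
    (integrable_finsetSum _ fun i _ => integrable_finsetSum _ fun j _ => h2 i j)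

lemma integrable_sum_sq_conv_pd
    (hu : MemLp (fun p : ℝ × Torus d => u p.1 p.2) 3 (spaceTime d T)) (hK : SmoothOnTorus K) :
    SpaceTimeIntegrable T fun t x => ∑ i, ∑ j,
      conv (pd j K) (fun z => u t z i) x * conv (pd j K) (fun z => u t z i) x := by
  have hDV := fun j i => memLpC_conv_u hu (hK.pd j).continuous i
  exact integrable_finsetSum _ fun i _ => integrable_finsetSum _ fun j _ =>
    ((hDV j i).mul (hDV j i) (r'' := 3 / 2)).integrable one_le_threeHalves

/-- The local energy balance of the fluctuation, before the viscous term `∇u : ∇V` is integrated by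
parts. -/
lemma fluct_energy_identity (hT : 0 < T) (hρ : IsMollifier ρ)
    (hu : MemLp (fun p : ℝ × Torus d => u p.1 p.2) 3 (spaceTime d T)) (hq : IsPressure T u q)
    (h : IsWeakSolution T ν u) (hK : SmoothOnTorus K) (hφ : IsTest T φ) :
    (∫ p, (∑ i, u p.1 p.2 i ^ 2) / 2 * dt φ p.1 p.2 ∂(spaceTime d T))
      + ν * (∫ p, (∑ i, u p.1 p.2 i ^ 2) / 2 * lapl (φ p.1) p.2 ∂(spaceTime d T))
      + (∫ p, (∑ i, ((∑ i, u p.1 p.2 i ^ 2) / 2 + q p.1 p.2) * u p.1 p.2 i * pd i (φ p.1) p.2)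
          ∂(spaceTime d T))
      - (∫ p, fluctEnergy K u p.1 p.2 * dt φ p.1 p.2 ∂(spaceTime d T))
      - (∫ p, fluctEnergy K u p.1 p.2 * (∑ i, (pd i (φ p.1) p.2 * conv K (fun z => u p.1 z i) p.2
          + φ p.1 p.2 * conv (pd i K) (fun z => u p.1 z i) p.2)) ∂(spaceTime d T))
      - ν * (∫ p, fluctEnergy K u p.1 p.2 * lapl (φ p.1) p.2 ∂(spaceTime d T))
      - (∫ p, (∑ i, fluctFlux K u q p.1 p.2 i * pd i (φ p.1) p.2) ∂(spaceTime d T))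
      + (∫ p, fluctCommutator K u p.1 p.2 * φ p.1 p.2 ∂(spaceTime d T))
      + ν * (∫ p, (∑ i, ∑ j, conv (pd j K) (fun z => u p.1 z i) p.2 *
          conv (pd j K) (fun z => u p.1 z i) p.2) * φ p.1 p.2 ∂(spaceTime d T))
    = -(2 * ν * ∫ p, (∑ i, ∑ j, u p.1 p.2 i *
        (pd j (φ p.1) p.2 * conv (pd j K) (fun z => u p.1 z i) p.2
        + φ p.1 p.2 * conv (pd j (pd j K)) (fun z => u p.1 z i) p.2)) ∂(spaceTime d T)) := by
  have hV := fun i => memLpC_conv_u hu hK.continuous i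
  have hDV := fun j i => memLpC_conv_u hu (hK.pd j).continuous i
  have hDDV := fun j i => memLpC_conv_u hu ((hK.pd j).pd j).continuous i
  have z5 := integralZero_mollified_energy hT hu hq h hK hφ
  have z6 := integralZero_correlation hT hρ hu hq h hK hφ
  have z1 := integralZero_u_grad hT hu h hK hφ
  have z2 := integralZero_fluct_grad hT hu hq h hK hφ
  have z3 := integralZero_green hT hu hK hφ
  have hA : SpaceTimeIntegrable T fun t x => (∑ i, u t x i ^ 2) / 2 :=
    MemLp.integrable one_le_threeHalves (memLp_kinetic hu)
  have hE : SpaceTimeIntegrable T (fluctEnergy K u) :=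
    MemLp.integrable one_le_threeHalves (memLp_fluctEnergy hu hK.continuous)
  have i1 := SpaceTimeIntegrable.mul_test hA hφ.dt
  have i2 := (SpaceTimeIntegrable.mul_test hA (hφ.lapl hT)).const_mul ν
  have i3 : SpaceTimeIntegrable T fun t x =>
      ∑ i, ((∑ i, u t x i ^ 2) / 2 + q t x) * u t x i * pd i (φ t) x :=
    integrable_finsetSum _ fun i _ => (integrable_flux hT hu hq i).mul_test (hφ.pd i)
  have i4 := SpaceTimeIntegrable.mul_test hE hφ.dt
  have hη : MemLpC T 3 fun t x => ∑ i, (pd i (φ t) x * conv K (fun z => u t z i) x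
      + φ t x * conv (pd i K) (fun z => u t z i) x) := MemLpC.sum _ fun i _ =>
    ((MemLpC.of_isTest (hφ.pd i)).mul (hV i)).add ((MemLpC.of_isTest hφ).mul (hDV i i))
  have i5 := hη.integrable_mul (memLp_fluctEnergy hu hK.continuous)
  have i6 := (SpaceTimeIntegrable.mul_test hE (hφ.lapl hT)).const_mul ν
  have i7 : SpaceTimeIntegrable T fun t x => ∑ i, fluctFlux K u q t x i * pd i (φ t) x :=
    integrable_finsetSum _ fun i _ => (integrable_fluctFlux hT hu hq hK i).mul_test (hφ.pd i)
  have i8 := (integrable_fluctCommutator hu hK).mul_test hφ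
  have i9 := ((integrable_sum_sq_conv_pd hu hK).mul_test hφ).const_mul ν
  have ix : SpaceTimeIntegrable T fun t x => ∑ i, ∑ j, u t x i *
        (pd j (φ t) x * conv (pd j K) (fun z => u t z i) x
        + φ t x * conv (pd j (pd j K)) (fun z => u t z i) x) :=
    integrable_finsetSum _ fun i _ => integrable_finsetSum _ fun j _ =>
      ((((MemLpC.of_isTest (hφ.pd j)).mul (hDV j i) (r'' := 3)).add ((MemLpC.of_isTest hφ).mul
        (hDDV j i))).mono_exponent threeHalves_le_three).integrable_mul
        (F := fun t x => u t x i) (memLp_coord hu i)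
  have j2 := Integrable.add i1 i2
  have j3 := Integrable.add j2 i3
  have j4 := Integrable.sub j3 i4
  have j5 := Integrable.sub j4 i5
  have j6 := Integrable.sub j5 i6
  have j7 := Integrable.sub j6 i7
  have j8 := Integrable.add j7 i8
  -- both sides become integrals of sums, so that the integrands can be compared pointwise
  have l1 := integral_add' j8 i9
  rw [integral_add' j7 i8, integral_sub' j6 i7, integral_sub' j5 i6, integral_sub' j4 i5,
    integral_sub' j3 i4, integral_add' j2 i3, integral_add' i1 i2] at l1
  have k1 := Integrable.sub z6.integrable (z5.integrable.div_const 2)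
  have k2 := Integrable.sub k1 z1.integrable
  have k3 := Integrable.add k2 z2.integrable
  have k4 := Integrable.add k3 (z3.integrable.const_mul ν)
  have l2 := integral_sub' k4 (ix.const_mul (2 * ν))
  rw [integral_add' k3 (z3.integrable.const_mul ν), integral_add' k2 z2.integrable,
    integral_sub' k1 z1.integrable, integral_sub' z6.integrable (z5.integrable.div_const 2)] at l2
  simp only [integral_const_mul, integral_div, z1.eq_zero, z2.eq_zero, z3.eq_zero, z5.eq_zero,
    z6.eq_zero] at l1 l2
  rw [← l1]
  refine Eq.trans (integral_congr_ae ?_) (l2.trans (by ring))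
  filter_upwards [ae_spaceTime_of_ae (ae_sum_conv_pd_eq_zero hT hu h hK),
    ae_spaceTime_of_ae (ae_integrable_u hu)] with p hdiv hint
  exact energy_algebra (u p.1 p.2) (fun i => conv K (fun z => u p.1 z i) p.2)
    (fun i => pd i (φ p.1) p.2) (fun i => conv (pd i K) (q p.1) p.2)
    (fun i => conv (lapl K) (fun z => u p.1 z i) p.2)
    (fun i j => conv (pd j K) (fun z => u p.1 z i) p.2)
    (fun i j => conv (pd j K) (fun z => u p.1 z i * u p.1 z j) p.2)
    (fun i j => conv (pd j (pd j K)) (fun z => u p.1 z i) p.2)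
    (φ p.1 p.2) (dt φ p.1 p.2) (lapl (φ p.1) p.2) (q p.1 p.2) (conv K (q p.1) p.2) ν
    (hdiv p.2) (fun i => sum_conv_pd_pd hK (hint i) p.2)

end Identity

/-! ### The terms of the modified energy identity -/

section Mollified

variable {d : ℕ} {T ν ℓ : ℝ} {u : ℝ → Torus d → Vec d} {q : ℝ → Torus d → ℝ}
  {φ : ℝ → Torus d → ℝ} {ρ : Vec d → ℝ}

lemma integrable_of_coord {α : Type*} [MeasurableSpace α] {μ : Measure α} {f : α → Vec d}
    (h : ∀ i, Integrable (fun a => f a i) μ) : Integrable f μ := by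
  have h1 : f = fun a => ∑ i, f a i • EuclideanSpace.single i (1 : ℝ) := by
    funext a
    ext j
    simp [Finset.sum_apply, Pi.single_apply]
  rw [h1]
  exact integrable_finsetSum _ fun i _ => (h i).smul_const _

/-- At almost every time, mollification is convolution with the periodized mollifier. -/
lemma ae_moll_eq_conv (hρ : IsMollifier ρ) (hℓ : 0 < ℓ)
    (hu : MemLp (fun p : ℝ × Torus d => u p.1 p.2) 3 (spaceTime d T)) (hq : IsPressure T u q) :
    ∀ᵐ t ∂(volume.restrict (Ioo 0 T)),
      (∀ x i, moll ρ ℓ (u t) x i = conv (mollKernel ρ ℓ) (fun z => u t z i) x) ∧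
      moll ρ ℓ (q t) = conv (mollKernel ρ ℓ) (q t) ∧
      ∀ i j, moll ρ ℓ (fun z => u t z i * u t z j)
        = conv (mollKernel ρ ℓ) (fun z => u t z i * u t z j) := by
  have hq' : SpaceTimeIntegrable T q := hq.integrable
  filter_upwards [ae_integrable_u hu, hq'.ae_integrable,
    ae_all_iff.2 fun i => ae_all_iff.2 fun j => (integrable_uu hu i j).ae_integrable]
    with t h1 h2 h3
  refine ⟨fun x i => ?_, moll_eq_conv hρ hℓ h2, fun i j => moll_eq_conv hρ hℓ (h3 i j)⟩
  rw [moll_apply hρ hℓ (integrable_of_coord h1), moll_eq_conv hρ hℓ (h1 i)]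

lemma ae_smooth_moll (hρ : IsMollifier ρ) (hℓ : 0 < ℓ)
    (hu : MemLp (fun p : ℝ × Torus d => u p.1 p.2) 3 (spaceTime d T)) (hq : IsPressure T u q) :
    ∀ᵐ t ∂(volume.restrict (Ioo 0 T)), SmoothOnTorus (moll ρ ℓ (u t)) := by
  filter_upwards [ae_moll_eq_conv hρ hℓ hu hq, ae_integrable_u hu] with t h1 h2
  refine contDiff_euclidean.2 fun i => ?_
  simp only [h1.1]
  exact (hρ.smooth_mollKernel hℓ).conv (h2 i)

lemma ae_smooth_Rterm (hρ : IsMollifier ρ) (hℓ : 0 < ℓ)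
    (hu : MemLp (fun p : ℝ × Torus d => u p.1 p.2) 3 (spaceTime d T)) (hq : IsPressure T u q) :
    ∀ᵐ t ∂(volume.restrict (Ioo 0 T)), ∀ i j, SmoothOnTorus fun x => Rterm ρ ℓ u t x i j := by
  filter_upwards [ae_moll_eq_conv hρ hℓ hu hq, ae_integrable_u hu,
    ae_all_iff.2 fun i => ae_all_iff.2 fun j => (integrable_uu hu i j).ae_integrable]
    with t h1 h2 h3 i j
  have hK := hρ.smooth_mollKernel hℓ
  simp only [Rterm, h1.1, h1.2.2]
  exact ((hK.conv (h2 i)).mul (hK.conv (h2 j))).sub (hK.conv (h3 i j))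

lemma ae_jac_moll (hρ : IsMollifier ρ) (hℓ : 0 < ℓ)
    (hu : MemLp (fun p : ℝ × Torus d => u p.1 p.2) 3 (spaceTime d T)) (hq : IsPressure T u q) :
    ∀ᵐ t ∂(volume.restrict (Ioo 0 T)), ∀ x i j,
      jac (moll ρ ℓ (u t)) x i j = conv (pd j (mollKernel ρ ℓ)) (fun z => u t z i) x := by
  filter_upwards [ae_moll_eq_conv hρ hℓ hu hq, ae_integrable_u hu] with t h1 h2 x i j
  simp only [jac, h1.1]
  exact congrFun (pd_conv (hρ.smooth_mollKernel hℓ) (h2 i) j) x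

lemma ae_Eterm (hρ : IsMollifier ρ) (hℓ : 0 < ℓ)
    (hu : MemLp (fun p : ℝ × Torus d => u p.1 p.2) 3 (spaceTime d T)) (hq : IsPressure T u q) :
    ∀ᵐ t ∂(volume.restrict (Ioo 0 T)), ∀ x,
      Eterm ρ ℓ u t x = fluctEnergy (mollKernel ρ ℓ) u t x := by
  filter_upwards [ae_moll_eq_conv hρ hℓ hu hq] with t h1 x
  simp only [Eterm, fluctEnergy, EuclideanSpace.real_norm_sq_eq, fluct, PiLp.sub_apply, h1.1]

lemma ae_Qterm (hρ : IsMollifier ρ) (hℓ : 0 < ℓ)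
    (hu : MemLp (fun p : ℝ × Torus d => u p.1 p.2) 3 (spaceTime d T)) (hq : IsPressure T u q) :
    ∀ᵐ t ∂(volume.restrict (Ioo 0 T)), ∀ x i,
      Qterm ρ ℓ u q t x i = fluctFlux (mollKernel ρ ℓ) u q t x i := by
  filter_upwards [ae_moll_eq_conv hρ hℓ hu hq] with t h1 x i
  simp only [Qterm, fluctFlux, fluctEnergy, EuclideanSpace.real_norm_sq_eq, fluct, PiLp.sub_apply,
    PiLp.smul_apply, smul_eq_mul, h1.1, h1.2.1]

lemma ae_Cterm (hρ : IsMollifier ρ) (hℓ : 0 < ℓ)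
    (hu : MemLp (fun p : ℝ × Torus d => u p.1 p.2) 3 (spaceTime d T)) (hq : IsPressure T u q) :
    ∀ᵐ t ∂(volume.restrict (Ioo 0 T)), ∀ x,
      Cterm ρ ℓ u t x = fluctCommutator (mollKernel ρ ℓ) u t x := by
  filter_upwards [ae_moll_eq_conv hρ hℓ hu hq, ae_jac_moll hρ hℓ hu hq, ae_integrable_u hu,
    ae_all_iff.2 fun i => ae_all_iff.2 fun j => (integrable_uu hu i j).ae_integrable]
    with t h1 h2 h3 h4 x
  have hK := hρ.smooth_mollKernel hℓ
  have hpd : ∀ j i, HasPd j (conv (mollKernel ρ ℓ) fun z => u t z i)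
      (conv (pd j (mollKernel ρ ℓ)) fun z => u t z i) := fun j i =>
    (hK.hasPd j).conv hK.continuous (hK.pd j).continuous (h3 i)
  have hR : ∀ i j, pd j (fun y => Rterm ρ ℓ u t y i j) x
      = conv (pd j (mollKernel ρ ℓ)) (fun z => u t z i) x
          * conv (mollKernel ρ ℓ) (fun z => u t z j) x
        + conv (mollKernel ρ ℓ) (fun z => u t z i) x
          * conv (pd j (mollKernel ρ ℓ)) (fun z => u t z j) x
        - conv (pd j (mollKernel ρ ℓ)) (fun z => u t z i * u t z j) x := by
    intro i j
    simp only [Rterm, h1.1, h1.2.2]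
    exact congrFun (((hpd j i).mul (hpd j j)).sub
      ((hK.hasPd j).conv hK.continuous (hK.pd j).continuous (h4 i j))).pd_eq x
  simp only [Cterm, fluctCommutator, frob, fluct, PiLp.sub_apply, h1.1, h2, hR]

lemma kinetic_eq (t : ℝ) (x : Torus d) : kinetic u t x = (∑ i, u t x i ^ 2) / 2 := by
  rw [kinetic, EuclideanSpace.real_norm_sq_eq]

lemma energyFlux_apply (t : ℝ) (x : Torus d) (i : Fin d) :
    energyFlux u q t x i = ((∑ i, u t x i ^ 2) / 2 + q t x) * u t x i := by
  rw [energyFlux, EuclideanSpace.real_norm_sq_eq]; rfl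

lemma SpaceTimeIntegrable.congr_ae {F H : ℝ → Torus d → ℝ} (hF : SpaceTimeIntegrable T F)
    (h : ∀ᵐ t ∂(volume.restrict (Ioo 0 T)), ∀ x, H t x = F t x) : SpaceTimeIntegrable T H :=
  Integrable.congr hF ((ae_spaceTime_of_ae h).mono fun p hp => (hp p.2).symm)

/-- The quantities that do not involve the viscosity are smooth or integrable. The cubic products
are estimated by Hölder with `u` in `L^3` and `q`, `|u|²` in `L^{3/2}`. -/
lemma termsMeaningful (hT : 0 < T) (hρ : IsMollifier ρ) (hℓ : 0 < ℓ)
    (hu : MemLp (fun p : ℝ × Torus d => u p.1 p.2) 3 (spaceTime d T)) (hq : IsPressure T u q) :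
    TermsMeaningful T ρ ℓ u q := by
  have hK := hρ.smooth_mollKernel hℓ
  have hE := memLp_fluctEnergy hu hK.continuous
  have aE := ae_Eterm hρ hℓ hu hq
  have am := ae_moll_eq_conv hρ hℓ hu hq
  refine ⟨ae_smooth_moll hρ hℓ hu hq, ae_smooth_Rterm hρ hℓ hu hq, ?_, ?_, ?_, ?_, ?_, ?_, ?_⟩
  · simp only [kinetic_eq]
    exact MemLp.integrable one_le_threeHalves (memLp_kinetic hu)
  · refine integrable_of_coord fun i => ?_
    simp only [energyFlux_apply]
    exact integrable_flux hT hu hq i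
  · exact SpaceTimeIntegrable.congr_ae (MemLp.integrable one_le_threeHalves hE) aE
  · refine integrable_of_coord fun i => ?_
    have := (memLpC_conv_u hu hK.continuous i).integrable_mul hE
    refine this.congr_ae (H := fun t x => (Eterm ρ ℓ u t x • moll ρ ℓ (u t) x) i) ?_
    filter_upwards [aE, am] with t h1 h2 x
    rw [PiLp.smul_apply, h1, h2.1, smul_eq_mul]
  · have hη : MemLpC T 3 fun t x => ∑ i, conv (pd i (mollKernel ρ ℓ)) (fun z => u t z i) x :=
      MemLpC.sum _ fun i _ => memLpC_conv_u hu (hK.pd i).continuous i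
    refine (hη.integrable_mul hE).congr_ae
      (H := fun t x => Eterm ρ ℓ u t x * divg (moll ρ ℓ (u t)) x) ?_
    filter_upwards [aE, ae_jac_moll hρ hℓ hu hq] with t h1 h2 x
    rw [h1]
    congr 1
    exact Finset.sum_congr rfl fun i _ => h2 x i i
  · refine integrable_of_coord fun i => ?_
    exact (integrable_fluctFlux hT hu hq hK i).congr_ae
      ((ae_Qterm hρ hℓ hu hq).mono fun t h x => h x i)
  · exact (integrable_fluctCommutator hu hK).congr_ae (ae_Cterm hρ hℓ hu hq)

lemma integrable_frob_jac_moll (hρ : IsMollifier ρ) (hℓ : 0 < ℓ)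
    (hu : MemLp (fun p : ℝ × Torus d => u p.1 p.2) 3 (spaceTime d T)) (hq : IsPressure T u q) :
    SpaceTimeIntegrable T fun t x => frob (jac (moll ρ ℓ (u t)) x) (jac (moll ρ ℓ (u t)) x) := by
  refine (integrable_sum_sq_conv_pd hu (hρ.smooth_mollKernel hℓ)).congr_ae ?_
  filter_upwards [ae_jac_moll hρ hℓ hu hq] with t h x
  simp only [frob, h]

lemma IsL2H1.integrable_frob {G : ℝ → Torus d → Fin d → Fin d → ℝ} (hG : IsL2H1 T u G) :
    SpaceTimeIntegrable T fun t x => frob (G t x) (G t x) :=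
  integrable_finsetSum _ fun i _ => integrable_finsetSum _ fun j _ =>
    (hG.grad_memLp i j).integrable_mul (hG.grad_memLp i j)

lemma IsL2H1.integrable_frob_jac {G : ℝ → Torus d → Fin d → Fin d → ℝ} (hG : IsL2H1 T u G)
    (hρ : IsMollifier ρ) (hℓ : 0 < ℓ)
    (hu : MemLp (fun p : ℝ × Torus d => u p.1 p.2) 3 (spaceTime d T)) (hq : IsPressure T u q) :
    SpaceTimeIntegrable T fun t x => frob (G t x) (jac (moll ρ ℓ (u t)) x) := by
  have hK := hρ.smooth_mollKernel hℓ
  have h1 : SpaceTimeIntegrable T fun t x => ∑ i, ∑ j, G t x i j *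
      conv (pd j (mollKernel ρ ℓ)) (fun z => u t z i) x :=
    integrable_finsetSum _ fun i _ => integrable_finsetSum _ fun j _ =>
      (hG.grad_memLp i j).integrable_mul ((memLpC_conv_u hu (hK.pd j).continuous i).mono_exponent
        (by norm_num : (2 : ℝ≥0∞) ≤ 3)).memLp
  refine h1.congr_ae ?_
  filter_upwards [ae_jac_moll hρ hℓ hu hq] with t h x
  simp only [frob, h]

lemma integral_congr_ae_time {F H : ℝ → Torus d → ℝ}
    (h : ∀ᵐ t ∂(volume.restrict (Ioo 0 T)), ∀ x, F t x = H t x) :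
    ∫ p, F p.1 p.2 ∂(spaceTime d T) = ∫ p, H p.1 p.2 ∂(spaceTime d T) :=
  integral_congr_ae ((ae_spaceTime_of_ae h).mono fun p hp => hp p.2)

lemma pairDiv_eq {V : ℝ → Torus d → Vec d} {W : ℝ → Torus d → Fin d → ℝ}
    (h : ∀ᵐ t ∂(volume.restrict (Ioo 0 T)), ∀ x i, V t x i = W t x i) :
    pairDiv T V φ = -∫ p, (∑ i, W p.1 p.2 i * pd i (φ p.1) p.2) ∂(spaceTime d T) := by
  rw [pairDiv]
  congr 1
  refine integral_congr_ae_time (F := fun t x => inner ℝ (V t x) (grad (φ t) x))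
    (H := fun t x => ∑ i, W t x i * pd i (φ t) x) (h.mono fun t ht x => ?_)
  simp only [grad, PiLp.inner_apply, RCLike.inner_apply, conj_trivial, ht]
  exact Finset.sum_congr rfl fun i _ => mul_comm _ _

/-- The modified energy identity, before the viscous term `∇u : ∇u_ℓ` is integrated by parts. -/
lemma mollified_balance (hT : 0 < T) (hρ : IsMollifier ρ) (hℓ : 0 < ℓ)
    (hu : MemLp (fun p : ℝ × Torus d => u p.1 p.2) 3 (spaceTime d T)) (hq : IsPressure T u q)
    (h : IsWeakSolution T ν u) (hφ : IsTest T φ) :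
    pairDt T (kinetic u) φ - ν * pairLapl T (kinetic u) φ + pairDiv T (energyFlux u q) φ
      = pairDt T (Eterm ρ ℓ u) φ
          + pairTransport T (fun t => moll ρ ℓ (u t)) (Eterm ρ ℓ u) φ
          - ν * pairLapl T (Eterm ρ ℓ u) φ
          + pairDiv T (Qterm ρ ℓ u q) φ
          + pair T (Cterm ρ ℓ u) φ
          + ν * pair T (fun t x =>
              frob (jac (moll ρ ℓ (u t)) x) (jac (moll ρ ℓ (u t)) x)) φ
          + 2 * ν * ∫ p, (∑ i, ∑ j, u p.1 p.2 i *
            (pd j (φ p.1) p.2 * conv (pd j (mollKernel ρ ℓ)) (fun z => u p.1 z i) p.2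
            + φ p.1 p.2 * conv (pd j (pd j (mollKernel ρ ℓ))) (fun z => u p.1 z i) p.2))
            ∂(spaceTime d T) := by
  have hK := hρ.smooth_mollKernel hℓ
  have aE := ae_Eterm hρ hℓ hu hq
  have key := fluct_energy_identity hT hρ hu hq h hK hφ
  have eE : ∀ ψ : ℝ → Torus d → ℝ, ∫ p, Eterm ρ ℓ u p.1 p.2 * ψ p.1 p.2 ∂(spaceTime d T)
      = ∫ p, fluctEnergy (mollKernel ρ ℓ) u p.1 p.2 * ψ p.1 p.2 ∂(spaceTime d T) := fun ψ =>
    integral_congr_ae_time (F := fun t x => Eterm ρ ℓ u t x * ψ t x)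
      (H := fun t x => fluctEnergy (mollKernel ρ ℓ) u t x * ψ t x)
      (aE.mono fun t h x => by rw [h])
  -- `div (φ u_ℓ)` expanded by the product rule
  have eTr : pairTransport T (fun t => moll ρ ℓ (u t)) (Eterm ρ ℓ u) φ
      = -∫ p, fluctEnergy (mollKernel ρ ℓ) u p.1 p.2 *
        (∑ i, (pd i (φ p.1) p.2 * conv (mollKernel ρ ℓ) (fun z => u p.1 z i) p.2
          + φ p.1 p.2 * conv (pd i (mollKernel ρ ℓ)) (fun z => u p.1 z i) p.2))
        ∂(spaceTime d T) := by
    rw [pairTransport]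
    congr 1
    refine integral_congr_ae_time
      (F := fun t x => Eterm ρ ℓ u t x * divg (fun y => φ t y • moll ρ ℓ (u t) y) x)
      (H := fun t x => fluctEnergy (mollKernel ρ ℓ) u t x *
        (∑ i, (pd i (φ t) x * conv (mollKernel ρ ℓ) (fun z => u t z i) x
          + φ t x * conv (pd i (mollKernel ρ ℓ)) (fun z => u t z i) x))) ?_
    filter_upwards [aE, ae_moll_eq_conv hρ hℓ hu hq, ae_integrable_u hu] with t h1 h2 h3 x
    rw [h1]
    congr 1
    simp only [divg, PiLp.smul_apply, smul_eq_mul, h2.1,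
      pd_mul_conv (hφ.smoothOnTorus t) hK (h3 _)]
  have eC : pair T (Cterm ρ ℓ u) φ
      = ∫ p, fluctCommutator (mollKernel ρ ℓ) u p.1 p.2 * φ p.1 p.2 ∂(spaceTime d T) :=
    integral_congr_ae_time (F := fun t x => Cterm ρ ℓ u t x * φ t x)
      (H := fun t x => fluctCommutator (mollKernel ρ ℓ) u t x * φ t x)
      ((ae_Cterm hρ hℓ hu hq).mono fun t h x => by rw [h])
  have eJ : pair T (fun t x => frob (jac (moll ρ ℓ (u t)) x) (jac (moll ρ ℓ (u t)) x)) φ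
      = ∫ p, (∑ i, ∑ j, conv (pd j (mollKernel ρ ℓ)) (fun z => u p.1 z i) p.2 *
          conv (pd j (mollKernel ρ ℓ)) (fun z => u p.1 z i) p.2) * φ p.1 p.2 ∂(spaceTime d T) :=
    integral_congr_ae_time
      (F := fun t x => frob (jac (moll ρ ℓ (u t)) x) (jac (moll ρ ℓ (u t)) x) * φ t x)
      (H := fun t x => (∑ i, ∑ j, conv (pd j (mollKernel ρ ℓ)) (fun z => u t z i) x *
          conv (pd j (mollKernel ρ ℓ)) (fun z => u t z i) x) * φ t x)
      ((ae_jac_moll hρ hℓ hu hq).mono fun t h x => by simp only [frob, h])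
  rw [eTr, eC, eJ, pairDiv_eq (ae_Qterm hρ hℓ hu hq),
    pairDiv_eq (.of_forall fun t x i => energyFlux_apply t x i)]
  simp only [pairDt, pairLapl, eE (fun t x => dt φ t x), eE (fun t x => lapl (φ t) x), kinetic_eq]
  linarith

/-- The viscous cross term of `mollified_balance` is the pairing with `∇u : ∇u_ℓ`. -/
lemma pair_frob_jac_moll (hT : 0 < T) (hρ : IsMollifier ρ) (hℓ : 0 < ℓ)
    (hu : MemLp (fun p : ℝ × Torus d => u p.1 p.2) 3 (spaceTime d T)) (hq : IsPressure T u q)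
    {G : ℝ → Torus d → Fin d → Fin d → ℝ} (hG : IsL2H1 T u G) (hφ : IsTest T φ) :
    ∫ p, (∑ i, ∑ j, u p.1 p.2 i *
      (pd j (φ p.1) p.2 * conv (pd j (mollKernel ρ ℓ)) (fun z => u p.1 z i) p.2
      + φ p.1 p.2 * conv (pd j (pd j (mollKernel ρ ℓ))) (fun z => u p.1 z i) p.2))
      ∂(spaceTime d T) = -pair T (fun t x => frob (G t x) (jac (moll ρ ℓ (u t)) x)) φ := by
  rw [integral_u_mul_pd_eq hT hG hu (hρ.smooth_mollKernel hℓ) hφ, pair]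
  congr 1
  exact integral_congr_ae_time
    (F := fun t x => (∑ i, ∑ j, G t x i j *
      conv (pd j (mollKernel ρ ℓ)) (fun z => u t z i) x) * φ t x)
    (H := fun t x => frob (G t x) (jac (moll ρ ℓ (u t)) x) * φ t x)
    ((ae_jac_moll hρ hℓ hu hq).mono fun t h x => by simp only [frob, h])

end Mollified

end TorusFluid

theorem proposition1p3 {d : ℕ} {T : ℝ} (hT : 0 < T)
    {ρ : Vec d → ℝ} (hρ : IsMollifier ρ)
    (u : ℝ → Torus d → Vec d) (q : ℝ → Torus d → ℝ)
    (hu : MemLp (fun p : ℝ × Torus d => u p.1 p.2) 3 (spaceTime d T))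
    (hq : IsPressure T u q) :
    -- the Euler equations
    (IsWeakSolution T 0 u → ∀ ℓ : ℝ, 0 < ℓ →
      TermsMeaningful T ρ ℓ u q ∧
      ∀ φ : ℝ → Torus d → ℝ, IsTest T φ →
        -duchonRobert T u q φ =
          pairDt T (Eterm ρ ℓ u) φ
          + pairTransport T (fun t => moll ρ ℓ (u t)) (Eterm ρ ℓ u) φ
          + pairDiv T (Qterm ρ ℓ u q) φ
          + pair T (Cterm ρ ℓ u) φ) ∧
    -- the Navier--Stokes equations with viscosity `ν ≥ 0`
    (∀ (ν : ℝ) (G : ℝ → Torus d → Fin d → Fin d → ℝ), 0 ≤ ν → IsWeakSolution T ν u →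
      (0 < ν → IsL2H1 T u G) → ∀ ℓ : ℝ, 0 < ℓ →
      TermsMeaningful T ρ ℓ u q ∧
      Integrable (fun p : ℝ × Torus d =>
        frob (jac (moll ρ ℓ (u p.1)) p.2) (jac (moll ρ ℓ (u p.1)) p.2)) (spaceTime d T) ∧
      (0 < ν → Integrable (fun p : ℝ × Torus d =>
        frob (G p.1 p.2) (G p.1 p.2)) (spaceTime d T) ∧
        Integrable (fun p : ℝ × Torus d =>
          frob (G p.1 p.2) (jac (moll ρ ℓ (u p.1)) p.2)) (spaceTime d T)) ∧
      ∀ φ : ℝ → Torus d → ℝ, IsTest T φ →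
        -(duchonRobertNS T ν u q G φ + ν * pair T (fun t x => frob (G t x) (G t x)) φ) =
          pairDt T (Eterm ρ ℓ u) φ
          + pairTransport T (fun t => moll ρ ℓ (u t)) (Eterm ρ ℓ u) φ
          - ν * pairLapl T (Eterm ρ ℓ u) φ
          + pairDiv T (Qterm ρ ℓ u q) φ
          + pair T (Cterm ρ ℓ u) φ
          + ν * pair T (fun t x =>
              frob (jac (moll ρ ℓ (u t)) x) (jac (moll ρ ℓ (u t)) x)) φ
          - 2 * ν * pair T (fun t x => frob (G t x) (jac (moll ρ ℓ (u t)) x)) φ) := by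
  refine ⟨fun h ℓ hℓ => ⟨termsMeaningful hT hρ hℓ hu hq, fun φ hφ => ?_⟩,
    fun ν G hν h hG ℓ hℓ => ⟨termsMeaningful hT hρ hℓ hu hq,
      integrable_frob_jac_moll hρ hℓ hu hq,
      fun hν' => ⟨(hG hν').integrable_frob, (hG hν').integrable_frob_jac hρ hℓ hu hq⟩,
      fun φ hφ => ?_⟩⟩
  · have key := mollified_balance hT hρ hℓ hu hq h hφ
    rw [duchonRobert]
    linarith
  · have key := mollified_balance hT hρ hℓ hu hq h hφ
    rw [duchonRobertNS]
    rcases hν.eq_or_lt with rfl | hν'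
    · linarith
    · rw [pair_frob_jac_moll hT hρ hℓ hu hq (hG hν') hφ] at key
      linarith
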